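/- **Proposition 5.7 (type B PBW degrees).** Let $1\le k\le n$, let $\mathfrak g=\mathfrak{so}_{2n+1}(\mathbb C)$ be the Lie algebra of the symmetric form on $\mathbb C^{2n+1}$ with $(e_i,e_j)=\delta_{i+j,2n+2}$ in the standard basis $e_1,\dots,e_{2n+1}$, and let $\mathfrak h$, $\mathfrak n$, $\mathfrak n^-$ be its diagonal, strictly upper triangular and strictly lower triangular parts. Let $\varepsilon_i\in\mathfrak h^*$ $(1\le i\le n)$ be the $i$-th diagonal entry. The positive roots are $\varepsilon_i$ and $\varepsilon_i\pm\varepsilon_j$ $(i<j)$, the fundamental weights are $\omega_k=\varepsilon_1+\dots+\varepsilon_k$ for $k<n$ and $\omega_n=\frac12(\varepsilon_1+\dots+\varepsilon_n)$, and the Weyl group $W$ consists of all signed permutations of $\varepsilon_1,\dots,\varepsilon_n$. Let $V_{\omega_k}$ be the irreducible $\mathfrak g$-module with highest weight vector $v_{\omega_k}$ of weight $\omega_k$; for $k<n$ it is isomorphic to $\Lambda^k(\mathbb C^{2n+1})$. For $w\in W$ let $v_{w(\omega_k)}\in V_{\omega_k}$ be a nonzero vector of weight $w(\omega_k)$ (it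 is unique up to a scalar). Put $$F_s=\mathrm{span}\{x_1\cdots x_l\,v_{\omega_k}:\ x_i\in\mathfrak n^-,\ l\le s\}\ (s\ge 0),\qquad F_{-1}=0 .$$ Let $d(\omega_k,w)$, the PBW degree of $v_{w(\omega_k)}$, be the $s$ with $v_{w(\omega_k)}\in F_s\setminus F_{s-1}$, and let $n(\omega_k,w)$ be the minimal number of terms in a decomposition of $\omega_k-w(\omega_k)$ into a sum of positive roots (repetitions allowed). Then $d(\omega_k,w)=n(\omega_k,w)$, unless $3\le k\le n-1$ and there is a subset $I\subset\{1,\dots,k\}$ with $\#I=2s+3$ for some integer $s\ge 0$ such that, under an isomorphism of $\mathfrak g$-modules $V_{\omega_k}\cong\Lambda^k(\mathbb C^{2n+1})$ and up to a nonzero scalar, $$v_{w(\omega_k)}=\bigwedge_{i\le k,\ i\notin I}e_i\ \wedge\ \bigwedge_{i\in I}e_{2n+2-i}.$$ In the latter case $d(\omega_k,w)=n(\omega_k,w)+1$. -/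

import Mathlib

-- The commutator bracket on matrices.
attribute [local instance 100] LieRing.ofAssociativeRing

namespace TypeB

noncomputable section

/-! ### The Lie algebra `so_{2n+1}`

It is taken with respect to the symmetric form on `ℂ^{2n+1}` whose Gram matrix in the standard basis
`e_1, …, e_{2n+1}` is the antidiagonal matrix.  The index `i : Fin (2 * n + 1)` stands for
`e_{i+1}`, and `i.rev` stands for `e_{2n+1-i} = e_{2n+2-(i+1)}`. -/

/-- The matrix with ones on the antidiagonal and zeros elsewhere. -/
def antidiag (n : ℕ) : Matrix (Fin (2 * n + 1)) (Fin (2 * n + 1)) ℂ :=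
  Matrix.of fun i j => if j = i.rev then 1 else 0

/-- The complex Lie algebra `so_{2n+1}` of matrices skew-adjoint for the antidiagonal form. -/
abbrev so (n : ℕ) : LieSubalgebra ℂ (Matrix (Fin (2 * n + 1)) (Fin (2 * n + 1)) ℂ) :=
  skewAdjointMatricesLieSubalgebra (antidiag n)

/-- The elements of the Cartan subalgebra: the diagonal matrices in `so_{2n+1}`, which are
`diag(t_1, …, t_n, 0, -t_n, …, -t_1)`. -/
def IsCartan {n : ℕ} (x : so n) : Prop :=
  ∀ i j, i ≠ j → x.1 i j = 0

/-- The elements of `𝔫`: strictly upper triangular matrices in `so_{2n+1}`. -/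
def IsUpper {n : ℕ} (x : so n) : Prop :=
  ∀ i j, j ≤ i → x.1 i j = 0

/-- The elements of `𝔫⁻`: strictly lower triangular matrices in `so_{2n+1}`. -/
def IsLower {n : ℕ} (x : so n) : Prop :=
  ∀ i j, i ≤ j → x.1 i j = 0

/-! ### Roots, weights and the Weyl group of type `B_n`

Weights are written in coordinates with respect to `ε_1, …, ε_n`, where `ε_i` sends
`diag(t_1, …, t_n, 0, -t_n, …, -t_1)` to `t_i`. -/

/-- The vector `ε_i`. -/
def eps {n : ℕ} (i : Fin n) : Fin n → ℝ := Pi.single i 1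

/-- The positive roots of type `B_n`: `ε_i`, and `ε_i - ε_j`, `ε_i + ε_j` for `i < j`. -/
def posRoots (n : ℕ) : Set (Fin n → ℝ) :=
  {β | (∃ i, β = eps i) ∨ ∃ i j, i < j ∧ (β = eps i - eps j ∨ β = eps i + eps j)}

/-- The fundamental weight `ω_k` (`1 ≤ k ≤ n`): it is `ε_1 + ⋯ + ε_k` for `k < n`, and
`(ε_1 + ⋯ + ε_n) / 2` for `k = n`. -/
def fundWeight (n k : ℕ) : Fin n → ℝ :=
  fun i => if k < n then (if (i : ℕ) < k then 1 else 0) else 1 / 2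

/-- The Weyl group of type `B_n`, as the set of signed permutations `w = (w_1, …, w_n)`:
`|w_i|` is `perm i`, and the sign of `w_i` is `sign i`. -/
structure SignedPerm (n : ℕ) where
  /-- the underlying permutation `i ↦ |w_i|` -/
  perm : Equiv.Perm (Fin n)
  /-- the signs -/
  sign : Fin n → ℤˣ

/-- The linear action of the Weyl group on weights, `w(ε_i) = ± ε_{|w_i|}` with the sign of
`w_i`. -/
def SignedPerm.act {n : ℕ} (w : SignedPerm n) (μ : Fin n → ℝ) : Fin n → ℝ :=
  ∑ i, (μ i * ((w.sign i : ℤ) : ℝ)) • eps (w.perm i)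

/-- The numbers of terms in the decompositions of `μ` into sums of positive roots (with
repetitions allowed). The least element of this set for `μ = λ - w(λ)` is the `q`-Kostant degree
`n(λ, w)`. -/
def decompositionLengths {n : ℕ} (μ : Fin n → ℝ) : Set ℕ :=
  {N | ∃ β : Fin N → (Fin n → ℝ), (∀ j, β j ∈ posRoots n) ∧ ∑ j, β j = μ}

/-! ### Modules -/

section Modules

variable {n : ℕ} {V : Type*} [AddCommGroup V] [Module ℂ V] [LieRingModule (so n) V]

/-- `v` is a nonzero vector of weight `μ`. -/
def IsWeightVector (μ : Fin n → ℝ) (v : V) : Prop :=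
  v ≠ 0 ∧ ∀ x : so n, IsCartan x →
    ⁅x, v⁆ = (∑ i : Fin n, (μ i : ℂ) *
      x.1 (Fin.castLE (by omega) i) (Fin.castLE (by omega) i)) • v

/-- `v` is a highest weight vector of weight `μ`. -/
def IsHighestWeightVector (μ : Fin n → ℝ) (v : V) : Prop :=
  IsWeightVector μ v ∧ ∀ x : so n, IsUpper x → ⁅x, v⁆ = 0

/-- The PBW filtration defined by the highest weight vector `v₀`:
`F_s = span {x_1 ⋯ x_l v₀ : x_i ∈ 𝔫⁻, l ≤ s}`. -/
def pbwFiltration (n : ℕ) {V : Type*} [AddCommGroup V] [Module ℂ V] [LieRingModule (so n) V]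
    (v₀ : V) (s : ℕ) : Submodule ℂ V :=
  Submodule.span ℂ {u | ∃ l : List (so n), l.length ≤ s ∧ (∀ x ∈ l, IsLower x) ∧
    u = l.foldr (fun x y => ⁅x, y⁆) v₀}

/-- `v` has PBW degree `s`: it lies in `F_s` and in no earlier step of the filtration
(nor is it zero, which is the case `F_{-1} = 0`). -/
def HasPBWDegree (n : ℕ) {V : Type*} [AddCommGroup V] [Module ℂ V] [LieRingModule (so n) V]
    (v₀ v : V) (s : ℕ) : Prop :=
  v ≠ 0 ∧ v ∈ pbwFiltration n v₀ s ∧ ∀ t < s, v ∉ pbwFiltration n v₀ t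

/-- `φ` is an isomorphism of `so_{2n+1}`-modules from the `k`-th exterior power of the vector
representation `ℂ^{2n+1}` to `V`, i.e. it intertwines
`x (m_1 ∧ ⋯ ∧ m_k) = ∑ i, m_1 ∧ ⋯ ∧ x m_i ∧ ⋯ ∧ m_k` with the action on `V`. -/
def IsExteriorPowerIso {k : ℕ} (φ : (⋀[ℂ]^k (Fin (2 * n + 1) → ℂ)) ≃ₗ[ℂ] V) : Prop :=
  ∀ (x : so n) (m : Fin k → (Fin (2 * n + 1) → ℂ)),
    ⁅x, φ (exteriorPower.ιMulti ℂ k m)⁆ =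
      ∑ i, φ (exteriorPower.ιMulti ℂ k (Function.update m i (x.1.mulVec (m i))))

end Modules

/-- For `I ⊆ {1, …, k}`, the wedge product of the `e_i` (`i ≤ k`, `i ∉ I`) and of the
`e_{2n+2-i}` (`i ∈ I`), each factor standing in the `i`-th place. -/
def flippedWedge {n k : ℕ} (hk : k ≤ n) (I : Finset (Fin k)) :
    ⋀[ℂ]^k (Fin (2 * n + 1) → ℂ) :=
  exteriorPower.ιMulti ℂ k fun i =>
    if i ∈ I then Pi.single (Fin.castLE (by omega) i : Fin (2 * n + 1)).rev 1
    else Pi.single (Fin.castLE (by omega) i : Fin (2 * n + 1)) 1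

/-- The exceptional extremal vectors: `3 ≤ k ≤ n - 1` and, under an identification of `V` with the
`k`-th exterior power of the vector representation (unique up to a scalar when `V` is irreducible),
`v` is the wedge product with flipped set `I ⊆ {1, …, k}` of cardinality `2s + 3`, `s ≥ 0`. -/
def IsExceptional {n k : ℕ} (hk : k ≤ n) {V : Type*} [AddCommGroup V] [Module ℂ V]
    [LieRingModule (so n) V] (v : V) : Prop :=
  3 ≤ k ∧ k < n ∧ ∃ (I : Finset (Fin k)) (s : ℕ), I.card = 2 * s + 3 ∧
    ∃ φ : (⋀[ℂ]^k (Fin (2 * n + 1) → ℂ)) ≃ₗ[ℂ] V,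
      IsExteriorPowerIso φ ∧ v = φ (flippedWedge hk I)

end

end TypeB

/-! The filtration is spanned by words in negative root vectors applied to the highest weight
vector, and each such word is a weight vector. A nonzero weight vector in $F_s$ therefore forces a
decomposition of $\omega_k-w(\omega_k)$ into at most $s$ positive roots
(`exists_mem_decompositionLengths`), so $d\ge n$ always. Placing the vector in $F_N$ for some lower
bound $N$ of all decomposition lengths then settles both numbers at once (`hasPBWDegree_of_le`).

For $k<n$ the module is identified with $\Lambda^k$. The exterior power is irreducible
(`isIrreducible_exteriorPower`), and irreducible modules with the same highest weight are isomorphic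
(`exists_equiv_of_isIrreducible`). The extremal vector becomes a monomial, ordered so that its
$i$-th factor is $e_i$, or $e_{\bar i}$ (a flip; $\bar i=2n+2-i$), or $e_{\pm j}$ with $j>k$ (a
move). Let there be $f$ flips and $m$ moves. A positive root has $\ell^1$-norm at most 2, and this
gives $n\ge f+m$. Conversely a move costs one root vector, two flips cost two applications of the
root vector of $-(\varepsilon_i+\varepsilon_j)$, and a last unpaired flip can be combined with a
move. If $f$ is odd and $m=0$, the last flip has to pass through $e_{n+1}$ and costs two. This is
still optimal for $f=1$, where a coordinate of the weight difference equals 2.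

In the remaining case, $f\ge3$ odd and $m=0$, a cyclic sum of roots $\varepsilon_a+\varepsilon_b$
gives $n=f$, while $d\le f+1$. It remains to see that the vector is not in $F_f$
(`IsStandard.form_word_eq_zero`). The sum of coordinates forces every letter of a word of length at
most $f$ and of the right weight to belong to some $\varepsilon_a+\varepsilon_b$ with $a,b$ flipped,
and these root vectors commute. The involution of indices exchanging $e_i$ and $e_{\bar i}$ for the
flipped $i$ carries $e_1\wedge\dots\wedge e_k$ to the extremal monomial. Twisting the standard form
by it makes the letters skew-adjoint. The coefficient $c$ of the extremal monomial in the word thus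
satisfies $c=(-1)^f c=-c$ and vanishes.

For $k=n$ no model of the spin module is built. Extremal weight spaces are lines, by
$\mathfrak{sl}_2$-theory for the simple roots (`mem_span_singleton_of_mem_wtSpace_spinWt`). A vector
with minus signs on $T$ is reached by $\lceil |T|/2\rceil$ root vectors (`exists_spin_vector`), and
the $\ell^1$-norm shows that fewer roots cannot suffice. -/

namespace TypeB

/-! ### Matrix coordinates for $\mathfrak{so}_{2n+1}$ and its root vectors -/

noncomputable section

variable {n : ℕ}

/-! ### Elements of `so_{2n+1}` -/

/-- The index of `e_i`, `1 ≤ i ≤ n`, among the indices of the standard basis. -/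
def pos (i : Fin n) : Fin (2 * n + 1) := Fin.castLE (by omega) i

@[simp] theorem val_pos (i : Fin n) : (pos i : ℕ) = i := rfl

theorem pos_injective : Function.Injective (pos (n := n)) := fun i j h => by
  simpa [Fin.ext_iff] using h

/-- The middle index. -/
def mid (n : ℕ) : Fin (2 * n + 1) := ⟨n, by omega⟩

@[simp] theorem val_mid : (mid n : ℕ) = n := rfl

theorem rev_mid : (mid n).rev = mid n := by
  ext; simp [Fin.val_rev]; omega

theorem pos_ne_rev (i j : Fin n) : pos i ≠ (pos j).rev := by
  intro h; have := congrArg Fin.val h; simp [Fin.val_rev] at this; omega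

theorem pos_ne_mid (i : Fin n) : pos i ≠ mid n := by
  intro h; have := congrArg Fin.val h; simp at this; omega

theorem rev_pos_ne_mid (i : Fin n) : (pos i).rev ≠ mid n := by
  intro h; have := congrArg Fin.val h; simp [Fin.val_rev] at this; omega

/-- Every index is that of some `e_i` with `i ≤ n`, the middle one, or that of some `e_{2n+2-i}`. -/
theorem index_cases (p : Fin (2 * n + 1)) :
    (∃ i, p = pos i) ∨ p = mid n ∨ ∃ i, p = (pos i).rev := by
  rcases lt_trichotomy (p : ℕ) n with h | h | h
  · exact Or.inl ⟨⟨p, h⟩, by ext; rfl⟩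
  · exact Or.inr (Or.inl (by ext; exact h))
  · refine Or.inr (Or.inr ⟨⟨2 * n - p, by omega⟩, ?_⟩)
    ext; simp [Fin.val_rev]; omega

theorem mem_so {x : Matrix (Fin (2 * n + 1)) (Fin (2 * n + 1)) ℂ} :
    x ∈ so n ↔ ∀ i j, x i j = - x j.rev i.rev := by
  rw [mem_skewAdjointMatricesLieSubalgebra, mem_skewAdjointMatricesSubmodule,
    Matrix.IsSkewAdjoint, Matrix.IsAdjointPair]
  have h1 : ∀ i j, (x.transpose * antidiag n) i j = x j.rev i := by
    intro i j
    rw [Matrix.mul_apply, Finset.sum_eq_single j.rev]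
    · simp [antidiag]
    · intro b _ hb
      have : j ≠ b.rev := fun h => hb (by simp [h])
      simp [antidiag, this]
    · simp
  have h2 : ∀ i j, (antidiag n * -x) i j = - x i.rev j := by
    intro i j
    rw [Matrix.mul_apply, Finset.sum_eq_single i.rev]
    · simp [antidiag]
    · intro b _ hb
      simp [antidiag, hb]
    · simp
  constructor
  · intro h i j
    have := congrFun (congrFun h j) i.rev
    rw [h1, h2] at this
    simpa using this
  · intro h
    ext i j
    rw [h1, h2, h]; simp

theorem apply_eq_neg_rev (x : so n) (i j : Fin (2 * n + 1)) : x.1 i j = - x.1 j.rev i.rev :=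
  mem_so.1 x.2 i j

/-- The element `E_{qp} - E_{\bar p \bar q}` of `so_{2n+1}`, which sends `e_p` to `e_q` and
`e_{\bar q}` to `-e_{\bar p}`. -/
def elt (p q : Fin (2 * n + 1)) : so n :=
  ⟨Matrix.single q p 1 - Matrix.single p.rev q.rev 1, mem_so.2 fun i j => by
    simp only [Matrix.sub_apply, Matrix.single_apply, neg_sub, Fin.rev_inj]
    congr 1
    · simp only [and_comm]
    · simp only [Fin.rev_eq_iff, and_comm]⟩

theorem elt_apply (p q i j : Fin (2 * n + 1)) :
    (elt p q).1 i j = (if q = i ∧ p = j then 1 else 0) - (if p.rev = i ∧ q.rev = j then 1 else 0) := by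
  simp [elt, Matrix.single_apply]

theorem elt_rev_self (p : Fin (2 * n + 1)) : elt p p.rev = 0 := by
  ext i j; simp [elt_apply]

theorem elt_rev_rev (p q : Fin (2 * n + 1)) : elt q.rev p.rev = - elt p q := by
  ext i j; simp [elt_apply]

theorem elt_mulVec_single (p q r : Fin (2 * n + 1)) :
    (elt p q).1.mulVec (Pi.single r 1) =
      (if r = p then Pi.single q 1 else 0) - (if r = q.rev then Pi.single p.rev 1 else 0) := by
  ext i
  rw [Matrix.mulVec_single_one, Matrix.col_apply, elt_apply]
  simp only [Pi.sub_apply]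
  congr 1
  · by_cases h1 : r = p <;> by_cases h2 : i = q <;> simp [h1, h2, eq_comm]
    all_goals first | exact Ne.symm ‹_› | exact fun _ => Ne.symm h1
  · by_cases h1 : r = q.rev <;> by_cases h2 : i = p.rev <;> simp [h1, h2, eq_comm]

/-- The factor $1/2$ appears because the entries at $(q,p)$ and $(\bar p,\bar q)$ are opposite and
so are the corresponding root elements: each term is counted twice. -/
theorem eq_half_sum_elt (x : so n) : x = (1 / 2 : ℂ) • ∑ p, ∑ q, x.1 q p • elt p q := by
  ext i j
  have h : ∀ (y : so n) (c : ℂ), (c • y).1 = c • y.1 := fun _ _ => rfl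
  rw [h]
  have hs : (∑ p, ∑ q, x.1 q p • elt p q).1 = ∑ p, ∑ q, x.1 q p • (elt p q).1 := by
    simp
  rw [hs]
  simp only [Matrix.smul_apply, Matrix.sum_apply, elt_apply, smul_eq_mul]
  have h1 : ∑ p, ∑ q, x.1 q p * (if q = i ∧ p = j then (1 : ℂ) else 0) = x.1 i j := by
    rw [Finset.sum_eq_single j, Finset.sum_eq_single i] <;> simp +contextual
  have h2 : ∑ p : Fin (2 * n + 1), ∑ q : Fin (2 * n + 1),
      x.1 q p * (if p.rev = i ∧ q.rev = j then (1 : ℂ) else 0) = x.1 j.rev i.rev := by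
    rw [Finset.sum_eq_single i.rev, Finset.sum_eq_single j.rev]
    · simp
    · intro b _ hb
      have : b.rev ≠ j := fun h => hb (by simp [← h])
      simp [this]
    · simp
    · intro b _ hb
      have : b.rev ≠ i := fun h => hb (by simp [← h])
      simp [this]
    · simp
  simp only [mul_sub, Finset.sum_sub_distrib, h1, h2]
  rw [← neg_neg (x.1 j.rev i.rev), ← apply_eq_neg_rev]
  ring

theorem coe_lie (x y : so n) : (⁅x, y⁆ : so n).1 = x.1 * y.1 - y.1 * x.1 := rfl

theorem elt_mul_elt (p q r s : Fin (2 * n + 1)) : (elt p q).1 * (elt r s).1 =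
    (if p = s then Matrix.single q r 1 else 0) - (if p = r.rev then Matrix.single q s.rev 1 else 0)
    - (if q.rev = s then Matrix.single p.rev r 1 else 0)
    + (if q = r then Matrix.single p.rev s.rev 1 else 0) := by
  have key : ∀ a b c d : Fin (2 * n + 1), (Matrix.single a b (1 : ℂ)) * Matrix.single c d (1 : ℂ) =
      if b = c then Matrix.single a d 1 else 0 := by
    intro a b c d
    split_ifs with h
    · subst h; simp
    · exact Matrix.single_mul_single_of_ne _ _ _ _ h _
  simp only [elt, sub_mul, mul_sub, key, Fin.rev_inj]
  abel

/-! ### Weights of the vector representation -/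

/-- The weight of the standard basis vector `e_p`. -/
def wt (p : Fin (2 * n + 1)) : Fin n → ℝ :=
  fun j => (if p = pos j then 1 else 0) - (if p = (pos j).rev then 1 else 0)

theorem wt_pos (i : Fin n) : wt (pos i) = eps i := by
  ext j
  simp [wt, pos_ne_rev, pos_injective.eq_iff, eps, Pi.single_apply, eq_comm]

theorem wt_rev (p : Fin (2 * n + 1)) : wt p.rev = - wt p := by
  ext j
  simp only [wt, Fin.rev_inj, Pi.neg_apply, neg_sub]
  congr 2
  simp [Fin.rev_eq_iff]

theorem wt_mid : wt (mid n) = 0 := by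
  ext j; simp [wt, (pos_ne_mid j).symm, (rev_pos_ne_mid j).symm]

/-- The value of a weight on a Cartan element. -/
def evalWt (μ : Fin n → ℝ) (x : so n) : ℂ := ∑ i : Fin n, (μ i : ℂ) * x.1 (pos i) (pos i)

theorem evalWt_add (μ ν : Fin n → ℝ) (x : so n) :
    evalWt (μ + ν) x = evalWt μ x + evalWt ν x := by
  simp [evalWt, add_mul, Finset.sum_add_distrib]

theorem evalWt_sub (μ ν : Fin n → ℝ) (x : so n) :
    evalWt (μ - ν) x = evalWt μ x - evalWt ν x := by
  simp [evalWt, sub_mul, Finset.sum_sub_distrib]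

theorem evalWt_eps (i : Fin n) (x : so n) : evalWt (eps i) x = x.1 (pos i) (pos i) := by
  rw [evalWt, Finset.sum_eq_single i] <;> simp +contextual [eps]

theorem evalWt_wt (p : Fin (2 * n + 1)) (x : so n) : evalWt (wt p) x = x.1 p p := by
  rcases index_cases p with ⟨i, rfl⟩ | rfl | ⟨i, rfl⟩
  · rw [wt_pos, evalWt_eps]
  · have := apply_eq_neg_rev x (mid n) (mid n)
    rw [rev_mid, self_eq_neg] at this
    rw [wt_mid, this]; simp [evalWt]
  · rw [wt_rev, wt_pos, apply_eq_neg_rev, Fin.rev_rev, ← evalWt_eps]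
    simp [evalWt]

theorem isCartan_elt_self (p : Fin (2 * n + 1)) : IsCartan (elt p p) := by
  intro i j hij
  rw [elt_apply, if_neg, if_neg, sub_zero]
  · rintro ⟨h1, h2⟩; exact hij (h1.symm.trans h2)
  · rintro ⟨h1, h2⟩; exact hij (h1.symm.trans h2)

theorem evalWt_elt_pos (μ : Fin n → ℝ) (i : Fin n) : evalWt μ (elt (pos i) (pos i)) = μ i := by
  rw [evalWt, Finset.sum_eq_single i]
  · simp [elt_apply, (pos_ne_rev i i).symm]
  · intro j _ hj
    rw [elt_apply, if_neg, if_neg]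
    · simp
    · rintro ⟨h, -⟩; exact pos_ne_rev _ _ h.symm
    · rintro ⟨h, -⟩; exact hj (pos_injective h.symm)
  · simp

theorem evalWt_injective {μ ν : Fin n → ℝ} (h : ∀ x : so n, IsCartan x → evalWt μ x = evalWt ν x) :
    μ = ν := by
  ext i
  have := h _ (isCartan_elt_self (pos i))
  rw [evalWt_elt_pos, evalWt_elt_pos] at this
  exact_mod_cast this

theorem IsCartan.lie_elt {x : so n} (hx : IsCartan x) (p q : Fin (2 * n + 1)) :
    ⁅x, elt p q⁆ = evalWt (wt q - wt p) x • elt p q := by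
  have hd : x.1 = Matrix.diagonal (fun i => x.1 i i) := by
    ext i j
    by_cases h : i = j
    · subst h; simp
    · rw [hx i j h, Matrix.diagonal_apply_ne _ h]
  rw [evalWt_sub, evalWt_wt, evalWt_wt]
  ext i j
  rw [coe_lie, Matrix.sub_apply]
  have h : ∀ (y : so n) (c : ℂ), (c • y).1 = c • y.1 := fun _ _ => rfl
  rw [h, Matrix.smul_apply, hd, Matrix.diagonal_mul, Matrix.mul_diagonal, ← hd, elt_apply,
    smul_eq_mul]
  have h1 := apply_eq_neg_rev x p p
  have h2 := apply_eq_neg_rev x q q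
  by_cases ha : q = i ∧ p = j
  · obtain ⟨rfl, rfl⟩ := ha
    simp only [and_self, if_true]
    by_cases hb : p.rev = q ∧ q.rev = p
    · rw [if_pos hb]; ring
    · rw [if_neg hb]; ring
  · by_cases hb : p.rev = i ∧ q.rev = j
    · obtain ⟨rfl, rfl⟩ := hb
      rw [if_neg ha]
      simp only [and_self, if_true]
      rw [h1, h2]; ring
    · rw [if_neg ha, if_neg hb]; ring

theorem IsCartan.lie_cartan {x y : so n} (hx : IsCartan x) (hy : IsCartan y) : ⁅x, y⁆ = 0 := by
  have hd : ∀ {x : so n}, IsCartan x → x.1 = Matrix.diagonal (fun i => x.1 i i) := by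
    intro x hx
    ext i j
    by_cases h : i = j
    · subst h; simp
    · rw [hx i j h, Matrix.diagonal_apply_ne _ h]
  apply Subtype.ext
  rw [coe_lie, hd hx, hd hy, Matrix.diagonal_mul_diagonal, Matrix.diagonal_mul_diagonal]
  ext i j
  simp [mul_comm]

theorem isLower_elt {p q : Fin (2 * n + 1)} (h : p < q) : IsLower (elt p q) := by
  intro i j hij
  rw [elt_apply, if_neg, if_neg, sub_zero]
  · rintro ⟨h1, h2⟩; subst h1 h2; exact absurd (Fin.rev_le_rev.1 hij) (not_le.2 h)
  · rintro ⟨h1, h2⟩; subst h1 h2; exact absurd hij (not_le.2 h)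

theorem isUpper_elt {p q : Fin (2 * n + 1)} (h : q < p) : IsUpper (elt p q) := by
  intro i j hij
  rw [elt_apply, if_neg, if_neg, sub_zero]
  · rintro ⟨h1, h2⟩; subst h1 h2; exact absurd (Fin.rev_le_rev.1 hij) (not_le.2 h)
  · rintro ⟨h1, h2⟩; subst h1 h2; exact absurd hij (not_le.2 h)

/-- The pair $q=\bar p$ has to be excluded: the weight difference would be $2\varepsilon_i$, which
is not a root, and the corresponding `elt` is zero. -/
theorem wt_sub_wt_mem_posRoots {p q : Fin (2 * n + 1)} (h : p < q) (hq : q ≠ p.rev) :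
    wt p - wt q ∈ posRoots n := by
  rcases index_cases p with ⟨i, rfl⟩ | rfl | ⟨i, rfl⟩ <;>
    rcases index_cases q with ⟨j, rfl⟩ | rfl | ⟨j, rfl⟩ <;>
    simp only [wt_pos, wt_mid, wt_rev, Fin.lt_def, val_pos, val_mid, Fin.val_rev] at h ⊢
  · exact Or.inr ⟨i, j, h, Or.inl rfl⟩
  · exact Or.inl ⟨i, by simp⟩
  · rw [sub_neg_eq_add]
    rcases lt_trichotomy i j with hij | rfl | hij
    · exact Or.inr ⟨i, j, hij, Or.inr rfl⟩
    · exact absurd rfl hq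
    · exact Or.inr ⟨j, i, hij, Or.inr (add_comm _ _)⟩
  · omega
  · omega
  · exact Or.inl ⟨j, by simp⟩
  · omega
  · omega
  · exact Or.inr ⟨j, i, by rw [Fin.lt_def]; omega, Or.inl (by abel)⟩

end

/-! ### General theory of highest weight modules and their PBW filtration -/

noncomputable section

/-! ### Weight spaces -/

section WeightSpaces

variable {n : ℕ} {V : Type*} [AddCommGroup V] [Module ℂ V] [LieRingModule (so n) V]
  [LieModule ℂ (so n) V]

variable (V) in
/-- The weight space of weight `μ`. -/
def wtSpace (μ : Fin n → ℝ) : Submodule ℂ V where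
  carrier := {v | ∀ x : so n, IsCartan x → ⁅x, v⁆ = evalWt μ x • v}
  add_mem' ha hb x hx := by rw [lie_add, ha x hx, hb x hx, smul_add]
  zero_mem' x _ := by simp
  smul_mem' c v hv x hx := by rw [lie_smul, hv x hx, smul_comm]

theorem mem_wtSpace {μ : Fin n → ℝ} {v : V} :
    v ∈ wtSpace V μ ↔ ∀ x : so n, IsCartan x → ⁅x, v⁆ = evalWt μ x • v := Iff.rfl

variable (V) in
-- Cartan elements commute, so their simultaneous generalized eigenspaces are independent. Distinct
-- weights differ on some Cartan element, so weight spaces sit inside distinct ones of these.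
theorem iSupIndep_wtSpace : iSupIndep (wtSpace V : (Fin n → ℝ) → Submodule ℂ V) := by
  have h := Module.End.independent_iInf_maxGenEigenspace_of_forall_mapsTo
    (fun x : {x : so n // IsCartan x} => LieModule.toEnd ℂ (so n) V x.1) (by
      intro x y φ
      apply Module.End.mapsTo_maxGenEigenspace_of_comm
      rw [commute_iff_lie_eq, ← LieHom.map_lie, y.2.lie_cartan x.2, map_zero])
  have h2 := h.comp (f := fun (μ : Fin n → ℝ) (x : {x : so n // IsCartan x}) => evalWt μ x.1)
    (fun μ ν hμν => evalWt_injective fun x hx => congrFun hμν ⟨x, hx⟩)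
  refine h2.mono fun μ v hv => ?_
  simp only [Function.comp, Submodule.mem_iInf]
  intro x
  exact Module.End.mem_maxGenEigenspace _ _ _ |>.2 ⟨1, by
    simp [hv x.1 x.2]⟩

theorem eq_of_mem_wtSpace {μ ν : Fin n → ℝ} {v : V} (hv : v ≠ 0) (h1 : v ∈ wtSpace V μ)
    (h2 : v ∈ wtSpace V ν) : μ = ν := by
  by_contra h
  have := (iSupIndep_wtSpace V).pairwiseDisjoint h
  exact hv (Submodule.disjoint_def.1 this v h1 h2)

/-- A vector of weight `μ` in the span of a set of weight vectors is in the span of those of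
weight `μ`. -/
theorem mem_span_inter_wtSpace {S : Set V} (hS : ∀ s ∈ S, ∃ ν : Fin n → ℝ, s ∈ wtSpace V ν) {μ : Fin n → ℝ}
    {v : V} (hv : v ∈ Submodule.span ℂ S) (hμ : v ∈ wtSpace V μ) :
    v ∈ Submodule.span ℂ (S ∩ wtSpace V μ) := by
  have hle : Submodule.span ℂ S ≤ Submodule.span ℂ (S ∩ (wtSpace V μ : Set V)) ⊔
      ⨆ ν : Fin n → ℝ, ⨆ (_ : ν ≠ μ), wtSpace V ν := by
    rw [Submodule.span_le]
    intro s hs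
    obtain ⟨ν, hν⟩ := hS s hs
    by_cases h : ν = μ
    · subst h
      exact Submodule.mem_sup_left (Submodule.subset_span ⟨hs, hν⟩)
    · exact Submodule.mem_sup_right (Submodule.mem_iSup_of_mem ν (Submodule.mem_iSup_of_mem h hν))
  obtain ⟨a, ha, b, hb, rfl⟩ := Submodule.mem_sup.1 (hle hv)
  have ha' : a ∈ wtSpace V μ :=
    (Submodule.span_le.2 Set.inter_subset_right : Submodule.span ℂ (S ∩ wtSpace V μ) ≤ _) ha
  have hb' : b ∈ wtSpace V μ := by simpa using Submodule.sub_mem _ hμ ha'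
  have := Submodule.disjoint_def.1 (iSupIndep_wtSpace V μ) b hb' hb
  rw [this, add_zero]
  exact ha

theorem elt_mem_wtSpace {μ : Fin n → ℝ} {v : V} (hv : v ∈ wtSpace V μ) (p q : Fin (2 * n + 1)) :
    ⁅elt p q, v⁆ ∈ wtSpace V (μ - (wt p - wt q)) := by
  intro x hx
  rw [leibniz_lie, hx.lie_elt, hv x hx, lie_smul, smul_lie, ← add_smul, ← evalWt_add]
  congr 2
  abel

/-- A submodule contains the weight components of its elements. -/
theorem mem_of_add_mem (N : LieSubmodule ℂ (so n) V) {μ : Fin n → ℝ} {a b : V}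
    (ha : a ∈ wtSpace V μ) (hb : b ∈ ⨆ ν : Fin n → ℝ, ⨆ (_ : ν ≠ μ), wtSpace V ν)
    (h : a + b ∈ N) : a ∈ N := by
  -- In the quotient the class of `a` has weight `μ` and also lies in the sum of the other weight
  -- spaces, so it is zero.
  let π := LieSubmodule.Quotient.mk' N
  have hπ : π a = π (-b) := by
    have h0 : π (a + b) = 0 := (LieSubmodule.Quotient.mk_eq_zero (N := N)).2 h
    rw [map_add] at h0
    rw [map_neg]
    exact eq_neg_of_add_eq_zero_left h0
  have hwt : ∀ (ν : Fin n → ℝ) u, u ∈ wtSpace V ν → π u ∈ wtSpace (V ⧸ N) ν := by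
    intro ν u hu x hx
    rw [← LieModuleHom.map_lie, hu x hx, map_smul]
  have h2 : π a ∈ ⨆ ν : Fin n → ℝ, ⨆ (_ : ν ≠ μ), wtSpace (V ⧸ N) ν := by
    rw [hπ]
    have hle : (⨆ ν : Fin n → ℝ, ⨆ (_ : ν ≠ μ), wtSpace V ν) ≤
        (⨆ ν : Fin n → ℝ, ⨆ (_ : ν ≠ μ), wtSpace (V ⧸ N) ν).comap (π : V →ₗ[ℂ] V ⧸ N) := by
      refine iSup₂_le fun ν hν b hb => ?_
      exact Submodule.mem_iSup_of_mem ν (Submodule.mem_iSup_of_mem hν (hwt ν b hb))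
    exact hle (Submodule.neg_mem _ hb)
  exact (LieSubmodule.Quotient.mk_eq_zero (N := N)).1
    (Submodule.disjoint_def.1 (iSupIndep_wtSpace (V ⧸ N) μ) _ (hwt _ _ ha) h2)

end WeightSpaces

/-! ### Words in the negative root vectors -/

section Words

variable {n : ℕ} {V : Type*} [AddCommGroup V] [Module ℂ V] [LieRingModule (so n) V]

/-- The result of applying a product of elements `elt p q` to a vector. -/
def word (u : V) (l : List (Fin (2 * n + 1) × Fin (2 * n + 1))) : V :=
  l.foldr (fun r y => ⁅(elt r.1 r.2 : so n), y⁆) u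

@[simp] theorem word_nil (u : V) :
    word u ([] : List (Fin (2 * n + 1) × Fin (2 * n + 1))) = u := rfl

@[simp] theorem word_cons (u : V) (r : Fin (2 * n + 1) × Fin (2 * n + 1)) (l) :
    word u (r :: l) = ⁅(elt r.1 r.2 : so n), word u l⁆ := rfl

/-- All the letters of the word are negative root vectors. -/
def IsLowerWord (l : List (Fin (2 * n + 1) × Fin (2 * n + 1))) : Prop :=
  ∀ r ∈ l, r.1 < r.2 ∧ r.2 ≠ r.1.rev

/-- The sum of the positive roots opposite to the weights of the letters of the word. -/
def drop (l : List (Fin (2 * n + 1) × Fin (2 * n + 1))) : Fin n → ℝ :=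
  (l.map fun r => wt r.1 - wt r.2).sum

@[simp] theorem drop_nil : drop ([] : List (Fin (2 * n + 1) × Fin (2 * n + 1))) = 0 := rfl

@[simp] theorem drop_cons (r : Fin (2 * n + 1) × Fin (2 * n + 1)) (l) :
    drop (r :: l) = (wt r.1 - wt r.2) + drop l := by simp [drop]

theorem word_mem_wtSpace [LieModule ℂ (so n) V] {μ : Fin n → ℝ} {u : V} (hu : u ∈ wtSpace V μ)
    (l : List (Fin (2 * n + 1) × Fin (2 * n + 1))) : word u l ∈ wtSpace V (μ - drop l) := by
  induction l with
  | nil => simpa using hu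
  | cons r l ih =>
    have := elt_mem_wtSpace ih r.1 r.2
    rw [word_cons, drop_cons]
    convert this using 2
    abel

theorem drop_decomposition {l : List (Fin (2 * n + 1) × Fin (2 * n + 1))} (hl : IsLowerWord l) :
    l.length ∈ decompositionLengths (drop l) := by
  refine ⟨fun j => wt (l.get j).1 - wt (l.get j).2, fun j => ?_, ?_⟩
  · exact wt_sub_wt_mem_posRoots (hl _ (List.get_mem l j)).1 (hl _ (List.get_mem l j)).2
  · rw [drop, ← List.sum_ofFn]
    congr 1
    apply List.ext_get <;> simp

/-- A linear functional positive on the positive roots. -/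
def height (μ : Fin n → ℝ) : ℝ := ∑ j : Fin n, ((n : ℝ) - (j : ℝ)) * μ j

theorem height_add (μ ν : Fin n → ℝ) : height (μ + ν) = height μ + height ν := by
  simp [height, mul_add, Finset.sum_add_distrib]

theorem height_sub (μ ν : Fin n → ℝ) : height (μ - ν) = height μ - height ν := by
  simp [height, mul_sub, Finset.sum_sub_distrib]

theorem height_eps (i : Fin n) : height (eps i) = (n : ℝ) - (i : ℝ) := by
  rw [height, Finset.sum_eq_single i] <;> simp +contextual [eps]

theorem height_pos_of_mem_posRoots {β : Fin n → ℝ} (hβ : β ∈ posRoots n) : 0 < height β := by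
  have key : ∀ i : Fin n, (i : ℝ) < n := fun i => by exact_mod_cast i.2
  rcases hβ with ⟨i, rfl⟩ | ⟨i, j, hij, rfl | rfl⟩
  · rw [height_eps]; linarith [key i]
  · rw [height_sub, height_eps, height_eps]
    have : (i : ℝ) < j := by exact_mod_cast hij
    linarith
  · rw [height_add, height_eps, height_eps]
    linarith [key i, key j]

theorem height_drop_nonneg {l : List (Fin (2 * n + 1) × Fin (2 * n + 1))} (hl : IsLowerWord l) :
    0 ≤ height (drop l) := by
  induction l with
  | nil => simp [height]
  | cons r l ih =>
    rw [drop_cons, height_add]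
    have h1 := hl r (by simp)
    have h2 := height_pos_of_mem_posRoots (wt_sub_wt_mem_posRoots h1.1 h1.2)
    linarith [ih fun r hr => hl r (by simp [hr])]

theorem eq_nil_of_drop_eq_zero {l : List (Fin (2 * n + 1) × Fin (2 * n + 1))}
    (hl : IsLowerWord l) (h : drop l = 0) : l = [] := by
  cases l with
  | nil => rfl
  | cons r l =>
    exfalso
    have h0 := congrArg height h
    rw [drop_cons, height_add] at h0
    have h1 := hl r (by simp)
    have h2 := height_pos_of_mem_posRoots (wt_sub_wt_mem_posRoots h1.1 h1.2)
    have h3 := height_drop_nonneg (l := l) fun r hr => hl r (by simp [hr])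
    have : height (0 : Fin n → ℝ) = 0 := by simp [height]
    linarith

/-! ### The PBW filtration -/

theorem pbwFiltration_mono (u : V) : Monotone (pbwFiltration n u) := by
  intro s t hst
  apply Submodule.span_mono
  rintro _ ⟨l, h1, h2, rfl⟩
  exact ⟨l, h1.trans hst, h2, rfl⟩

theorem self_mem_pbwFiltration (u : V) (s : ℕ) : u ∈ pbwFiltration n u s :=
  Submodule.subset_span ⟨[], by simp, by simp, rfl⟩

theorem pbwFiltration_smul_le [LieModule ℂ (so n) V] (u : V) (c : ℂ) (s : ℕ) :
    pbwFiltration n (c • u) s ≤ pbwFiltration n u s := by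
  rw [pbwFiltration, Submodule.span_le]
  rintro _ ⟨l, h1, h2, rfl⟩
  have : l.foldr (fun x y => ⁅x, y⁆) (c • u) = c • l.foldr (fun x y => ⁅x, y⁆) u := by
    clear h1 h2
    induction l with
    | nil => rfl
    | cons x l ih => simp [ih]
  rw [this]
  exact Submodule.smul_mem _ _ (Submodule.subset_span ⟨l, h1, h2, rfl⟩)

theorem lie_mem_pbwFiltration [LieModule ℂ (so n) V] {u v : V} {s : ℕ} {x : so n} (hx : IsLower x)
    (hv : v ∈ pbwFiltration n u s) : ⁅x, v⁆ ∈ pbwFiltration n u (s + 1) := by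
  induction hv using Submodule.span_induction with
  | mem v hv =>
    obtain ⟨l, h1, h2, rfl⟩ := hv
    exact Submodule.subset_span ⟨x :: l, by simpa using h1, List.forall_mem_cons.2 ⟨hx, h2⟩, rfl⟩
  | zero => simp
  | add a b _ _ ha hb => rw [lie_add]; exact Submodule.add_mem _ ha hb
  | smul c a _ ha => rw [lie_smul]; exact Submodule.smul_mem _ _ ha

theorem elt_lie_mem_pbwFiltration [LieModule ℂ (so n) V] {u v : V} {s : ℕ}
    {p q : Fin (2 * n + 1)} (h : p < q)
    (hv : v ∈ pbwFiltration n u s) : ⁅elt p q, v⁆ ∈ pbwFiltration n u (s + 1) :=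
  lie_mem_pbwFiltration (isLower_elt h) hv

/-- Arbitrary elements of $\mathfrak n^-$ are not weight vectors. Expanding them in root vectors
makes every generator of the filtration a weight vector. -/
theorem pbwFiltration_le_span_word [LieModule ℂ (so n) V] (u : V) (s : ℕ) :
    pbwFiltration n u s ≤ Submodule.span ℂ {v | ∃ l : List (Fin (2 * n + 1) × Fin (2 * n + 1)),
      IsLowerWord l ∧ l.length ≤ s ∧ v = word u l} := by
  rw [pbwFiltration, Submodule.span_le]
  rintro _ ⟨l, h1, h2, rfl⟩
  induction l generalizing s with
  | nil => exact Submodule.subset_span ⟨[], by simp [IsLowerWord], by simp, rfl⟩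
  | cons x l ih =>
    obtain ⟨s, rfl⟩ : ∃ t, s = t + 1 := ⟨s - 1, by simp at h1; omega⟩
    have hl := ih s (by simpa using h1) fun y hy => h2 y (by simp [hy])
    have hx := h2 x (by simp)
    simp only [List.foldr_cons, SetLike.mem_coe] at hl ⊢
    generalize l.foldr (fun x y => ⁅x, y⁆) u = v at hl
    induction hl using Submodule.span_induction with
    | mem v hv =>
      obtain ⟨l, h3, h4, rfl⟩ := hv
      rw [eq_half_sum_elt x, smul_lie]
      refine Submodule.smul_mem _ _ ?_
      rw [sum_lie]
      refine Submodule.sum_mem _ fun p _ => ?_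
      rw [sum_lie]
      refine Submodule.sum_mem _ fun q _ => ?_
      rw [smul_lie]
      rcases le_or_gt q p with h | h
      · rw [hx _ _ h, zero_smul]; exact Submodule.zero_mem _
      by_cases hq : q = p.rev
      · subst hq; rw [elt_rev_self]; simp
      · refine Submodule.smul_mem _ _ (Submodule.subset_span ⟨(p, q) :: l, ?_, ?_, rfl⟩)
        · intro r hr
          rcases List.mem_cons.1 hr with rfl | hr
          · exact ⟨h, hq⟩
          · exact h3 r hr
        · simpa using h4
    | zero => simp
    | add a b _ _ ha hb => rw [lie_add]; exact Submodule.add_mem _ ha hb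
    | smul c a _ ha => rw [lie_smul]; exact Submodule.smul_mem _ _ ha

theorem mem_span_word_of_mem_pbwFiltration [LieModule ℂ (so n) V] {lam μ : Fin n → ℝ} {u v : V}
    {s : ℕ} (hu : u ∈ wtSpace V lam) (hv : v ∈ pbwFiltration n u s) (hμ : v ∈ wtSpace V μ) :
    v ∈ Submodule.span ℂ
      {v | ∃ l : List (Fin (2 * n + 1) × Fin (2 * n + 1)),
        IsLowerWord l ∧ l.length ≤ s ∧ lam - drop l = μ ∧ v = word u l} := by
  have h := mem_span_inter_wtSpace (μ := μ) (by
    rintro _ ⟨l, h1, h2, rfl⟩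
    exact ⟨_, word_mem_wtSpace hu l⟩) (pbwFiltration_le_span_word u s hv) hμ
  -- Words that vanish are discarded: zero lies in every weight space, so it would say nothing about
  -- `drop l`.
  rw [← Submodule.span_sdiff_singleton_zero] at h
  refine Submodule.span_mono ?_ h
  rintro _ ⟨⟨⟨l, h1, h2, rfl⟩, h3⟩, h4⟩
  exact ⟨l, h1, h2, eq_of_mem_wtSpace h4 (word_mem_wtSpace hu l) h3, rfl⟩

/-- A weight vector in the `s`-th step of the PBW filtration yields a decomposition into at most
`s` positive roots. -/
theorem exists_mem_decompositionLengths [LieModule ℂ (so n) V] {lam μ : Fin n → ℝ} {u v : V}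
    {s : ℕ} (hu : u ∈ wtSpace V lam) (hv : v ∈ pbwFiltration n u s) (hμ : v ∈ wtSpace V μ)
    (hv0 : v ≠ 0) : ∃ N ≤ s, N ∈ decompositionLengths (lam - μ) := by
  have h := mem_span_word_of_mem_pbwFiltration hu hv hμ
  by_contra hcon
  apply hv0
  have : {v : V | ∃ l : List (Fin (2 * n + 1) × Fin (2 * n + 1)), IsLowerWord l ∧ l.length ≤ s ∧ lam - drop l = μ ∧ v = word u l} = ∅ := by
    ext w
    simp only [Set.mem_ofPred_eq, Set.mem_empty_iff_false, iff_false]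
    rintro ⟨l, h1, h2, h3, -⟩
    apply hcon
    refine ⟨l.length, h2, ?_⟩
    rw [← h3, sub_sub_cancel]
    exact drop_decomposition h1
  rw [this] at h
  simpa using h

/-- Only the empty word preserves the weight, since every letter lowers the height strictly. Hence
the top weight space of a highest weight module is a line. -/
theorem mem_span_singleton_of_mem_pbwFiltration [LieModule ℂ (so n) V] {lam : Fin n → ℝ} {u v : V}
    {s : ℕ} (hu : u ∈ wtSpace V lam) (hv : v ∈ pbwFiltration n u s) (hμ : v ∈ wtSpace V lam) :
    v ∈ Submodule.span ℂ {u} := by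
  refine Submodule.span_mono ?_ (mem_span_word_of_mem_pbwFiltration hu hv hμ)
  rintro _ ⟨l, h1, h2, h3, rfl⟩
  rw [eq_nil_of_drop_eq_zero h1 (by simpa using h3)]
  rfl

end Words

/-! ### Highest weight modules -/

section HighestWeight

variable {n : ℕ} {V : Type*} [AddCommGroup V] [Module ℂ V] [LieRingModule (so n) V]
  [LieModule ℂ (so n) V]

/-- The upper triangular elements of `so_{2n+1}`. -/
def IsBorel (x : so n) : Prop := ∀ i j, j < i → x.1 i j = 0

/-- The line spanned by `u` is stable under upper triangular matrices. -/
def IsBorelEigen (n : ℕ) {V : Type*} [AddCommGroup V] [Module ℂ V] [LieRingModule (so n) V]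
    (u : V) : Prop := ∀ x : so n, IsBorel x → ∃ c : ℂ, ⁅x, u⁆ = c • u

theorem exists_lower_add_borel (x : so n) : ∃ y z : so n, IsLower y ∧ IsBorel z ∧ x = y + z := by
  let y : so n := ⟨Matrix.of fun i j => if j < i then x.1 i j else 0, mem_so.2 fun i j => by
    simp only [Matrix.of_apply, Fin.rev_lt_rev]
    split_ifs
    · exact apply_eq_neg_rev x i j
    · simp⟩
  refine ⟨y, x - y, ?_, ?_, by abel⟩
  · intro i j hij
    simp [y, not_lt.2 hij]
  · intro i j hij
    change x.1 i j - y.1 i j = 0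
    simp [y, hij]

theorem exists_cartan_add_upper {x : so n} (hx : IsBorel x) :
    ∃ y z : so n, IsCartan y ∧ IsUpper z ∧ x = y + z := by
  let y : so n := ⟨Matrix.of fun i j => if i = j then x.1 i j else 0, mem_so.2 fun i j => by
    simp only [Matrix.of_apply, Fin.rev_inj]
    simp only [eq_comm (a := j)]
    split_ifs
    · exact apply_eq_neg_rev x i j
    · simp⟩
  refine ⟨y, x - y, ?_, ?_, by abel⟩
  · intro i j hij
    simp [y, hij]
  · intro i j hij
    change x.1 i j - y.1 i j = 0
    rcases hij.eq_or_lt with rfl | h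
    · simp [y]
    · simp [y, h.ne', hx _ _ h]

theorem IsHighestWeightVector.isBorelEigen {μ : Fin n → ℝ} {v : V}
    (hv : IsHighestWeightVector μ v) : IsBorelEigen n v := by
  intro x hx
  obtain ⟨y, z, hy, hz, rfl⟩ := exists_cartan_add_upper hx
  exact ⟨_, by rw [add_lie, hv.2 z hz, add_zero]; exact hv.1.2 y hy⟩

/-- Commute `x` past the first letter `y`. The commutator splits into a strictly lower part, which
replaces `y` without lengthening the word, and a Borel part, to which the induction applies. -/
theorem IsBorelEigen.lie_mem {u v : V} (hu : IsBorelEigen n u) {x : so n} (hx : IsBorel x) {s : ℕ}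
    (hv : v ∈ pbwFiltration n u s) : ⁅x, v⁆ ∈ pbwFiltration n u s := by
  induction hv using Submodule.span_induction with
  | mem v hv =>
    obtain ⟨l, h1, h2, rfl⟩ := hv
    refine pbwFiltration_mono u h1 ?_
    clear h1
    induction l generalizing x with
    | nil =>
      obtain ⟨c, hc⟩ := hu x hx
      rw [List.foldr_nil, hc]
      exact Submodule.smul_mem _ _ (self_mem_pbwFiltration u _)
    | cons y l ih =>
      have h3 : ∀ y ∈ l, IsLower y := fun y hy => h2 y (by simp [hy])
      have hy := h2 y (by simp)
      rw [List.foldr_cons, leibniz_lie]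
      obtain ⟨a, b, ha, hb, hab⟩ := exists_lower_add_borel ⁅x, y⁆
      have hl : l.foldr (fun x y => ⁅x, y⁆) u ∈ pbwFiltration n u l.length :=
        Submodule.subset_span ⟨l, le_rfl, h3, rfl⟩
      rw [hab, add_lie, List.length_cons]
      refine Submodule.add_mem _ (Submodule.add_mem _ (lie_mem_pbwFiltration ha hl) ?_)
        (lie_mem_pbwFiltration hy (ih hx h3))
      exact pbwFiltration_mono u (Nat.le_succ _) (ih hb h3)
  | zero => simp
  | add a b _ _ ha hb => rw [lie_add]; exact Submodule.add_mem _ ha hb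
  | smul c a _ ha => rw [lie_smul]; exact Submodule.smul_mem _ _ ha

/-- The submodule generated by a vector whose line is stable under upper triangular matrices. -/
def IsBorelEigen.generated {u : V} (hu : IsBorelEigen n u) : LieSubmodule ℂ (so n) V where
  toSubmodule := ⨆ s, pbwFiltration n u s
  lie_mem := by
    intro x v hv
    change v ∈ ⨆ s, pbwFiltration n u s at hv
    change _ ∈ ⨆ s, pbwFiltration n u s
    rw [Submodule.mem_iSup_of_directed _ (pbwFiltration_mono u).directed_le] at hv ⊢
    obtain ⟨s, hs⟩ := hv
    obtain ⟨y, z, hy, hz, rfl⟩ := exists_lower_add_borel x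
    refine ⟨s + 1, ?_⟩
    rw [add_lie]
    exact Submodule.add_mem _ (lie_mem_pbwFiltration hy hs)
      (pbwFiltration_mono u (Nat.le_succ s) (hu.lie_mem hz hs))

theorem IsBorelEigen.mem_generated {u : V} (hu : IsBorelEigen n u) {v : V} :
    v ∈ hu.generated ↔ ∃ s, v ∈ pbwFiltration n u s := by
  change v ∈ ⨆ s, pbwFiltration n u s ↔ _
  rw [Submodule.mem_iSup_of_directed _ (pbwFiltration_mono u).directed_le]

theorem IsBorelEigen.exists_mem_pbwFiltration [LieModule.IsIrreducible ℂ (so n) V] {u : V}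
    (hu : IsBorelEigen n u) (h0 : u ≠ 0) (v : V) : ∃ s, v ∈ pbwFiltration n u s := by
  rw [← hu.mem_generated, (eq_bot_or_eq_top hu.generated).resolve_left]
  · trivial
  · intro h
    have : u ∈ hu.generated := hu.mem_generated.2 ⟨0, self_mem_pbwFiltration u 0⟩
    rw [h] at this
    exact h0 (by simpa using this)

/-- In an irreducible module there is no singular vector below the highest weight vector. -/
theorem IsBorelEigen.eq_zero_of_height_pos [LieModule.IsIrreducible ℂ (so n) V]
    {lam μ : Fin n → ℝ} {v₀ u : V} (h0 : v₀ ≠ 0) (hv₀ : v₀ ∈ wtSpace V lam) (hu : IsBorelEigen n u)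
    (hμ : u ∈ wtSpace V μ) (hlt : height μ < height lam) : u = 0 := by
  by_contra hne
  -- If nonzero, `u` generates the whole module and in particular `v₀`; but words applied to `u`
  -- never have greater height than `u`.
  obtain ⟨s, hs⟩ := hu.exists_mem_pbwFiltration hne v₀
  have h := mem_span_word_of_mem_pbwFiltration hμ hs hv₀
  apply h0
  have : {v : V | ∃ l : List (Fin (2 * n + 1) × Fin (2 * n + 1)), IsLowerWord l ∧ l.length ≤ s ∧ μ - drop l = lam ∧ v = word u l} = ∅ := by
    ext w
    simp only [Set.mem_ofPred_eq, Set.mem_empty_iff_false, iff_false]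
    rintro ⟨l, h1, h2, h3, -⟩
    have := height_drop_nonneg h1
    rw [← h3, height_sub] at hlt
    linarith
  rw [this] at h
  simpa using h

end HighestWeight

/-! ### Comparison of highest weight modules -/

section Comparison

variable {n : ℕ} {V S : Type*} [AddCommGroup V] [Module ℂ V] [LieRingModule (so n) V]
  [LieModule ℂ (so n) V] [AddCommGroup S] [Module ℂ S] [LieRingModule (so n) S]
  [LieModule ℂ (so n) S]

instance instLieRingModuleProd : LieRingModule (so n) (V × S) where
  bracket x v := (⁅x, v.1⁆, ⁅x, v.2⁆)
  add_lie x y v := by ext <;> simp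
  lie_add x v w := by ext <;> simp
  leibniz_lie x y v := by ext <;> simp

theorem lie_prod (x : so n) (v : V) (s : S) : ⁅x, (v, s)⁆ = (⁅x, v⁆, ⁅x, s⁆) := rfl

instance instLieModuleProd : LieModule ℂ (so n) (V × S) where
  smul_lie c x v := by obtain ⟨a, b⟩ := v; simp [lie_prod]
  lie_smul c x v := by obtain ⟨a, b⟩ := v; simp [lie_prod]

/-- Irreducible modules with highest weight vectors of the same weight are isomorphic. -/
theorem exists_equiv_of_isIrreducible [LieModule.IsIrreducible ℂ (so n) V]
    [LieModule.IsIrreducible ℂ (so n) S] {lam : Fin n → ℝ} {v₀ : V} {e : S}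
    (hv₀ : IsHighestWeightVector lam v₀) (he : IsHighestWeightVector lam e) :
    ∃ φ : S ≃ₗ[ℂ] V, (∀ (x : so n) s, φ ⁅x, s⁆ = ⁅x, φ s⁆) ∧ φ e = v₀ := by
  have hw : IsHighestWeightVector lam (v₀, e) := by
    refine ⟨⟨fun h => hv₀.1.1 (congrArg Prod.fst h), fun x hx => ?_⟩, fun x hx => ?_⟩
    · rw [lie_prod, hv₀.1.2 x hx, he.1.2 x hx]; rfl
    · rw [lie_prod, hv₀.2 x hx, he.2 x hx]; rfl
  -- The submodule of the product generated by the pair of highest weight vectors will be the graph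
  -- of the isomorphism.
  let M := hw.isBorelEigen.generated
  have hM : (v₀, e) ∈ M := (hw.isBorelEigen.mem_generated).2 ⟨0, self_mem_pbwFiltration _ _⟩
  have hline : ∀ w ∈ M, w ∈ wtSpace (V × S) lam → ∃ c : ℂ, w = c • (v₀, e) := by
    intro w hwM hwl
    obtain ⟨s, hs⟩ := hw.isBorelEigen.mem_generated.1 hwM
    obtain ⟨c, hc⟩ := Submodule.mem_span_singleton.1
      (mem_span_singleton_of_mem_pbwFiltration hw.1.2 hs hwl)
    exact ⟨c, hc.symm⟩
  -- the two kernels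
  let K₁ : LieSubmodule ℂ (so n) V :=
    { carrier := {v | (v, (0 : S)) ∈ M}
      add_mem' := fun {a b} ha hb => by simpa using M.add_mem ha hb
      zero_mem' := M.zero_mem
      smul_mem' := fun c v hv => by simpa using M.smul_mem c hv
      lie_mem := fun {x v} hv => by simpa [lie_prod] using M.lie_mem (x := x) hv }
  let K₂ : LieSubmodule ℂ (so n) S :=
    { carrier := {s | ((0 : V), s) ∈ M}
      add_mem' := fun {a b} ha hb => by simpa using M.add_mem ha hb
      zero_mem' := M.zero_mem
      smul_mem' := fun c v hv => by simpa using M.smul_mem c hv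
      lie_mem := fun {x v} hv => by simpa [lie_prod] using M.lie_mem (x := x) hv }
  let R₁ : LieSubmodule ℂ (so n) V :=
    { carrier := {v | ∃ s : S, (v, s) ∈ M}
      add_mem' := fun {a b} ⟨s, hs⟩ ⟨t, ht⟩ => ⟨s + t, by simpa using M.add_mem hs ht⟩
      zero_mem' := ⟨0, M.zero_mem⟩
      smul_mem' := fun c v ⟨s, hs⟩ => ⟨c • s, by simpa using M.smul_mem c hs⟩
      lie_mem := fun {x v} ⟨s, hs⟩ => ⟨⁅x, s⁆, by simpa [lie_prod] using M.lie_mem (x := x) hs⟩ }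
  let R₂ : LieSubmodule ℂ (so n) S :=
    { carrier := {s | ∃ v : V, (v, s) ∈ M}
      add_mem' := fun {a b} ⟨s, hs⟩ ⟨t, ht⟩ => ⟨s + t, by simpa using M.add_mem hs ht⟩
      zero_mem' := ⟨0, M.zero_mem⟩
      smul_mem' := fun c v ⟨s, hs⟩ => ⟨c • s, by simpa using M.smul_mem c hs⟩
      lie_mem := fun {x v} ⟨s, hs⟩ => ⟨⁅x, s⁆, by simpa [lie_prod] using M.lie_mem (x := x) hs⟩ }
  -- Otherwise `(v₀, 0)` would be in `M`, although the part of `M` of weight `lam` is the line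
  -- through `(v₀, e)`.
  have hK₁ : K₁ = ⊥ := by
    by_contra h
    have : v₀ ∈ K₁ := by rw [(eq_bot_or_eq_top K₁).resolve_left h]; trivial
    obtain ⟨c, hc⟩ := hline (v₀, 0) this fun x hx => by
      rw [lie_prod, hv₀.1.2 x hx, lie_zero]; simp [evalWt, pos]
    have h1 : v₀ = c • v₀ := congrArg Prod.fst hc
    have h2 : (0 : S) = c • e := congrArg Prod.snd hc
    rcases smul_eq_zero.1 h2.symm with h3 | h3
    · exact hv₀.1.1 (by rw [h1, h3, zero_smul])
    · exact he.1.1 h3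
  have hK₂ : K₂ = ⊥ := by
    by_contra h
    have : e ∈ K₂ := by rw [(eq_bot_or_eq_top K₂).resolve_left h]; trivial
    obtain ⟨c, hc⟩ := hline (0, e) this fun x hx => by
      rw [lie_prod, he.1.2 x hx, lie_zero]; simp [evalWt, pos]
    have h1 : e = c • e := congrArg Prod.snd hc
    have h2 : (0 : V) = c • v₀ := congrArg Prod.fst hc
    rcases smul_eq_zero.1 h2.symm with h3 | h3
    · exact he.1.1 (by rw [h1, h3, zero_smul])
    · exact hv₀.1.1 h3
  have hR₁ : R₁ = ⊤ := (eq_bot_or_eq_top R₁).resolve_left fun h => by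
    have : v₀ ∈ R₁ := ⟨e, hM⟩
    rw [h] at this
    exact hv₀.1.1 (by simpa using this)
  have hR₂ : R₂ = ⊤ := (eq_bot_or_eq_top R₂).resolve_left fun h => by
    have : e ∈ R₂ := ⟨v₀, hM⟩
    rw [h] at this
    exact he.1.1 (by simpa using this)
  have huniq₁ : ∀ {v v' s}, (v, s) ∈ M → (v', s) ∈ M → v = v' := by
    intro v v' s h h'
    have : v - v' ∈ K₁ := by
      have := M.sub_mem h h'
      rwa [Prod.mk_sub_mk, sub_self] at this
    rw [hK₁] at this
    exact sub_eq_zero.1 (by simpa using this)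
  have huniq₂ : ∀ {v s s'}, (v, s) ∈ M → (v, s') ∈ M → s = s' := by
    intro v s s' h h'
    have : s - s' ∈ K₂ := by
      have := M.sub_mem h h'
      rwa [Prod.mk_sub_mk, sub_self] at this
    rw [hK₂] at this
    exact sub_eq_zero.1 (by simpa using this)
  have hex₂ : ∀ s : S, ∃ v : V, (v, s) ∈ M := fun s => by
    have : s ∈ R₂ := by rw [hR₂]; trivial
    exact this
  have hex₁ : ∀ v : V, ∃ s : S, (v, s) ∈ M := fun v => by
    have : v ∈ R₁ := by rw [hR₁]; trivial
    exact this
  choose f hf using hex₂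
  choose g hg using hex₁
  let φ : S ≃ₗ[ℂ] V :=
    { toFun := f
      invFun := g
      map_add' := fun s t => huniq₁ (hf _) (by simpa using M.add_mem (hf s) (hf t))
      map_smul' := fun c s => huniq₁ (hf _) (by simpa using M.smul_mem c (hf s))
      left_inv := fun s => huniq₂ (hg _) (hf _)
      right_inv := fun v => huniq₁ (hf _) (hg _) }
  exact ⟨φ, fun x s => huniq₁ (hf _) (M.lie_mem (x := x) (hf s)),
    huniq₁ (hf _) hM⟩

end Comparison

end

/-! ### Multilinear algebra of exterior powers -/

noncomputable section

/-! ### Derivations of exterior powers -/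

section Derivation

open exteriorPower Function

variable {M : Type*} [AddCommGroup M] [Module ℂ M] {k : ℕ}

/-- The multilinear map `m ↦ ∑ i, m_1 ∧ ⋯ ∧ f m_i ∧ ⋯ ∧ m_k`. -/
def derivMulti (k : ℕ) (f : M →ₗ[ℂ] M) : MultilinearMap ℂ (fun _ : Fin k => M) (⋀[ℂ]^k M) :=
  ∑ i, (ιMulti ℂ k (M := M)).toMultilinearMap.compLinearMap
    (update (fun _ => LinearMap.id) i f)

theorem derivMulti_apply (f : M →ₗ[ℂ] M) (m : Fin k → M) :
    derivMulti k f m = ∑ i, ιMulti ℂ k (update m i (f (m i))) := by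
  rw [derivMulti, sum_apply]
  refine Finset.sum_congr rfl fun i _ => ?_
  rw [MultilinearMap.compLinearMap_apply]
  change ιMulti ℂ k _ = _
  refine congrArg _ (funext fun j => ?_)
  rcases eq_or_ne j i with rfl | h
  · simp
  · simp [h]

/-- The alternating map `m ↦ ∑ i, m_1 ∧ ⋯ ∧ f m_i ∧ ⋯ ∧ m_k`. -/
def derivAlt (k : ℕ) (f : M →ₗ[ℂ] M) : M [⋀^Fin k]→ₗ[ℂ] ⋀[ℂ]^k M where
  toMultilinearMap := derivMulti k f
  map_eq_zero_of_eq' := by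
    intro v a b hab hne
    change derivMulti k f v = 0
    rw [derivMulti_apply, ← Finset.add_sum_erase _ _ (Finset.mem_univ a),
      ← Finset.add_sum_erase _ _ (Finset.mem_erase.2 ⟨hne.symm, Finset.mem_univ b⟩),
      Finset.sum_eq_zero, add_zero]
    -- The only two terms that survive differ by a transposition of their factors and therefore
    -- cancel.
    · have : update v b (f (v b)) = update v a (f (v a)) ∘ Equiv.swap a b := by
        ext j
        simp only [comp_apply]
        rcases eq_or_ne j a with rfl | h1
        · simp [hne, hab, hne.symm]
        · rcases eq_or_ne j b with rfl | h2
          · simp [hab]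
          · simp [Equiv.swap_apply_of_ne_of_ne h1 h2, h1, h2]
      rw [this, add_comm]
      exact (ιMulti ℂ k).map_swap_add _ hne
    · intro i hi
      simp only [Finset.mem_erase] at hi
      refine (ιMulti ℂ k).map_eq_zero_of_eq _ (i := a) (j := b) ?_ hne
      rw [update_of_ne hi.2.1.symm, update_of_ne hi.1.symm, hab]

/-- The derivation of the exterior power induced by an endomorphism. -/
def deriv (k : ℕ) (f : M →ₗ[ℂ] M) : ⋀[ℂ]^k M →ₗ[ℂ] ⋀[ℂ]^k M :=
  alternatingMapLinearEquiv (derivAlt k f)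

theorem deriv_ιMulti (f : M →ₗ[ℂ] M) (m : Fin k → M) :
    deriv k f (ιMulti ℂ k m) = ∑ i, ιMulti ℂ k (update m i (f (m i))) := by
  rw [deriv, alternatingMapLinearEquiv_apply_ιMulti]
  exact derivMulti_apply f m

theorem hom_ext {N : Type*} [AddCommGroup N] [Module ℂ N] {f g : ⋀[ℂ]^k M →ₗ[ℂ] N}
    (h : ∀ m, f (ιMulti ℂ k m) = g (ιMulti ℂ k m)) : f = g :=
  linearMap_ext (AlternatingMap.ext h)

theorem deriv_add (f g : M →ₗ[ℂ] M) : deriv k (f + g) = deriv k f + deriv k g :=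
  hom_ext fun m => by simp [deriv_ιMulti, Finset.sum_add_distrib]

theorem deriv_smul (c : ℂ) (f : M →ₗ[ℂ] M) : deriv k (c • f) = c • deriv k f :=
  hom_ext fun m => by simp [deriv_ιMulti, Finset.smul_sum]

theorem deriv_sub (f g : M →ₗ[ℂ] M) : deriv k (f - g) = deriv k f - deriv k g :=
  hom_ext fun m => by simp [deriv_ιMulti, Finset.sum_sub_distrib]

theorem deriv_deriv_ιMulti (f g : M →ₗ[ℂ] M) (m : Fin k → M) :
    deriv k f (deriv k g (ιMulti ℂ k m)) = deriv k (f * g) (ιMulti ℂ k m) +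
      ∑ i, ∑ j ∈ Finset.univ.erase i,
        ιMulti ℂ k (update (update m i (g (m i))) j (f (m j))) := by
  simp only [deriv_ιMulti, map_sum]
  rw [← Finset.sum_add_distrib]
  refine Finset.sum_congr rfl fun i _ => ?_
  rw [← Finset.add_sum_erase _ _ (Finset.mem_univ i)]
  congr 1
  · simp
  · refine Finset.sum_congr rfl fun j hj => ?_
    rw [update_of_ne (Finset.ne_of_mem_erase hj)]

/-- In the composite, the terms where `f` and `g` hit different factors are symmetric in `f` and
`g`, so they cancel in the commutator. Those hitting the same factor form the derivation of the
product. -/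
theorem deriv_lie (f g : M →ₗ[ℂ] M) :
    deriv k (f * g - g * f) = deriv k f * deriv k g - deriv k g * deriv k f := by
  refine hom_ext fun m => ?_
  rw [deriv_sub]
  simp only [LinearMap.sub_apply, Module.End.mul_apply, deriv_deriv_ιMulti]
  rw [add_sub_add_comm, left_eq_add, sub_eq_zero]
  rw [Finset.sum_comm' (t' := Finset.univ) (s' := fun j => Finset.univ.erase j)
    (by simp [eq_comm])]
  refine Finset.sum_congr rfl fun i _ => Finset.sum_congr rfl fun j hj => ?_
  rw [update_comm (Finset.ne_of_mem_erase hj)]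

end Derivation

/-! ### The standard bilinear form on exterior powers -/

section Form

open exteriorPower Function Matrix

variable {ι : Type*} [Fintype ι] {k : ℕ}

/-- Expanding the determinants along the replaced columns or rows, both sides become
$\operatorname{tr}(\operatorname{adj}(G)\,Y)$. -/
theorem sum_det_updateCol (G Y : Matrix (Fin k) (Fin k) ℂ) :
    ∑ i, (G.updateCol i fun r => Y r i).det = ∑ i, (G.updateRow i (Y i)).det := by
  simp only [← cramer_apply, ← cramer_transpose_apply, cramer_eq_adjugate_mulVec,
    ← adjugate_transpose, mulVec, dotProduct, transpose_apply]
  rw [Finset.sum_comm]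

variable (ι k) in
/-- The symmetric bilinear form on the exterior power for which the wedge products of standard
basis vectors are orthonormal. -/
def form : ⋀[ℂ]^k (ι → ℂ) →ₗ[ℂ] ⋀[ℂ]^k (ι → ℂ) →ₗ[ℂ] ℂ :=
  (pairingDual ℂ (ι → ℂ) k).comp (exteriorPower.map k (dotProductBilin ℂ ℂ))

theorem form_ιMulti (a b : Fin k → ι → ℂ) :
    form ι k (ιMulti ℂ k a) (ιMulti ℂ k b) = (Matrix.of fun i j => a j ⬝ᵥ b i).det := by
  simp only [form, LinearMap.comp_apply, exteriorPower.map_apply_ιMulti,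
    pairingDual_ιMulti_ιMulti]
  rfl

theorem form_comm (a b : ⋀[ℂ]^k (ι → ℂ)) : form ι k a b = form ι k b a := by
  have : form ι k = (form ι k).flip := by
    refine hom_ext fun a => hom_ext fun b => ?_
    rw [LinearMap.flip_apply, form_ιMulti, form_ιMulti, ← det_transpose]
    congr 1
    ext i j
    simp [dotProduct_comm]
  conv_lhs => rw [this]
  rfl

/-- On decomposable vectors the two sides replace one column, respectively one row, of the Gram
matrix, so adjointness comes down to `sum_det_updateCol`. -/
theorem form_deriv {f g : (ι → ℂ) →ₗ[ℂ] ι → ℂ} (h : ∀ x y, f x ⬝ᵥ y = x ⬝ᵥ g y)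
    (a b : ⋀[ℂ]^k (ι → ℂ)) : form ι k (deriv k f a) b = form ι k a (deriv k g b) := by
  have : (form ι k).comp (deriv k f) = (form ι k).compl₂ (deriv k g) := by
    refine hom_ext fun a => hom_ext fun b => ?_
    simp only [LinearMap.comp_apply, LinearMap.compl₂_apply, deriv_ιMulti, map_sum,
      LinearMap.sum_apply, form_ιMulti]
    convert sum_det_updateCol (Matrix.of fun i j => a j ⬝ᵥ b i)
      (Matrix.of fun i j => f (a j) ⬝ᵥ b i) using 2 with i _ i _
    · congr 1
      ext r c
      rcases eq_or_ne c i with rfl | hc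
      · simp
      · simp [hc]
    · congr 1
      ext r c
      rcases eq_or_ne r i with rfl | hr
      · simp [h]
      · simp [hr]
  exact LinearMap.congr_fun₂ this a b

theorem form_map {f g : (ι → ℂ) →ₗ[ℂ] ι → ℂ} (h : ∀ x y, f x ⬝ᵥ y = x ⬝ᵥ g y)
    (a b : ⋀[ℂ]^k (ι → ℂ)) :
    form ι k (exteriorPower.map k f a) b = form ι k a (exteriorPower.map k g b) := by
  have : (form ι k).comp (exteriorPower.map k f) = (form ι k).compl₂ (exteriorPower.map k g) := by
    refine hom_ext fun a => hom_ext fun b => ?_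
    simp [form_ιMulti, h]
  exact LinearMap.congr_fun₂ this a b

theorem eq_zero_of_form_eq_zero [LinearOrder ι] {u : ⋀[ℂ]^k (ι → ℂ)}
    (h : ∀ w, form ι k w u = 0) : u = 0 := by
  apply ((Pi.basisFun ℂ ι).exteriorPower k).repr.injective
  ext s
  rw [basis_repr_apply, map_zero, Finsupp.zero_apply,
    ← h (ιMulti_family ℂ k (Pi.basisFun ℂ ι) s), form, LinearMap.comp_apply,
    exteriorPower.map_apply_ιMulti_family, ιMultiDual]
  congr 3
  ext i x
  simp [dotProductBilin]

end Form

end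

/-! ### The modules $\Lambda^k(\mathbb C^{2n+1})$, monomials and irreducibility for $k<n$ -/

noncomputable section

open exteriorPower Function

variable {n k : ℕ}

/-! ### Exterior powers of the vector representation -/

instance instLieRingModuleExteriorPower :
    LieRingModule (so n) (⋀[ℂ]^k (Fin (2 * n + 1) → ℂ)) where
  bracket x u := deriv k x.1.mulVecLin u
  add_lie x y u := by
    change deriv k (x.1 + y.1).mulVecLin u = _
    rw [Matrix.mulVecLin_add, deriv_add]; rfl
  lie_add x u v := map_add _ u v
  leibniz_lie x y u := by
    change deriv k x.1.mulVecLin (deriv k y.1.mulVecLin u) =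
      deriv k (x.1 * y.1 - y.1 * x.1).mulVecLin u + deriv k y.1.mulVecLin (deriv k x.1.mulVecLin u)
    have : (x.1 * y.1 - y.1 * x.1).mulVecLin =
        x.1.mulVecLin * y.1.mulVecLin - y.1.mulVecLin * x.1.mulVecLin := by
      refine LinearMap.ext fun v => ?_
      simp [Matrix.mulVec_mulVec]
    rw [this, deriv_lie]
    simp

theorem lie_eq_deriv (x : so n) (u : ⋀[ℂ]^k (Fin (2 * n + 1) → ℂ)) :
    ⁅x, u⁆ = deriv k x.1.mulVecLin u := rfl

instance instLieModuleExteriorPower : LieModule ℂ (so n) (⋀[ℂ]^k (Fin (2 * n + 1) → ℂ)) where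
  smul_lie c x u := by
    change deriv k (c • x.1).mulVecLin u = _
    have : (c • x.1).mulVecLin = c • x.1.mulVecLin :=
      LinearMap.ext fun v => by simp
    rw [this, deriv_smul]; rfl
  lie_smul c x u := map_smul _ c u

theorem isExteriorPowerIso_iff {V : Type*} [AddCommGroup V] [Module ℂ V] [LieRingModule (so n) V]
    [LieModule ℂ (so n) V] {φ : (⋀[ℂ]^k (Fin (2 * n + 1) → ℂ)) ≃ₗ[ℂ] V} :
    IsExteriorPowerIso φ ↔ ∀ (x : so n) u, φ ⁅x, u⁆ = ⁅x, φ u⁆ := by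
  constructor
  · intro h x u
    have : φ.toLinearMap.comp (deriv k x.1.mulVecLin) =
        (LieModule.toEnd ℂ (so n) V x).comp φ.toLinearMap := by
      refine hom_ext fun m => ?_
      simpa [deriv_ιMulti] using (h x m).symm
    exact LinearMap.congr_fun this u
  · intro h x m
    rw [← h, lie_eq_deriv, deriv_ιMulti, map_sum]
    rfl

/-- The wedge product of the standard basis vectors with indices `f 1, …, f k`. -/
def tup (f : Fin k → Fin (2 * n + 1)) : ⋀[ℂ]^k (Fin (2 * n + 1) → ℂ) :=
  ιMulti ℂ k fun i => Pi.single (f i) 1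

theorem tup_eq_zero {f : Fin k → Fin (2 * n + 1)} (hf : ¬ Injective f) : tup f = 0 := by
  apply AlternatingMap.map_eq_zero_of_not_injective
  intro h
  exact hf fun i j hij => h (by simp [hij])

theorem tup_comp_perm (f : Fin k → Fin (2 * n + 1)) (σ : Equiv.Perm (Fin k)) :
    tup (f ∘ σ) = Equiv.Perm.sign σ • tup f :=
  (ιMulti ℂ k).map_perm (fun i => Pi.single (f i) 1) σ

theorem tup_swap (f : Fin k → Fin (2 * n + 1)) {i j : Fin k} (h : j ≠ i) :
    tup (update (update f i (f j)) j (f i)) = - tup f := by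
  rw [← Equiv.comp_swap_eq_update, tup, tup]
  exact (ιMulti ℂ k).map_swap (fun i => Pi.single (f i) 1) h

theorem span_tup : Submodule.span ℂ (Set.range (tup (n := n) (k := k))) = ⊤ := by
  have h := ιMulti_span_of_span ℂ k (Fin (2 * n + 1) → ℂ)
    (s := Set.range fun p => Pi.single p 1) (by
      rw [← Module.Basis.span_eq (Pi.basisFun ℂ (Fin (2 * n + 1)))]
      congr 2
      ext p
      simp)
  rw [eq_top_iff, ← h, Submodule.span_le]
  rintro _ ⟨a, ha, rfl⟩
  choose f hf using fun i => ha ⟨i, rfl⟩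
  refine Submodule.subset_span ⟨f, ?_⟩
  rw [tup]
  congr 1
  ext1 i
  exact hf i

theorem form_tup_self {f : Fin k → Fin (2 * n + 1)} (hf : Injective f) :
    form (Fin (2 * n + 1)) k (tup f) (tup f) = 1 := by
  rw [tup, form_ιMulti, ← Matrix.det_one (n := Fin k)]
  congr 1
  ext i j
  simp [Matrix.one_apply, Pi.single_apply, hf.eq_iff]

theorem lie_tup (x : so n) (f : Fin k → Fin (2 * n + 1)) :
    ⁅x, tup f⁆ = ∑ i, ιMulti ℂ k
      (update (fun i => Pi.single (f i) 1) i (x.1.mulVec (Pi.single (f i) 1))) := by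
  rw [lie_eq_deriv, tup, deriv_ιMulti]
  rfl

theorem ιMulti_update_single (f : Fin k → Fin (2 * n + 1)) (i : Fin k) (q : Fin (2 * n + 1)) :
    ιMulti ℂ k (update (fun i => Pi.single (f i) (1 : ℂ)) i (Pi.single q 1)) = tup (update f i q) := by
  rw [tup]
  congr 1
  ext1 j
  rcases eq_or_ne j i with rfl | h
  · simp
  · simp [h]

theorem elt_lie_tup (p q : Fin (2 * n + 1)) (f : Fin k → Fin (2 * n + 1)) :
    ⁅elt p q, tup f⁆ = ∑ i, ((if f i = p then tup (update f i q) else 0) -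
      (if f i = q.rev then tup (update f i p.rev) else 0)) := by
  rw [lie_tup]
  refine Finset.sum_congr rfl fun i _ => ?_
  rw [elt_mulVec_single, AlternatingMap.map_update_sub]
  congr 1
  · split_ifs
    · exact ιMulti_update_single f i q
    · exact AlternatingMap.map_update_zero _ _ _
  · split_ifs
    · exact ιMulti_update_single f i p.rev
    · exact AlternatingMap.map_update_zero _ _ _

theorem elt_lie_tup_of_forall_ne {p q : Fin (2 * n + 1)} {f : Fin k → Fin (2 * n + 1)}
    (hf : Injective f) {i : Fin k} (hi : f i = p) (hq : ∀ j, f j ≠ q.rev) :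
    ⁅elt p q, tup f⁆ = tup (update f i q) := by
  rw [elt_lie_tup, Finset.sum_eq_single i]
  · simp [hi, hi ▸ hq i]
  · intro j _ hj
    rw [if_neg, if_neg (hq j), sub_zero]
    rw [← hi]
    exact fun h => hj (hf h)
  · simp

theorem elt_lie_tup_of_eq_of_eq {p q : Fin (2 * n + 1)} {f : Fin k → Fin (2 * n + 1)}
    (hf : Injective f) {i j : Fin k} (hi : f i = p) (hj : f j = q.rev) :
    ⁅elt p q, tup f⁆ = tup (update f i q) - tup (update f j p.rev) := by
  rw [elt_lie_tup, Finset.sum_sub_distrib]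
  congr 1
  · rw [Finset.sum_eq_single i]
    · simp [hi]
    · intro l _ hl
      rw [if_neg]
      rw [← hi]
      exact fun h => hl (hf h)
    · simp
  · rw [Finset.sum_eq_single j]
    · simp [hj]
    · intro l _ hl
      rw [if_neg]
      rw [← hj]
      exact fun h => hl (hf h)
    · simp

theorem tup_mem_wtSpace (f : Fin k → Fin (2 * n + 1)) :
    tup f ∈ wtSpace (⋀[ℂ]^k (Fin (2 * n + 1) → ℂ)) (∑ i, wt (f i)) := by
  intro x hx
  have h1 : ∀ p, x.1.mulVec (Pi.single p 1) = evalWt (wt p) x • Pi.single p 1 := by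
    intro p
    ext i
    rw [evalWt_wt, Matrix.mulVec_single_one, Matrix.col_apply]
    rcases eq_or_ne i p with rfl | h
    · simp
    · simp [h, hx i p h]
  have h2 : evalWt (∑ i, wt (f i)) x = ∑ i, evalWt (wt (f i)) x := by
    simp only [evalWt, Finset.sum_apply, Complex.ofReal_sum, Finset.sum_mul]
    rw [Finset.sum_comm]
  rw [lie_tup, h2, Finset.sum_smul]
  refine Finset.sum_congr rfl fun i _ => ?_
  rw [h1, AlternatingMap.map_update_smul]
  congr 1
  exact (ιMulti_update_single f i (f i)).trans (by rw [update_eq_self])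

/-- An exterior monomial whose weight is extremal is determined by its weight up to a scalar. -/
theorem tup_mem_span_of_wt_eq {f g : Fin k → Fin (2 * n + 1)} (hg : Injective g)
    (hg' : ∀ i j, g i ≠ (g j).rev) (h : ∑ i, wt (f i) = ∑ i, wt (g i)) :
    tup f ∈ Submodule.span ℂ {tup g} := by
  by_cases hf : Injective f
  swap
  · rw [tup_eq_zero hf]; exact Submodule.zero_mem _
  -- Compare the coordinate belonging to `g i`: since `g` contains no opposite pair, the weight of
  -- `g` has there the strict sign of that factor, and without this factor `f` cannot reach that
  -- sign.
  have key : ∀ i, ∃ j, f j = g i := by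
    intro i
    by_contra! hcon
    rcases index_cases (g i) with ⟨a, ha⟩ | ha | ⟨a, ha⟩
    · have h1 := congrFun h a
      simp only [Finset.sum_apply, wt] at h1
      have h2 : ∑ j, ((if f j = pos a then (1 : ℝ) else 0) - if f j = (pos a).rev then 1 else 0)
          ≤ 0 := by
        refine Finset.sum_nonpos fun j _ => ?_
        rw [if_neg (ha ▸ hcon j)]
        split_ifs <;> norm_num
      have h3 : ∀ j, (0 : ℝ) ≤ (if g j = pos a then (1 : ℝ) else 0) -
          if g j = (pos a).rev then 1 else 0 := by
        intro j
        rw [if_neg (c := g j = (pos a).rev) (ha ▸ hg' j i)]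
        split_ifs <;> norm_num
      have h4 := Finset.single_le_sum (fun j _ => h3 j) (Finset.mem_univ i)
      rw [if_pos ha, if_neg (ha ▸ hg' i i)] at h4
      linarith
    · exact hg' i i (by rw [ha, rev_mid])
    · have ha' : (g i).rev = pos a := by rw [ha, Fin.rev_rev]
      have h1 := congrFun h a
      simp only [Finset.sum_apply, wt] at h1
      have h2 : 0 ≤ ∑ j, ((if f j = pos a then (1 : ℝ) else 0) -
          if f j = (pos a).rev then 1 else 0) := by
        refine Finset.sum_nonneg fun j _ => ?_
        rw [if_neg (c := f j = (pos a).rev) (ha ▸ hcon j)]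
        split_ifs <;> norm_num
      have h3 : ∀ j, (if g j = pos a then (1 : ℝ) else 0) -
          (if g j = (pos a).rev then 1 else 0) ≤ 0 := by
        intro j
        rw [if_neg (c := g j = pos a) (ha' ▸ hg' j i)]
        split_ifs <;> norm_num
      have h4 := Finset.sum_le_sum_of_subset_of_nonneg (f := fun j =>
        -((if g j = pos a then (1 : ℝ) else 0) - (if g j = (pos a).rev then 1 else 0)))
        (Finset.subset_univ {i}) (fun j _ _ => by linarith [h3 j])
      rw [Finset.sum_singleton, if_neg (c := g i = pos a) (ha' ▸ hg' i i), if_pos ha,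
        Finset.sum_neg_distrib] at h4
      linarith
  choose τ hτ using key
  have hτi : Injective τ := fun i j hij => hg (by rw [← hτ, ← hτ, hij])
  let σ := Equiv.ofBijective τ (Finite.injective_iff_bijective.1 hτi)
  have : tup g = Equiv.Perm.sign σ • tup f := by
    rw [← tup_comp_perm]
    congr 1
    ext1 i
    exact (hτ i).symm
  rw [this, Submodule.mem_span_singleton]
  refine ⟨((Equiv.Perm.sign σ : ℤ) : ℂ), ?_⟩
  rcases Int.units_eq_one_or (Equiv.Perm.sign σ) with h | h <;> simp [h]

/-- The tuple of the indices of `e_1, …, e_k`. -/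
def base (hk : k ≤ n) (i : Fin k) : Fin (2 * n + 1) := pos (Fin.castLE hk i)

theorem base_injective (hk : k ≤ n) : Injective (base hk) :=
  pos_injective.comp (Fin.castLE_injective hk)

theorem base_ne_rev (hk : k ≤ n) (i j : Fin k) : base hk i ≠ (base hk j).rev := pos_ne_rev _ _

theorem exists_base_eq (hk : k ≤ n) (i : Fin k) {q : Fin (2 * n + 1)} (h : q < base hk i) :
    ∃ j ≠ i, base hk j = q :=
  ⟨⟨q, by have := i.2; have h' : (q : ℕ) < i := h; omega⟩,
    fun hh => by have h' : (q : ℕ) < i := h; rw [← hh] at h'; simp at h', rfl⟩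

theorem tup_update_base_eq_zero (hk : k ≤ n) (i : Fin k) {q : Fin (2 * n + 1)}
    (h : q < base hk i) : tup (update (base hk) i q) = 0 := by
  obtain ⟨j, hj, rfl⟩ := exists_base_eq hk i h
  apply tup_eq_zero
  intro hinj
  exact hj (hinj (by simp [hj]))

theorem sum_wt_base (hk : k < n) : ∑ i, wt (base hk.le i) = fundWeight n k := by
  ext j
  simp only [base, wt_pos, Finset.sum_apply, fundWeight, if_pos hk, eps, Pi.single_apply]
  by_cases hj : (j : ℕ) < k
  · rw [if_pos hj, Finset.sum_eq_single ⟨j, hj⟩]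
    · simp
    · intro b _ hb
      rw [if_neg]
      intro h
      apply hb
      ext
      simp [h]
    · simp
  · rw [if_neg hj]
    refine Finset.sum_eq_zero fun i _ => if_neg fun h => hj ?_
    rw [h]
    simp

/-- A raising operator replaces a factor $e_i$ by some earlier basis vector, which is already a
factor, so every term of its action vanishes. -/
theorem isHighestWeightVector_tup_base (hk : k < n) :
    IsHighestWeightVector (fundWeight n k) (tup (base hk.le)) := by
  refine ⟨⟨fun h => ?_, ?_⟩, fun x hx => ?_⟩
  · have := form_tup_self (base_injective hk.le)
    rw [h] at this
    simp at this
  · have := tup_mem_wtSpace (base hk.le)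
    rw [sum_wt_base hk] at this
    exact this
  · rw [eq_half_sum_elt x, smul_lie, sum_lie, Finset.sum_eq_zero, smul_zero]
    intro p _
    rw [sum_lie]
    refine Finset.sum_eq_zero fun q _ => ?_
    rw [smul_lie]
    rcases le_or_gt p q with h | h
    · rw [hx _ _ h, zero_smul]
    rw [elt_lie_tup, Finset.sum_eq_zero, smul_zero]
    intro i _
    have h1 : base hk.le i = p → tup (update (base hk.le) i q) = 0 :=
      fun hi => tup_update_base_eq_zero _ _ (hi ▸ h)
    have h2 : base hk.le i = q.rev → tup (update (base hk.le) i p.rev) = 0 :=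
      fun hi => tup_update_base_eq_zero _ _ (hi ▸ Fin.rev_lt_rev.2 h)
    rw [ite_eq_right_iff.2 h1, ite_eq_right_iff.2 h2, sub_zero]

/-! ### Irreducibility of the exterior powers -/

/-- Each factor rules out at most one index up to sign, and $k<n$. The spare pair $e_a,e_{\bar a}$
is what makes room for the rearrangements behind irreducibility. -/
theorem exists_free (hk : k < n) (f : Fin k → Fin (2 * n + 1)) :
    ∃ a : Fin n, ∀ j, f j ≠ pos a ∧ f j ≠ (pos a).rev := by
  classical
  have hex : ∀ j, ∃ b : Fin n, ∀ a, (f j = pos a ∨ f j = (pos a).rev) → a = b := by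
    intro j
    rcases index_cases (f j) with ⟨b, hb⟩ | hb | ⟨b, hb⟩
    · refine ⟨b, fun a ha => ?_⟩
      rw [hb] at ha
      rcases ha with ha | ha
      · exact (pos_injective ha).symm
      · exact absurd ha (pos_ne_rev _ _)
    -- The middle vector rules out no index, so any default value will do.
    · refine ⟨⟨0, by omega⟩, fun a ha => ?_⟩
      rw [hb] at ha
      rcases ha with ha | ha
      · exact absurd ha.symm (pos_ne_mid _)
      · exact absurd ha.symm (rev_pos_ne_mid _)
    · refine ⟨b, fun a ha => ?_⟩
      rw [hb] at ha
      rcases ha with ha | ha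
      · exact absurd ha.symm (pos_ne_rev _ _)
      · exact (pos_injective (Fin.rev_injective ha)).symm
  choose b hb using hex
  obtain ⟨a, ha⟩ : ∃ a, a ∉ Finset.univ.image b := by
    by_contra! h
    have h1 : (Finset.univ : Finset (Fin n)) ⊆ Finset.univ.image b := fun a _ => h a
    have h2 := (Finset.card_le_card h1).trans Finset.card_image_le
    simp at h2
    omega
  refine ⟨a, fun j => ⟨fun h => ha ?_, fun h => ha ?_⟩⟩
  · rw [hb j a (Or.inl h)]; simp
  · rw [hb j a (Or.inr h)]; simp

theorem update_injective {α β : Type*} [DecidableEq α] {f : α → β} (hf : Injective f) {i : α}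
    {q : β} (hq : ∀ j ≠ i, f j ≠ q) : Injective (update f i q) := by
  intro a b hab
  rcases eq_or_ne a i with ha | ha <;> rcases eq_or_ne b i with hb | hb
  · rw [ha, hb]
  · subst ha
    rw [update_self, update_of_ne hb] at hab
    exact absurd hab.symm (hq b hb)
  · subst hb
    rw [update_self, update_of_ne ha] at hab
    exact absurd hab (hq a ha)
  · rw [update_of_ne ha, update_of_ne hb] at hab
    exact hf hab

section Cyclic

variable {N : LieSubmodule ℂ (so n) (⋀[ℂ]^k (Fin (2 * n + 1) → ℂ))}

theorem tup_update_mem {f : Fin k → Fin (2 * n + 1)} (hf : Injective f) (hN : tup f ∈ N)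
    (i : Fin k) {q : Fin (2 * n + 1)} (hq : ∀ j, f j ≠ q.rev) : tup (update f i q) ∈ N := by
  rw [← elt_lie_tup_of_forall_ne hf rfl hq]
  exact N.lie_mem hN

/-- An exterior monomial is recovered from the result of replacing one of its factors. -/
theorem tup_mem_of_update {f : Fin k → Fin (2 * n + 1)} (i : Fin k) {q : Fin (2 * n + 1)}
    (hinj : Injective (update f i q)) (hN : tup (update f i q) ∈ N) (hq : f i ≠ q.rev)
    (hf : ∀ j ≠ i, f j ≠ (f i).rev) : tup f ∈ N := by
  have := tup_update_mem hinj hN i (q := f i) fun j => by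
    rcases eq_or_ne j i with rfl | h
    · rw [update_self]
      intro h
      exact hq (by rw [h, Fin.rev_rev])
    · rw [update_of_ne h]
      exact hf j h
  rwa [update_idem, update_eq_self] at this

/-- Induction on the number of factors that differ from $e_i$ in place $i$. A root vector replaces
one factor cleanly when the opposite of the new vector is absent; whenever this is obstructed, the
replacement makes a detour through the spare index of `exists_free`. -/
theorem tup_mem_of_pair_free (hk : k < n) (hN : tup (base hk.le) ∈ N)
    {f : Fin k → Fin (2 * n + 1)} (hf : Injective f) (hf' : ∀ i j, i ≠ j → f i ≠ (f j).rev) :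
    tup f ∈ N := by
  classical
  obtain ⟨m, hm⟩ : ∃ m, (Finset.univ.filter fun i => f i ≠ base hk.le i).card ≤ m := ⟨_, le_rfl⟩
  induction m generalizing f with
  | zero =>
    have : f = base hk.le := by
      ext1 i
      by_contra h
      have h1 : i ∈ (Finset.univ.filter fun i => f i ≠ base hk.le i) := by simp [h]
      rw [Finset.card_eq_zero.1 (Nat.le_zero.1 hm)] at h1
      simp at h1
    rwa [this]
  | succ m ih =>
    have step : ∀ {f : Fin k → Fin (2 * n + 1)}, Injective f → (∀ i j, i ≠ j → f i ≠ (f j).rev) →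
        (Finset.univ.filter fun i => f i ≠ base hk.le i).card ≤ m + 1 → ∀ i, f i ≠ base hk.le i →
        (∀ j ≠ i, f j ≠ base hk.le i ∧ f j ≠ (base hk.le i).rev) → tup f ∈ N := by
      intro f hf hf' hm i hi hj
      have hginj : Injective (update f i (base hk.le i)) :=
        update_injective hf fun j hji => (hj j hji).1
      have hg : tup (update f i (base hk.le i)) ∈ N := by
        refine ih hginj ?_ ?_
        · intro a b hab
          rcases eq_or_ne a i with ha | ha <;> rcases eq_or_ne b i with hb | hb
          · exact absurd (ha.trans hb.symm) hab
          · subst ha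
            rw [update_self, update_of_ne hb]
            intro h
            exact (hj b hb).2 (by rw [h, Fin.rev_rev])
          · subst hb
            rw [update_self, update_of_ne ha]
            exact (hj a ha).2
          · rw [update_of_ne ha, update_of_ne hb]
            exact hf' a b hab
        · have hss : (Finset.univ.filter fun l => update f i (base hk.le i) l ≠ base hk.le l) ⊂
              (Finset.univ.filter fun l => f l ≠ base hk.le l) := by
            rw [Finset.ssubset_iff_of_subset]
            · exact ⟨i, by simp [hi], by simp⟩
            · intro l hl
              rcases eq_or_ne l i with rfl | hli
              · simp at hl
              · simpa [hli] using hl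
          have := Finset.card_lt_card hss
          omega
      -- No root vector carries $e_i$ to $e_{\bar i}$ (that `elt` is zero), so here the spare index
      -- serves as an intermediate stop.
      by_cases hrev : f i = (base hk.le i).rev
      · obtain ⟨a, ha⟩ := exists_free hk f
        have h1 : base hk.le i ≠ (pos a).rev := pos_ne_rev _ _
        have h2 : base hk.le i ≠ pos a := fun h => (ha i).2 (by rw [hrev, h])
        have hg' := tup_update_mem hginj hg i (q := pos a) fun j => by
          rcases eq_or_ne j i with rfl | h
          · rwa [update_self]
          · rw [update_of_ne h]
            exact (ha j).2
        rw [update_idem] at hg'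
        refine tup_mem_of_update i (update_injective hf fun j _ => (ha j).1) hg' (ha i).2 ?_
        intro j hji
        rw [hrev, Fin.rev_rev]
        exact (hj j hji).1
      · exact tup_mem_of_update i hginj hg hrev fun j hji => hf' j i hji
    by_cases hall : ∃ i, f i ≠ base hk.le i
    swap
    · push Not at hall
      rwa [funext hall]
    obtain ⟨i, hi⟩ := hall
    by_cases hj : ∃ j ≠ i, f j = base hk.le i ∨ f j = (base hk.le i).rev
    swap
    · push Not at hj
      exact step hf hf' hm i hi hj
    obtain ⟨j, hji, hj⟩ := hj
    obtain ⟨a, ha⟩ := exists_free hk f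
    have hai : pos a ≠ base hk.le i ∧ pos a ≠ (base hk.le i).rev := by
      refine ⟨fun h => ?_, pos_ne_rev _ _⟩
      rcases hj with hj | hj
      · exact (ha j).1 (by rw [hj, h])
      · exact (ha j).2 (by rw [hj, h])
    -- The factor in place `j` blocks place `i` and is parked at the spare index. Place `j` was
    -- already wrong, so the number of wrong places does not grow.
    have hinj : Injective (update f j (pos a)) := update_injective hf fun l _ => (ha l).1
    refine tup_mem_of_update j hinj (step hinj ?_ ?_ i ?_ ?_) (ha j).2 fun l hl => hf' l j hl
    · intro b c hbc
      rcases eq_or_ne b j with hb | hb <;> rcases eq_or_ne c j with hc | hc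
      · exact absurd (hb.trans hc.symm) hbc
      · subst hb
        rw [update_self, update_of_ne hc]
        intro h
        exact (ha c).2 (by rw [h, Fin.rev_rev])
      · subst hc
        rw [update_self, update_of_ne hb]
        exact (ha b).2
      · rw [update_of_ne hb, update_of_ne hc]
        exact hf' b c hbc
    · refine (Finset.card_le_card ?_).trans hm
      intro l hl
      rcases eq_or_ne l j with rfl | hlj
      · simp only [Finset.mem_filter, Finset.mem_univ, true_and]
        rcases hj with hj | hj
        · rw [hj]
          exact fun h => hji (base_injective hk.le h).symm
        · rw [hj]
          exact (base_ne_rev hk.le _ _).symm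
      · simpa [hlj] using hl
    · rwa [update_of_ne hji.symm]
    · intro l hl
      rcases eq_or_ne l j with rfl | hlj
      · rwa [update_self]
      · rw [update_of_ne hlj]
        constructor
        · intro h
          rcases hj with hj | hj
          · exact hlj (hf (h.trans hj.symm))
          · exact hf' l j hlj (by rw [h, hj, Fin.rev_rev])
        · intro h
          rcases hj with hj | hj
          · exact hf' l j hlj (by rw [h, hj])
          · exact hlj (hf (h.trans hj.symm))

/-- Induction on the number of factors lying in opposite pairs. Breaking a pair with a spare vector
$e_q$ and then applying a root vector gives the monomial minus the one in which the pair has become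
$e_q,e_{\bar q}$. Using both $q=a$ and $q=\bar a$, the unwanted monomials differ by a transposition,
and the sum is twice the desired one. -/
theorem tup_mem_of_tup_base_mem (hk : k < n) (hN : tup (base hk.le) ∈ N)
    (f : Fin k → Fin (2 * n + 1)) : tup f ∈ N := by
  classical
  by_cases hf : Injective f
  swap
  · rw [tup_eq_zero hf]; exact N.zero_mem
  obtain ⟨m, hm⟩ : ∃ m, (Finset.univ.filter fun i => ∃ j ≠ i, f j = (f i).rev).card ≤ m :=
    ⟨_, le_rfl⟩
  induction m generalizing f with
  | zero =>
    refine tup_mem_of_pair_free hk hN hf fun i j hij h => ?_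
    have h1 : j ∈ (Finset.univ.filter fun i => ∃ j ≠ i, f j = (f i).rev) := by
      simpa using ⟨i, hij, h⟩
    rw [Finset.card_eq_zero.1 (Nat.le_zero.1 hm)] at h1
    simp at h1
  | succ m ih =>
    by_cases hp : ∃ i j, i ≠ j ∧ f i = (f j).rev
    swap
    · push Not at hp
      exact tup_mem_of_pair_free hk hN hf hp
    obtain ⟨j, i, hij, hj⟩ := hp
    obtain ⟨a, ha⟩ := exists_free hk f
    have red : ∀ q, (∀ j, f j ≠ q ∧ f j ≠ q.rev) → q ≠ q.rev →
        Injective (update f i q) ∧ tup (update f i q) ∈ N := by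
      intro q hq hqq
      have hinj : Injective (update f i q) := update_injective hf fun l _ => (hq l).1
      refine ⟨hinj, ih _ hinj ?_⟩
      have hss : (Finset.univ.filter fun l => ∃ j ≠ l, update f i q j = (update f i q l).rev) ⊂
          (Finset.univ.filter fun l => ∃ j ≠ l, f j = (f l).rev) := by
        rw [Finset.ssubset_iff_of_subset]
        · refine ⟨i, by simpa using ⟨j, hij, hj⟩, ?_⟩
          simp only [Finset.mem_filter, Finset.mem_univ, true_and, not_exists, not_and]
          intro l hl
          rw [update_self, update_of_ne hl]
          exact (hq l).2
        · intro l hl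
          simp only [Finset.mem_filter, Finset.mem_univ, true_and] at hl ⊢
          obtain ⟨c, hcl, hc⟩ := hl
          rcases eq_or_ne l i with rfl | hli
          · exact ⟨j, hij, hj⟩
          · rw [update_of_ne hli] at hc
            rcases eq_or_ne c i with rfl | hci
            · rw [update_self] at hc
              exact absurd (by rw [hc, Fin.rev_rev]) (hq l).2
            · rw [update_of_ne hci] at hc
              exact ⟨c, hcl, hc⟩
      have := Finset.card_lt_card hss
      omega
    have move : ∀ q, (∀ j, f j ≠ q ∧ f j ≠ q.rev) → q ≠ q.rev →
        tup f - tup (update (update f i q) j q.rev) ∈ N := by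
      intro q hq hqq
      obtain ⟨hinj, hmem⟩ := red q hq hqq
      have h := N.lie_mem (x := elt q (f i)) hmem
      rw [elt_lie_tup_of_eq_of_eq hinj (i := i) (j := j) (update_self _ _ _)
        (by rw [update_of_ne hij, hj]), update_idem, update_eq_self] at h
      exact h
    have hrr : pos a ≠ (pos a).rev := pos_ne_rev a a
    have h1 := move (pos a) ha hrr
    have h2 := move (pos a).rev (fun l => ⟨(ha l).2, by rw [Fin.rev_rev]; exact (ha l).1⟩)
      (by rw [Fin.rev_rev]; exact hrr.symm)
    have h3 : tup (update (update f i (pos a).rev) j (pos a).rev.rev) =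
        - tup (update (update f i (pos a)) j (pos a).rev) := by
      rw [← tup_swap _ hij]
      congr 1
      ext1 l
      rcases eq_or_ne l j with rfl | hlj
      · simp [hij.symm]
      · rcases eq_or_ne l i with rfl | hli
        · simp [hij.symm]
        · simp [hlj, hli]
    rw [h3] at h2
    have h4 := N.add_mem h1 h2
    rw [sub_neg_eq_add, sub_add_add_cancel, ← two_smul ℂ] at h4
    have h5 := N.smul_mem (1 / 2 : ℂ) h4
    rwa [smul_smul, one_div_mul_cancel two_ne_zero, one_smul] at h5

theorem eq_top_of_tup_base_mem (hk : k < n) (hN : tup (base hk.le) ∈ N) : N = ⊤ := by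
  rw [← LieSubmodule.toSubmodule_eq_top, eq_top_iff, ← span_tup, Submodule.span_le]
  rintro _ ⟨f, rfl⟩
  exact tup_mem_of_tup_base_mem hk hN f

end Cyclic

/-- The transpose of an element of `so_{2n+1}`. -/
def transp (x : so n) : so n := ⟨x.1.transpose, mem_so.2 fun i j => apply_eq_neg_rev x j i⟩

theorem form_lie (x : so n) (a b : ⋀[ℂ]^k (Fin (2 * n + 1) → ℂ)) :
    form _ k ⁅x, a⁆ b = form _ k a ⁅transp x, b⁆ := by
  refine form_deriv (fun v w => ?_) a b
  simp only [Matrix.mulVecLin_apply, transp]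
  rw [Matrix.mulVec_transpose, dotProduct_comm, Matrix.dotProduct_mulVec, dotProduct_comm]

theorem transp_elt (p q : Fin (2 * n + 1)) : transp (elt p q) = elt q p := by
  ext i j
  change (elt p q).1 j i = (elt q p).1 i j
  rw [elt_apply, elt_apply]
  simp only [and_comm]

theorem form_eq_zero_of_wt_ne {μ ν : Fin n → ℝ} (h : μ ≠ ν)
    {a b : ⋀[ℂ]^k (Fin (2 * n + 1) → ℂ)} (ha : a ∈ wtSpace _ μ) (hb : b ∈ wtSpace _ ν) :
    form _ k a b = 0 := by
  by_contra hne
  apply h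
  refine evalWt_injective fun x hx => ?_
  have h1 := form_lie x a b
  have h2 : transp x = x := by
    ext i j
    change x.1 j i = x.1 i j
    rcases eq_or_ne i j with rfl | hij
    · rfl
    · rw [hx i j hij, hx j i hij.symm]
  rw [h2, ha x hx, hb x hx] at h1
  simpa [hne] using h1

/-- The orthogonal complement of a submodule. -/
def orthogonal (N : LieSubmodule ℂ (so n) (⋀[ℂ]^k (Fin (2 * n + 1) → ℂ))) :
    LieSubmodule ℂ (so n) (⋀[ℂ]^k (Fin (2 * n + 1) → ℂ)) where
  toSubmodule := ⨅ u ∈ N, LinearMap.ker (form (Fin (2 * n + 1)) k u)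
  lie_mem {x w} hw := by
    change w ∈ ⨅ u ∈ N, LinearMap.ker (form (Fin (2 * n + 1)) k u) at hw
    change ⁅x, w⁆ ∈ ⨅ u ∈ N, LinearMap.ker (form (Fin (2 * n + 1)) k u)
    simp only [Submodule.mem_iInf, LinearMap.mem_ker] at hw ⊢
    intro u hu
    rw [form_comm, form_lie, form_comm]
    exact hw _ (N.lie_mem hu)

theorem mem_orthogonal {N : LieSubmodule ℂ (so n) (⋀[ℂ]^k (Fin (2 * n + 1) → ℂ))}
    {w : ⋀[ℂ]^k (Fin (2 * n + 1) → ℂ)} :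
    w ∈ orthogonal N ↔ ∀ u ∈ N, form (Fin (2 * n + 1)) k u w = 0 := by
  change w ∈ ⨅ u ∈ N, LinearMap.ker (form (Fin (2 * n + 1)) k u) ↔ _
  simp only [Submodule.mem_iInf, LinearMap.mem_ker]

/-- A proper submodule misses $e=e_1\wedge\dots\wedge e_k$, which generates everything. The weight
of $e$ has multiplicity one and weight spaces are orthogonal, so the submodule is orthogonal to $e$.
Its orthogonal complement is then a submodule containing $e$, hence the whole space, and
nondegeneracy makes the submodule zero. -/
theorem isIrreducible_exteriorPower (hk : k < n) :
    LieModule.IsIrreducible ℂ (so n) (⋀[ℂ]^k (Fin (2 * n + 1) → ℂ)) := by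
  set e := tup (base hk.le) with he
  have hhw := isHighestWeightVector_tup_base hk
  have : Nontrivial (⋀[ℂ]^k (Fin (2 * n + 1) → ℂ)) := ⟨⟨e, 0, hhw.1.1⟩⟩
  refine LieModule.IsIrreducible.mk fun N hN => ?_
  by_contra hNtop
  have heN : e ∉ N := fun h => hNtop (eq_top_of_tup_base_mem hk h)
  -- the coefficient of `e` vanishes on `N`
  have hcoef : ∀ u ∈ N, form _ k u e = 0 := by
    intro u hu
    have hdec : ∀ u : ⋀[ℂ]^k (Fin (2 * n + 1) → ℂ), u ∈ Submodule.span ℂ {e} ⊔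
        ⨆ ν : Fin n → ℝ, ⨆ (_ : ν ≠ fundWeight n k), wtSpace _ ν := by
      intro u
      have hu : u ∈ Submodule.span ℂ (Set.range (tup (n := n) (k := k))) := by
        rw [span_tup]; trivial
      refine Submodule.span_le.2 ?_ hu
      rintro _ ⟨f, rfl⟩
      by_cases h : ∑ i, wt (f i) = fundWeight n k
      · exact Submodule.mem_sup_left (tup_mem_span_of_wt_eq (base_injective _) (base_ne_rev _)
          (h.trans (sum_wt_base hk).symm))
      · exact Submodule.mem_sup_right (Submodule.mem_iSup_of_mem _ (Submodule.mem_iSup_of_mem h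
          (tup_mem_wtSpace f)))
    obtain ⟨a, ha, b, hb, rfl⟩ := Submodule.mem_sup.1 (hdec u)
    obtain ⟨c, rfl⟩ := Submodule.mem_span_singleton.1 ha
    have hform : ∀ b ∈ ⨆ ν : Fin n → ℝ, ⨆ (_ : ν ≠ fundWeight n k),
        wtSpace (⋀[ℂ]^k (Fin (2 * n + 1) → ℂ)) ν, form _ k b e = 0 := by
      intro b hb
      have hle : (⨆ ν : Fin n → ℝ, ⨆ (_ : ν ≠ fundWeight n k),
          wtSpace (⋀[ℂ]^k (Fin (2 * n + 1) → ℂ)) ν) ≤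
          LinearMap.ker ((form (Fin (2 * n + 1)) k).flip e) := by
        refine iSup₂_le fun ν hν b hb => ?_
        rw [LinearMap.mem_ker, LinearMap.flip_apply]
        exact form_eq_zero_of_wt_ne hν hb hhw.1.2
      have := LinearMap.mem_ker.1 (hle hb)
      rwa [LinearMap.flip_apply] at this
    have h4 : c • e ∈ N := mem_of_add_mem N (Submodule.smul_mem _ c hhw.1.2) hb hu
    have hc : c = 0 := by
      by_contra hc
      apply heN
      have := N.smul_mem c⁻¹ h4
      rwa [smul_smul, inv_mul_cancel₀ hc, one_smul] at this
    rw [hc, zero_smul, zero_add]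
    exact hform b hb
  have hP := eq_top_of_tup_base_mem hk (N := orthogonal N) (mem_orthogonal.2 hcoef)
  apply hN
  rw [LieSubmodule.eq_bot_iff]
  intro u hu
  refine eq_zero_of_form_eq_zero fun w => ?_
  have hw : w ∈ orthogonal N := by rw [hP]; trivial
  rw [form_comm]
  exact mem_orthogonal.1 hw u hu

end

/-! ### Norm estimates for roots, and upper bounds for the degree when $k<n$ -/

noncomputable section

open Function

variable {n k : ℕ}

/-! ### Lower bounds for the number of positive roots in a decomposition -/

theorem apply_le_one_of_mem_posRoots {β : Fin n → ℝ} (hβ : β ∈ posRoots n) (a : Fin n) :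
    β a ≤ 1 := by
  rcases hβ with ⟨i, rfl⟩ | ⟨i, j, hij, rfl | rfl⟩
  · simp only [eps, Pi.single_apply]; split_ifs <;> norm_num
  · simp only [eps, Pi.sub_apply, Pi.single_apply]; split_ifs <;> norm_num
  · simp only [eps, Pi.add_apply, Pi.single_apply]
    split_ifs with h1 h2
    · exact absurd (h1.symm.trans h2) hij.ne
    all_goals norm_num

theorem sum_abs_eps (i : Fin n) : ∑ a, |eps i a| = 1 := by
  rw [Finset.sum_eq_single i] <;> simp +contextual [eps]

theorem sum_abs_le_two_of_mem_posRoots {β : Fin n → ℝ} (hβ : β ∈ posRoots n) :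
    ∑ a, |β a| ≤ 2 := by
  have key : ∀ i j : Fin n, ∑ a, (|eps i a| + |eps j a|) = 2 := by
    intro i j
    rw [Finset.sum_add_distrib, sum_abs_eps, sum_abs_eps]; norm_num
  rcases hβ with ⟨i, rfl⟩ | ⟨i, j, hij, rfl | rfl⟩
  · rw [sum_abs_eps]; norm_num
  · exact (Finset.sum_le_sum fun a _ => abs_sub (eps i a) (eps j a)).trans (key i j).le
  · exact (Finset.sum_le_sum fun a _ => abs_add_le (eps i a) (eps j a)).trans (key i j).le

theorem apply_le_of_mem_decompositionLengths {μ : Fin n → ℝ} {N : ℕ}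
    (hN : N ∈ decompositionLengths μ) (a : Fin n) : μ a ≤ N := by
  obtain ⟨β, hβ, rfl⟩ := hN
  rw [Finset.sum_apply]
  refine (Finset.sum_le_sum fun j _ => apply_le_one_of_mem_posRoots (hβ j) a).trans ?_
  simp

theorem sum_abs_le_of_mem_decompositionLengths {μ : Fin n → ℝ} {N : ℕ}
    (hN : N ∈ decompositionLengths μ) : ∑ a, |μ a| ≤ 2 * N := by
  obtain ⟨β, hβ, rfl⟩ := hN
  calc ∑ a, |(∑ j, β j) a| ≤ ∑ a, ∑ j, |β j a| := by
        refine Finset.sum_le_sum fun a _ => ?_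
        rw [Finset.sum_apply]
        exact Finset.abs_sum_le_sum_abs _ _
    _ = ∑ j, ∑ a, |β j a| := Finset.sum_comm
    _ ≤ ∑ _j : Fin N, (2 : ℝ) :=
        Finset.sum_le_sum fun j _ => sum_abs_le_two_of_mem_posRoots (hβ j)
    _ = 2 * N := by simp [mul_comm]

theorem SignedPerm.act_apply (w : SignedPerm n) (μ : Fin n → ℝ) (i : Fin n) :
    w.act μ (w.perm i) = μ i * ((w.sign i : ℤ) : ℝ) := by
  rw [SignedPerm.act, Finset.sum_apply, Finset.sum_eq_single i]
  · simp [eps]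
  · intro j _ hj
    simp [eps, hj.symm]
  · simp

theorem SignedPerm.abs_sign (w : SignedPerm n) (i : Fin n) : |((w.sign i : ℤ) : ℝ)| = 1 := by
  rcases Int.units_eq_one_or (w.sign i) with h | h <;> simp [h]

theorem SignedPerm.sum_abs_act (w : SignedPerm n) (μ : Fin n → ℝ) :
    ∑ a, |w.act μ a| = ∑ a, |μ a| := by
  rw [← Equiv.sum_comp w.perm]
  refine Finset.sum_congr rfl fun i _ => ?_
  rw [w.act_apply, abs_mul, w.abs_sign, mul_one]

/-! ### Standard exterior monomials -/

/-- The exterior monomial with indices `g` has extremal weight, and the factors `e_{\pm i}`,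
`i ≤ k`, stand in the `i`-th place. -/
structure IsStandard (hk : k ≤ n) (g : Fin k → Fin (2 * n + 1)) : Prop where
  inj : Injective g
  ne_rev : ∀ i j, g i ≠ (g j).rev
  cases : ∀ i, g i = base hk i ∨ g i = (base hk i).rev ∨
    ∀ j, g i ≠ base hk j ∧ g i ≠ (base hk j).rev

/-- The places of the factors `e_{2n+2-i}`, `i ≤ k`. -/
def flips (hk : k ≤ n) (g : Fin k → Fin (2 * n + 1)) : Finset (Fin k) :=
  Finset.univ.filter fun i => g i = (base hk i).rev

/-- The places of the factors other than `e_i` and `e_{2n+2-i}`, `i ≤ k`. -/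
def moves (hk : k ≤ n) (g : Fin k → Fin (2 * n + 1)) : Finset (Fin k) :=
  Finset.univ.filter fun i => ∀ j, g i ≠ base hk j ∧ g i ≠ (base hk j).rev

namespace IsStandard

variable {hk : k ≤ n} {g : Fin k → Fin (2 * n + 1)} (hg : IsStandard hk g)

include hg

theorem eq_base_iff {i j : Fin k} (h : g i = base hk j) : i = j := by
  rcases hg.cases i with h1 | h1 | h1
  · exact base_injective hk (h1.symm.trans h)
  · exact absurd (h.symm.trans h1) (base_ne_rev hk _ _)
  · exact absurd h (h1 j).1

theorem eq_rev_base_iff {i j : Fin k} (h : g i = (base hk j).rev) : i = j := by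
  rcases hg.cases i with h1 | h1 | h1
  · exact absurd (h1.symm.trans h) (base_ne_rev hk _ _)
  · exact base_injective hk (Fin.rev_injective (h1.symm.trans h))
  · exact absurd h (h1 j).2

/-- The monomials with factors of `g` on `T` and $e_i$ elsewhere are the intermediate stages of the
construction. No factor repeats, because in a standard monomial $e_j$ can occur only in place $j$.
-/
theorem piecewise_injective (T : Finset (Fin k)) : Injective (T.piecewise g (base hk)) := by
  intro i j h
  by_cases hi : i ∈ T <;> by_cases hj : j ∈ T <;> simp only [hi, hj, not_false_eq_true,
    Finset.piecewise_eq_of_mem, Finset.piecewise_eq_of_notMem] at h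
  · exact hg.inj h
  · exact hg.eq_base_iff h
  · exact (hg.eq_base_iff h.symm).symm
  · exact base_injective hk h

theorem mem_or_mem (i : Fin k) : g i = base hk i ∨ i ∈ moves hk g ∪ flips hk g := by
  rcases hg.cases i with h | h | h <;> simp [moves, flips, h]

theorem piecewise_eq : (moves hk g ∪ flips hk g).piecewise g (base hk) = g := by
  ext1 i
  by_cases hi : i ∈ moves hk g ∪ flips hk g
  · rw [Finset.piecewise_eq_of_mem _ _ _ hi]
  · rw [Finset.piecewise_eq_of_notMem _ _ _ hi]
    exact ((hg.mem_or_mem i).resolve_right hi).symm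

omit hg in
theorem _root_.TypeB.base_lt_of_mem_moves {c : Fin k} (hc : c ∈ moves hk g) (i : Fin k) :
    base hk i < g c := by
  simp only [moves, Finset.mem_filter, Finset.mem_univ, true_and] at hc
  rcases lt_trichotomy (g c) (base hk i) with h | h | h
  · obtain ⟨j, -, hj⟩ := exists_base_eq hk i h
    exact absurd hj.symm (hc j).1
  · exact absurd h (hc i).1
  · exact h

theorem piecewise_ne_rev_of_mem_moves {c : Fin k} (hc : c ∈ moves hk g) (T : Finset (Fin k))
    (j : Fin k) : T.piecewise g (base hk) j ≠ (g c).rev := by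
  by_cases hj : j ∈ T
  · rw [Finset.piecewise_eq_of_mem _ _ _ hj]
    exact hg.ne_rev j c
  · rw [Finset.piecewise_eq_of_notMem _ _ _ hj]
    simp only [moves, Finset.mem_filter, Finset.mem_univ, true_and] at hc
    exact fun h => (hc j).2 (by rw [h, Fin.rev_rev])

end IsStandard

theorem base_lt_mid (hk : k ≤ n) (i : Fin k) : base hk i < mid n := by
  rw [Fin.lt_def]; simp [base]; omega

theorem mid_lt_rev_base (hk : k ≤ n) (i : Fin k) : mid n < (base hk i).rev := by
  rw [Fin.lt_def]; simp [base, Fin.val_rev]; omega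

theorem base_lt_rev_base (hk : k ≤ n) (i j : Fin k) : base hk i < (base hk j).rev :=
  (base_lt_mid hk i).trans (mid_lt_rev_base hk j)

/-! ### Upper bounds for the PBW degree -/

section Upper

variable {u : ⋀[ℂ]^k (Fin (2 * n + 1) → ℂ)} {s : ℕ}

theorem tup_update_mem_pbwFiltration {f : Fin k → Fin (2 * n + 1)} (hf : Injective f)
    (hs : tup f ∈ pbwFiltration n u s) (i : Fin k) {q : Fin (2 * n + 1)} (hlt : f i < q)
    (hq : ∀ j, f j ≠ q.rev) : tup (update f i q) ∈ pbwFiltration n u (s + 1) := by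
  rw [← elt_lie_tup_of_forall_ne hf rfl hq]
  exact elt_lie_mem_pbwFiltration hlt hs

/-- The root vector of $-(\varepsilon_i+\varepsilon_j)$ is applied twice. The first application
gives a difference of two monomials; the second turns both into the doubly flipped one, with signs
that add up to a factor 2. -/
theorem tup_flip_flip_mem_pbwFiltration {hk : k ≤ n} {f : Fin k → Fin (2 * n + 1)}
    (hf : Injective f) (hs : tup f ∈ pbwFiltration n u s) {i j : Fin k} (hij : i ≠ j)
    (hi : f i = base hk i) (hj : f j = base hk j) (hi' : ∀ l, f l ≠ (base hk i).rev)
    (hj' : ∀ l, f l ≠ (base hk j).rev) :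
    tup (update (update f j (base hk j).rev) i (base hk i).rev) ∈ pbwFiltration n u (s + 2) := by
  have hlt : base hk i < (base hk j).rev := base_lt_rev_base hk i j
  have hinj₁ : Injective (update f i (base hk j).rev) := update_injective hf fun l _ => hj' l
  have hinj₂ : Injective (update f j (base hk i).rev) := update_injective hf fun l _ => hi' l
  have h1 : ⁅elt (base hk i) (base hk j).rev, tup f⁆ =
      tup (update f i (base hk j).rev) - tup (update f j (base hk i).rev) :=
    elt_lie_tup_of_eq_of_eq hf hi (by rw [hj, Fin.rev_rev])
  have h2 : ⁅elt (base hk i) (base hk j).rev, tup (update f i (base hk j).rev)⁆ =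
      - tup (update (update f i (base hk j).rev) j (base hk i).rev) := by
    rw [← neg_neg (elt (base hk i) (base hk j).rev), ← elt_rev_rev, neg_lie, Fin.rev_rev,
      elt_lie_tup_of_forall_ne hinj₁ (i := j) (by rw [update_of_ne hij.symm, hj])]
    intro l
    rw [Fin.rev_rev]
    rcases eq_or_ne l i with rfl | hl
    · rw [update_self]
      exact (base_ne_rev hk _ _).symm
    · rw [update_of_ne hl, ← hi]
      exact fun h => hl (hf h)
  have h3 : ⁅elt (base hk i) (base hk j).rev, tup (update f j (base hk i).rev)⁆ =
      tup (update (update f j (base hk i).rev) i (base hk j).rev) := by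
    rw [elt_lie_tup_of_forall_ne hinj₂ (i := i) (by rw [update_of_ne hij, hi])]
    intro l
    rw [Fin.rev_rev]
    rcases eq_or_ne l j with rfl | hl
    · rw [update_self]
      exact (base_ne_rev hk _ _).symm
    · rw [update_of_ne hl, ← hj]
      exact fun h => hl (hf h)
  have h4 := elt_lie_mem_pbwFiltration hlt (elt_lie_mem_pbwFiltration hlt hs)
  have h5 : tup (update (update f i (base hk j).rev) j (base hk i).rev) =
      - tup (update (update f j (base hk j).rev) i (base hk i).rev) := by
    rw [← tup_swap _ hij]
    congr 1
    ext1 l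
    rcases eq_or_ne l j with rfl | hlj
    · simp [hij.symm]
    · rcases eq_or_ne l i with rfl | hli
      · simp [hij, hij.symm]
      · simp [hlj, hli]
  have h7 : update (update f j (base hk i).rev) i (base hk j).rev =
      update (update f i (base hk j).rev) j (base hk i).rev := update_comm hij.symm _ _ _
  rw [h1, lie_sub, h2, h3, h7, h5, neg_neg, sub_neg_eq_add,
    ← two_smul ℂ] at h4
  have h6 := Submodule.smul_mem _ (1 / 2 : ℂ) h4
  rwa [smul_smul, one_div_mul_cancel two_ne_zero, one_smul] at h6

variable {hk : k ≤ n} {g : Fin k → Fin (2 * n + 1)} (hg : IsStandard hk g)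

include hg

/-- Each moved factor is put in place by one root vector, whatever has been done in the other
places. -/
theorem IsStandard.piecewise_union_mem {T D : Finset (Fin k)} (hD : D ⊆ moves hk g)
    (hTD : Disjoint D T) (hs : tup (T.piecewise g (base hk)) ∈ pbwFiltration n u s) :
    tup ((D ∪ T).piecewise g (base hk)) ∈ pbwFiltration n u (s + D.card) := by
  classical
  induction D using Finset.induction_on with
  | empty =>
    rw [Finset.empty_union]
    simpa using hs
  | insert c D hcD ih =>
    have hcT : c ∉ D ∪ T := by
      rw [Finset.mem_union, not_or]
      exact ⟨hcD, Finset.disjoint_left.1 hTD (Finset.mem_insert_self _ _)⟩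
    have hc : c ∈ moves hk g := hD (Finset.mem_insert_self _ _)
    rw [Finset.insert_union, Finset.piecewise_insert, Finset.card_insert_of_notMem hcD, ← add_assoc]
    refine tup_update_mem_pbwFiltration (hg.piecewise_injective _)
      (ih ((Finset.subset_insert _ _).trans hD)
        (Finset.disjoint_of_subset_left (Finset.subset_insert _ _) hTD)) c ?_
      (hg.piecewise_ne_rev_of_mem_moves hc _)
    rw [Finset.piecewise_eq_of_notMem _ _ _ hcT]
    exact base_lt_of_mem_moves hc c

theorem IsStandard.piecewise_ne_rev_base {T : Finset (Fin k)} {i : Fin k} (hi : i ∉ T)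
    (l : Fin k) : T.piecewise g (base hk) l ≠ (base hk i).rev := by
  by_cases hl : l ∈ T
  · rw [Finset.piecewise_eq_of_mem _ _ _ hl]
    exact fun h => hi (hg.eq_rev_base_iff h ▸ hl)
  · rw [Finset.piecewise_eq_of_notMem _ _ _ hl]
    exact base_ne_rev hk _ _

theorem IsStandard.piecewise_mem_of_even {T : Finset (Fin k)} (hT : T ⊆ flips hk g) {m : ℕ}
    (hm : T.card = 2 * m) :
    tup (T.piecewise g (base hk)) ∈ pbwFiltration n (tup (base hk)) (2 * m) := by
  classical
  induction m generalizing T with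
  | zero =>
    rw [Finset.card_eq_zero.1 hm, Finset.piecewise_empty]
    exact self_mem_pbwFiltration _ _
  | succ m ih =>
    obtain ⟨i, hi⟩ : T.Nonempty := Finset.card_pos.1 (by omega)
    obtain ⟨j, hj⟩ : (T.erase i).Nonempty :=
      Finset.card_pos.1 (by rw [Finset.card_erase_of_mem hi]; omega)
    set T' := (T.erase i).erase j with hT'
    have hTT' : T = insert i (insert j T') := by
      rw [hT', Finset.insert_erase hj, Finset.insert_erase hi]
    have hsub : T' ⊆ T := (Finset.erase_subset _ _).trans (Finset.erase_subset _ _)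
    have hjT' : j ∉ T' := by simp [hT']
    have hiT' : i ∉ T' := by simp [hT']
    have hij : i ≠ j := (Finset.ne_of_mem_erase hj).symm
    have hcard : T'.card = 2 * m := by
      rw [hT', Finset.card_erase_of_mem hj, Finset.card_erase_of_mem hi]; omega
    have hgi : g i = (base hk i).rev := by
      simpa [flips] using hT hi
    have hgj : g j = (base hk j).rev := by
      simpa [flips] using hT (Finset.mem_of_mem_erase hj)
    have h := ih (hsub.trans hT) hcard
    rw [hTT', Finset.piecewise_insert, Finset.piecewise_insert, hgi, hgj]
    exact tup_flip_flip_mem_pbwFiltration (hg.piecewise_injective _) h hij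
      (Finset.piecewise_eq_of_notMem _ _ _ hiT') (Finset.piecewise_eq_of_notMem _ _ _ hjT')
      (hg.piecewise_ne_rev_base hiT') (hg.piecewise_ne_rev_base hjT')

/-- No single root vector flips $e_i$, so the unpaired flip goes $e_i\to e_{n+1}\to e_{\bar i}$ and
costs one step more than its share. -/
theorem IsStandard.piecewise_mem_of_odd {T : Finset (Fin k)} (hT : T ⊆ flips hk g) {m : ℕ}
    (hm : T.card = 2 * m + 1) :
    tup (T.piecewise g (base hk)) ∈ pbwFiltration n (tup (base hk)) (2 * m + 2) := by
  classical
  obtain ⟨i, hi⟩ : T.Nonempty := Finset.card_pos.1 (by omega)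
  have h := hg.piecewise_mem_of_even ((Finset.erase_subset i T).trans hT) (m := m)
    (by rw [Finset.card_erase_of_mem hi]; omega)
  have hgi : g i = (base hk i).rev := by simpa [flips] using hT hi
  have hmid : ∀ l, (T.erase i).piecewise g (base hk) l ≠ mid n := by
    intro l
    by_cases hl : l ∈ T.erase i
    · rw [Finset.piecewise_eq_of_mem _ _ _ hl]
      exact fun h => hg.ne_rev l l (by rw [h, rev_mid])
    · rw [Finset.piecewise_eq_of_notMem _ _ _ hl]
      exact pos_ne_mid _
  have hinj := hg.piecewise_injective (T.erase i)
  have hfi : (T.erase i).piecewise g (base hk) i = base hk i :=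
    Finset.piecewise_eq_of_notMem _ _ _ (Finset.notMem_erase i T)
  have h1 := tup_update_mem_pbwFiltration hinj h i (q := mid n)
    (by rw [hfi]; exact base_lt_mid hk i) (by rwa [rev_mid])
  have h2 := tup_update_mem_pbwFiltration (update_injective hinj fun l _ => hmid l) h1 i
    (q := (base hk i).rev) (by rw [update_self]; exact mid_lt_rev_base hk i) (by
      intro l
      rw [Fin.rev_rev]
      rcases eq_or_ne l i with rfl | hl
      · rw [update_self]
        exact (pos_ne_mid _).symm
      · rw [update_of_ne hl, ← hfi]
        exact fun h => hl (hinj h))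
  rw [update_idem, ← hgi, ← Finset.piecewise_insert, Finset.insert_erase hi] at h2
  exact h2

/-- The unpaired flip in place `i` is traded against the move in place `c`: $e_i$ goes to the target
of the move and $e_c$ goes to $e_{\bar i}$. Two root vectors give the desired monomial up to a
transposition, with no detour through the middle. -/
theorem IsStandard.piecewise_insert_mem_of_odd {T : Finset (Fin k)} (hT : T ⊆ flips hk g) {m : ℕ}
    (hm : T.card = 2 * m + 1) {c : Fin k} (hc : c ∈ moves hk g) :
    tup ((insert c T).piecewise g (base hk)) ∈ pbwFiltration n (tup (base hk)) (2 * m + 2) := by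
  classical
  obtain ⟨i, hi⟩ : T.Nonempty := Finset.card_pos.1 (by omega)
  have h := hg.piecewise_mem_of_even ((Finset.erase_subset i T).trans hT) (m := m)
    (by rw [Finset.card_erase_of_mem hi]; omega)
  have hgi : g i = (base hk i).rev := by simpa [flips] using hT hi
  have hc' := hc
  simp only [moves, Finset.mem_filter, Finset.mem_univ, true_and] at hc'
  have hci : c ≠ i := fun h => (hc' i).2 (by rw [h, hgi])
  have hcT : c ∉ T := fun h => (hc' c).2 (by simpa [flips] using hT h)
  have hinj := hg.piecewise_injective (T.erase i)
  have hfi : (T.erase i).piecewise g (base hk) i = base hk i :=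
    Finset.piecewise_eq_of_notMem _ _ _ (Finset.notMem_erase i T)
  have hfc : (T.erase i).piecewise g (base hk) c = base hk c :=
    Finset.piecewise_eq_of_notMem _ _ _ fun h => hcT (Finset.mem_of_mem_erase h)
  have h1 := tup_update_mem_pbwFiltration hinj h i (q := g c)
    (by rw [hfi]; exact base_lt_of_mem_moves hc i) (hg.piecewise_ne_rev_of_mem_moves hc _)
  have hinj₁ : Injective (update ((T.erase i).piecewise g (base hk)) i (g c)) := by
    refine update_injective hinj fun l _ h => ?_
    by_cases hl : l ∈ T.erase i
    · rw [Finset.piecewise_eq_of_mem _ _ _ hl] at h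
      exact hcT (hg.inj h ▸ Finset.mem_of_mem_erase hl)
    · rw [Finset.piecewise_eq_of_notMem _ _ _ hl] at h
      exact (hc' l).1 h.symm
  have h2 := tup_update_mem_pbwFiltration hinj₁ h1 c
    (q := (base hk i).rev) (by rw [update_of_ne hci, hfc]; exact base_lt_rev_base hk c i) (by
      intro l
      rw [Fin.rev_rev]
      rcases eq_or_ne l i with rfl | hl
      · rw [update_self]
        exact (hc' l).1
      · rw [update_of_ne hl, ← hfi]
        exact fun h => hl (hinj h))
  have h3 : update (update ((T.erase i).piecewise g (base hk)) i (g c)) c (base hk i).rev =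
      update (update ((insert c T).piecewise g (base hk)) i
        ((insert c T).piecewise g (base hk) c)) c ((insert c T).piecewise g (base hk) i) := by
    ext1 l
    rcases eq_or_ne l c with rfl | hlc
    · simp [hi, hgi]
    · rcases eq_or_ne l i with rfl | hli
      · simp [hlc]
      · by_cases hlT : l ∈ T <;> simp [hlc, hli, hlT]
  rw [h3, tup_swap _ hci] at h2
  simpa using Submodule.neg_mem _ h2

/-- The upper bound for the PBW degree of a standard monomial. -/
theorem IsStandard.mem_pbwFiltration (h : Even (flips hk g).card ∨ (moves hk g).Nonempty) :
    tup g ∈ pbwFiltration n (tup (base hk)) ((flips hk g).card + (moves hk g).card) := by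
  classical
  have hdisj : Disjoint (moves hk g) (flips hk g) := by
    rw [Finset.disjoint_left]
    intro i h1 h2
    simp only [moves, flips, Finset.mem_filter, Finset.mem_univ, true_and] at h1 h2
    exact (h1 i).2 h2
  rcases Nat.even_or_odd' (flips hk g).card with ⟨m, hm | hm⟩
  · have h1 := hg.piecewise_mem_of_even subset_rfl hm
    have h2 := hg.piecewise_union_mem subset_rfl hdisj h1
    rwa [hg.piecewise_eq, ← hm] at h2
  · obtain ⟨c, hc⟩ := h.resolve_left (by rw [hm]; simp)
    have h1 := hg.piecewise_insert_mem_of_odd subset_rfl hm hc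
    have h2 := hg.piecewise_union_mem (D := (moves hk g).erase c) (Finset.erase_subset _ _) (by
      rw [Finset.disjoint_insert_right]
      exact ⟨Finset.notMem_erase _ _,
        Finset.disjoint_of_subset_left (Finset.erase_subset _ _) hdisj⟩) h1
    have h3 : (moves hk g).erase c ∪ insert c (flips hk g) = moves hk g ∪ flips hk g := by
      rw [Finset.union_insert, ← Finset.insert_union, Finset.insert_erase hc]
    rw [h3, hg.piecewise_eq, Finset.card_erase_of_mem hc] at h2
    have h4 := Finset.card_pos.2 ⟨c, hc⟩
    convert h2 using 2
    omega

theorem IsStandard.mem_pbwFiltration_of_odd (h : Odd (flips hk g).card)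
    (h' : moves hk g = ∅) :
    tup g ∈ pbwFiltration n (tup (base hk)) ((flips hk g).card + 1) := by
  obtain ⟨m, hm⟩ := h
  have h1 := hg.piecewise_mem_of_odd subset_rfl hm
  have h2 := hg.piecewise_eq
  rw [h', Finset.empty_union] at h2
  rwa [h2, show 2 * m + 2 = (flips hk g).card + 1 by omega] at h1

end Upper

end

/-! ### Weyl group orbits, and lower bounds for the number of roots -/

noncomputable section

open Function

variable {n k : ℕ}

/-! ### The monomials attached to the elements of the Weyl group -/

/-- The index of the standard basis vector of weight `w(ε_i)`. -/
def SignedPerm.index (w : SignedPerm n) (i : Fin n) : Fin (2 * n + 1) :=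
  if w.sign i = 1 then pos (w.perm i) else (pos (w.perm i)).rev

theorem SignedPerm.wt_index (w : SignedPerm n) (i : Fin n) :
    wt (w.index i) = ((w.sign i : ℤ) : ℝ) • eps (w.perm i) := by
  rw [SignedPerm.index]
  rcases Int.units_eq_one_or (w.sign i) with h | h
  · simp [h, wt_pos]
  · rw [if_neg (by rw [h]; decide), wt_rev, wt_pos, h]; simp

theorem SignedPerm.index_injective (w : SignedPerm n) : Injective w.index := by
  intro i j h
  have key : w.perm i = w.perm j := by
    simp only [SignedPerm.index] at h
    split_ifs at h
    · exact pos_injective h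
    · exact absurd h (pos_ne_rev _ _)
    · exact absurd h.symm (pos_ne_rev _ _)
    · exact pos_injective (Fin.rev_injective h)
  exact w.perm.injective key

theorem SignedPerm.index_ne_rev (w : SignedPerm n) (i j : Fin n) :
    w.index i ≠ (w.index j).rev := by
  intro h
  have key : w.perm i = w.perm j := by
    simp only [SignedPerm.index] at h
    split_ifs at h
    · exact absurd h (pos_ne_rev _ _)
    · exact pos_injective (by rwa [Fin.rev_rev] at h)
    · exact pos_injective (Fin.rev_injective h)
    · rw [Fin.rev_rev] at h
      exact absurd h.symm (pos_ne_rev _ _)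
  obtain rfl := w.perm.injective key
  simp only [SignedPerm.index] at h
  split_ifs at h
  · exact pos_ne_rev _ _ h
  · rw [Fin.rev_rev] at h
    exact pos_ne_rev _ _ h.symm

theorem SignedPerm.sum_wt_index (w : SignedPerm n) (hk : k < n) :
    ∑ i : Fin k, wt (w.index (Fin.castLE hk.le i)) = w.act (fundWeight n k) := by
  ext a
  obtain ⟨i, rfl⟩ := w.perm.surjective a
  rw [w.act_apply, Finset.sum_apply]
  simp only [w.wt_index, Pi.smul_apply, smul_eq_mul, eps, Pi.single_apply, w.perm.injective.eq_iff,
    mul_ite, mul_one, mul_zero, fundWeight, if_pos hk, ite_mul, one_mul, zero_mul]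
  by_cases hi : (i : ℕ) < k
  · rw [if_pos hi, Finset.sum_eq_single ⟨i, hi⟩]
    · simp
    · intro b _ hb
      rw [if_neg]
      intro h
      apply hb
      ext
      simp [h]
    · simp
  · rw [if_neg hi]
    refine Finset.sum_eq_zero fun l _ => if_neg fun h => hi ?_
    rw [h]
    simp

/-- Only the order of the factors has to be arranged. Sending $i$ to the place of the factor $e_{\pm
i}$, where there is one, is a partial bijection of the places, and it extends to a permutation. -/
theorem SignedPerm.exists_isStandard (w : SignedPerm n) (hk : k < n) :
    ∃ g, IsStandard hk.le g ∧ ∑ i, wt (g i) = w.act (fundWeight n k) := by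
  classical
  let g₀ : Fin k → Fin (2 * n + 1) := fun i => w.index (Fin.castLE hk.le i)
  have hinj : Injective g₀ := w.index_injective.comp (Fin.castLE_injective _)
  have hrev : ∀ i j, g₀ i ≠ (g₀ j).rev := fun i j => w.index_ne_rev _ _
  let R : Fin k → Fin k → Prop := fun l i => g₀ l = base hk.le i ∨ g₀ l = (base hk.le i).rev
  have hR₁ : ∀ {l i i'}, R l i → R l i' → i = i' := by
    rintro l i i' (h | h) (h' | h')
    · exact base_injective hk.le (h.symm.trans h')
    · exact absurd (h.symm.trans h') (base_ne_rev _ _ _)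
    · exact absurd (h'.symm.trans h) (base_ne_rev _ _ _)
    · exact base_injective hk.le (Fin.rev_injective (h.symm.trans h'))
  have hR₂ : ∀ {l l' i}, R l i → R l' i → l = l' := by
    rintro l l' i (h | h) (h' | h')
    · exact hinj (h.trans h'.symm)
    · exact absurd (by rw [h, h', Fin.rev_rev]) (hrev l l')
    · exact absurd (by rw [h, h']) (hrev l l')
    · exact hinj (h.trans h'.symm)
  choose τ hτ using fun i : {i // ∃ l, R l i} => i.2
  let e : {i // ∃ l, R l i} ≃ {l // ∃ i, R l i} :=
    Equiv.ofBijective (fun i => ⟨τ i, i.1, hτ i⟩) (by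
      constructor
      · intro i i' h
        have h' : τ i = τ i' := congrArg Subtype.val h
        exact Subtype.ext (hR₁ (hτ i) (h' ▸ hτ i'))
      · rintro ⟨l, i, hl⟩
        exact ⟨⟨i, l, hl⟩, Subtype.ext (hR₂ (hτ ⟨i, l, hl⟩) hl)⟩)
  let σ := e.extendSubtype
  refine ⟨g₀ ∘ σ, ⟨hinj.comp σ.injective, fun i j => hrev _ _, fun i => ?_⟩, ?_⟩
  · by_cases hi : ∃ l, R l i
    · have h1 : σ i = τ ⟨i, hi⟩ := e.extendSubtype_apply_of_mem i hi
      have h2 := hτ ⟨i, hi⟩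
      rw [← h1] at h2
      rcases h2 with h2 | h2
      · exact Or.inl h2
      · exact Or.inr (Or.inl h2)
    · have h1 : ¬ ∃ j, R (σ i) j := e.extendSubtype_not_mem i hi
      push Not at h1
      exact Or.inr (Or.inr fun j => not_or.1 (h1 j))
  · rw [← w.sum_wt_index hk]
    exact Equiv.sum_comp σ fun i => wt (g₀ i)

/-! ### The lower bound -/

section Lower

variable {hk : k ≤ n} {g : Fin k → Fin (2 * n + 1)} (hg : IsStandard hk g)

include hg

theorem IsStandard.sum_wt_apply (i : Fin k) :
    (∑ l, wt (g l)) (Fin.castLE hk i) = wt (g i) (Fin.castLE hk i) := by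
  rw [Finset.sum_apply]
  refine Finset.sum_eq_single i (fun l _ hl => ?_) (by simp)
  rw [wt, if_neg, if_neg, sub_zero]
  · exact fun h => hl (hg.eq_rev_base_iff h)
  · exact fun h => hl (hg.eq_base_iff h)

theorem IsStandard.sum_wt_apply_flips {i : Fin k} (hi : i ∈ flips hk g) :
    (∑ l, wt (g l)) (Fin.castLE hk i) = -1 := by
  have h : g i = (pos (Fin.castLE hk i)).rev := (Finset.mem_filter.1 hi).2
  rw [hg.sum_wt_apply, h, wt_rev, wt_pos]
  simp [eps]

theorem IsStandard.sum_wt_apply_moves {i : Fin k} (hi : i ∈ moves hk g) :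
    (∑ l, wt (g l)) (Fin.castLE hk i) = 0 := by
  simp only [moves, Finset.mem_filter, Finset.mem_univ, true_and] at hi
  rw [hg.sum_wt_apply, wt]
  exact (congrArg₂ _ (if_neg (hi i).1) (if_neg (hi i).2)).trans (sub_zero _)

end Lower

theorem fundWeight_castLE (hk : k < n) (i : Fin k) : fundWeight n k (Fin.castLE hk.le i) = 1 := by
  simp [fundWeight, hk]

theorem disjoint_moves_flips (hk : k ≤ n) (g : Fin k → Fin (2 * n + 1)) :
    Disjoint (moves hk g) (flips hk g) := by
  rw [Finset.disjoint_left]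
  intro i h1 h2
  simp only [moves, flips, Finset.mem_filter, Finset.mem_univ, true_and] at h1 h2
  exact (h1 i).2 h2

/-- The $\ell^1$-norms of $\omega$ and $w\omega$ agree, so $\|\omega-w\omega\|_1$ is the sum of
$|\omega_a-(w\omega)_a|+|\omega_a|-|(w\omega)_a|$. Every summand is nonnegative and equals 2 at each
flip or move, while a root contributes at most 2 to the norm. -/
theorem IsStandard.le_of_mem_decompositionLengths {hk : k < n} {g : Fin k → Fin (2 * n + 1)}
    (hg : IsStandard hk.le g) {w : SignedPerm n} (hw : ∑ i, wt (g i) = w.act (fundWeight n k))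
    {N : ℕ} (hN : N ∈ decompositionLengths (fundWeight n k - w.act (fundWeight n k))) :
    (flips hk.le g).card + (moves hk.le g).card ≤ N := by
  classical
  have h1 := sum_abs_le_of_mem_decompositionLengths hN
  set ω := fundWeight n k with hω
  have h2 : ∑ a, |(ω - w.act ω) a| = ∑ a, (|(ω - w.act ω) a| + |ω a| - |w.act ω a|) := by
    rw [Finset.sum_sub_distrib, Finset.sum_add_distrib, w.sum_abs_act]; ring
  have h3 : ∑ a ∈ (moves hk.le g ∪ flips hk.le g).map (Fin.castLEEmb hk.le),
      (|(ω - w.act ω) a| + |ω a| - |w.act ω a|) ≤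
      ∑ a, (|(ω - w.act ω) a| + |ω a| - |w.act ω a|) := by
    refine Finset.sum_le_sum_of_subset_of_nonneg (Finset.subset_univ _) fun a _ _ => ?_
    rw [Pi.sub_apply, abs_sub_comm]
    linarith [abs_sub_abs_le_abs_sub (w.act ω a) (ω a)]
  have h4 : ∑ a ∈ (moves hk.le g ∪ flips hk.le g).map (Fin.castLEEmb hk.le),
      (|(ω - w.act ω) a| + |ω a| - |w.act ω a|) =
      2 * ((moves hk.le g ∪ flips hk.le g).card : ℝ) := by
    rw [Finset.sum_map, Finset.sum_congr rfl (g := fun _ => (2 : ℝ)), Finset.sum_const,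
      nsmul_eq_mul, mul_comm]
    intro i hi
    rw [Fin.castLEEmb_apply, Pi.sub_apply, hω, fundWeight_castLE hk, ← hω, ← hw]
    rcases Finset.mem_union.1 hi with hi | hi
    · rw [hg.sum_wt_apply_moves hi]; norm_num
    · rw [hg.sum_wt_apply_flips hi]; norm_num
  rw [Finset.card_union_of_disjoint (disjoint_moves_flips hk.le g)] at h4
  have h5 : ((moves hk.le g).card + (flips hk.le g).card : ℕ) ≤ (N : ℝ) := by
    linarith
  rw [add_comm]
  exact_mod_cast h5

/-- A flip makes a coordinate of the difference equal to 2, and a positive root has coordinates at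
most 1. This settles the case of a single flip, where the norm bound gives only 1. -/
theorem IsStandard.two_le_of_mem_decompositionLengths {hk : k < n} {g : Fin k → Fin (2 * n + 1)}
    (hg : IsStandard hk.le g) {w : SignedPerm n} (hw : ∑ i, wt (g i) = w.act (fundWeight n k))
    (hne : (flips hk.le g).Nonempty)
    {N : ℕ} (hN : N ∈ decompositionLengths (fundWeight n k - w.act (fundWeight n k))) :
    2 ≤ N := by
  obtain ⟨i, hi⟩ := hne
  have h := apply_le_of_mem_decompositionLengths hN (Fin.castLE hk.le i)
  rw [Pi.sub_apply, fundWeight_castLE hk, ← hw, hg.sum_wt_apply_flips hi] at h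
  have : (2 : ℝ) ≤ N := by linarith
  exact_mod_cast this

/-! ### Sums of the roots `ε_a + ε_b` -/

/-- The sum of the coordinates. -/
def total (μ : Fin n → ℝ) : ℝ := ∑ a, μ a

theorem total_add (μ ν : Fin n → ℝ) : total (μ + ν) = total μ + total ν := by
  simp [total, Finset.sum_add_distrib]

theorem total_sub (μ ν : Fin n → ℝ) : total (μ - ν) = total μ - total ν := by
  simp [total, Finset.sum_sub_distrib]

theorem total_eps (i : Fin n) : total (eps i) = 1 := by
  rw [total, Finset.sum_eq_single i] <;> simp +contextual [eps]

theorem total_wt_le (p : Fin (2 * n + 1)) : total (wt p) ≤ 1 := by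
  rcases index_cases p with ⟨i, rfl⟩ | rfl | ⟨i, rfl⟩
  · rw [wt_pos, total_eps]
  · simp [wt_mid, total]
  · have : total (wt (pos i).rev) = -1 := by
      rw [wt_rev, wt_pos, ← zero_sub, total_sub, total_eps]; simp [total]
    linarith

theorem exists_eq_pos_of_one_le {p : Fin (2 * n + 1)} (h : 1 ≤ total (wt p)) :
    ∃ i, p = pos i := by
  rcases index_cases p with ⟨i, rfl⟩ | rfl | ⟨i, rfl⟩
  · exact ⟨i, rfl⟩
  · simp [wt_mid, total] at h
    linarith
  · have : total (wt (pos i).rev) = -1 := by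
      rw [wt_rev, wt_pos, ← zero_sub, total_sub, total_eps]; simp [total]
    linarith

theorem total_letter_le (r : Fin (2 * n + 1) × Fin (2 * n + 1)) :
    total (wt r.1 - wt r.2) ≤ 2 := by
  have h1 := total_wt_le r.1
  have h2 := total_wt_le r.2.rev
  rw [wt_rev, ← zero_sub, total_sub] at h2
  have h3 : total (0 : Fin n → ℝ) = 0 := by simp [total]
  rw [total_sub]
  linarith

theorem total_drop_le (l : List (Fin (2 * n + 1) × Fin (2 * n + 1))) :
    total (drop l) ≤ 2 * l.length := by
  induction l with
  | nil => simp [total]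
  | cons r l ih =>
    rw [drop_cons, total_add, List.length_cons]
    push_cast
    linarith [total_letter_le r]

/-- Each letter contributes at most 2 to the coordinate sum, so in the extreme case every letter
contributes exactly 2, and only weight differences $\varepsilon_a+\varepsilon_b$ do that. -/
theorem exists_of_le_total_drop {l : List (Fin (2 * n + 1) × Fin (2 * n + 1))}
    (h : 2 * (l.length : ℝ) ≤ total (drop l)) :
    ∀ r ∈ l, ∃ a b, r = (pos a, (pos b).rev) := by
  induction l with
  | nil => simp
  | cons r l ih =>
    rw [drop_cons, total_add, List.length_cons] at h
    push_cast at h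
    have h1 := total_letter_le r
    have h2 := total_drop_le l
    intro r' hr'
    rcases List.mem_cons.1 hr' with rfl | hr'
    · have h3 := total_wt_le r'.1
      have h4 := total_wt_le r'.2.rev
      have h0 : total (0 : Fin n → ℝ) = 0 := by simp [total]
      have h5 : total (wt r'.2.rev) = - total (wt r'.2) := by
        rw [wt_rev, ← zero_sub, total_sub, h0, zero_sub]
      rw [total_sub] at h
      obtain ⟨a, ha⟩ := exists_eq_pos_of_one_le (p := r'.1) (by linarith)
      obtain ⟨b, hb⟩ := exists_eq_pos_of_one_le (p := r'.2.rev) (by linarith)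
      exact ⟨a, b, Prod.ext ha (by rw [← hb, Fin.rev_rev])⟩
    · exact ih (by linarith) r' hr'

theorem drop_apply_nonneg {l : List (Fin (2 * n + 1) × Fin (2 * n + 1))}
    (h : ∀ r ∈ l, ∃ a b, r = (pos a, (pos b).rev)) (c : Fin n) : 0 ≤ drop l c := by
  induction l with
  | nil => simp
  | cons r l ih =>
    obtain ⟨a, b, rfl⟩ := h _ (List.mem_cons_self ..)
    rw [drop_cons, Pi.add_apply, Pi.sub_apply, wt_pos, wt_rev, wt_pos, Pi.neg_apply]
    have h1 : ∀ a : Fin n, 0 ≤ eps a c := fun a => by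
      simp only [eps, Pi.single_apply]; split_ifs <;> norm_num
    linarith [h1 a, h1 b, ih fun r hr => h r (List.mem_cons_of_mem _ hr)]

theorem drop_apply_pos {l : List (Fin (2 * n + 1) × Fin (2 * n + 1))}
    (h : ∀ r ∈ l, ∃ a b, r = (pos a, (pos b).rev)) {a b : Fin n} (hr : (pos a, (pos b).rev) ∈ l) :
    0 < drop l a ∧ 0 < drop l b := by
  have h1 : ∀ a c : Fin n, 0 ≤ eps a c := fun a c => by
    simp only [eps, Pi.single_apply]; split_ifs <;> norm_num
  have h2 : ∀ a : Fin n, eps a a = 1 := fun a => by simp [eps]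
  induction l with
  | nil => simp at hr
  | cons r l ih =>
    have h' := fun r hr => h r (List.mem_cons_of_mem _ hr)
    rcases List.mem_cons.1 hr with rfl | hrl
    · simp only [drop_cons, Pi.add_apply, Pi.sub_apply, wt_pos, wt_rev, Pi.neg_apply, h2]
      have := drop_apply_nonneg h'
      constructor <;> linarith [this a, this b, h1 a b, h1 b a]
    · obtain ⟨a', b', rfl⟩ := h _ (List.mem_cons_self ..)
      obtain ⟨h3, h4⟩ := ih h' hrl
      simp only [drop_cons, Pi.add_apply, Pi.sub_apply, wt_pos, wt_rev, Pi.neg_apply]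
      constructor <;> linarith [h1 a' a, h1 a' b, h1 b' a, h1 b' b]

/-- Arrange `I` in a cycle and add $\varepsilon_a+\varepsilon_b$ over neighbours. At least two
elements are needed for neighbours to be distinct. -/
theorem mem_decompositionLengths_of_two_le {I : Finset (Fin n)} (hI : 2 ≤ I.card) :
    I.card ∈ decompositionLengths (∑ i ∈ I, (2 : ℝ) • eps i) := by
  obtain ⟨m, hm⟩ : ∃ m, I.card = m + 2 := ⟨I.card - 2, by omega⟩
  rw [hm]
  -- Writing the size as `m + 2` makes `j + 1` cyclic and different from `j`.
  let a : Fin (m + 2) ≃ I := (finCongr hm.symm).trans I.equivFin.symm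
  refine ⟨fun j => eps (a j).1 + eps (a (j + 1)).1, fun j => ?_, ?_⟩
  · have hne : (a j).1 ≠ (a (j + 1)).1 := by
      intro h
      have := a.injective (Subtype.ext h)
      simp at this
    rcases lt_or_gt_of_ne hne with h | h
    · exact Or.inr ⟨_, _, h, Or.inr rfl⟩
    · exact Or.inr ⟨_, _, h, Or.inr (add_comm _ _)⟩
  · rw [Finset.sum_add_distrib]
    have h1 : ∑ j, eps (a (j + 1)).1 = ∑ j, eps (a j).1 :=
      Equiv.sum_comp (Equiv.addRight (1 : Fin (m + 2))) fun j => eps (a j).1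
    have h2 : ∑ j, eps (a j).1 = ∑ i ∈ I, eps i := by
      rw [Equiv.sum_comp a fun i => eps i.1]
      exact Finset.sum_coe_sort I eps
    rw [h1, h2, ← two_smul ℝ, Finset.smul_sum]

end

/-! ### The exceptional vectors and the conclusion for $k<n$ -/

noncomputable section

open Function

variable {n k : ℕ}

/-! ### Exchanging `e_i` and `e_{2n+2-i}` -/

section Swap

variable {π : Fin (2 * n + 1) → Fin (2 * n + 1)}

/-- The map of the exterior power induced by a map of the indices. -/
def permute (k : ℕ) (π : Fin (2 * n + 1) → Fin (2 * n + 1)) :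
    ⋀[ℂ]^k (Fin (2 * n + 1) → ℂ) →ₗ[ℂ] ⋀[ℂ]^k (Fin (2 * n + 1) → ℂ) :=
  exteriorPower.map k (LinearMap.funLeft ℂ ℂ π)

theorem permute_tup (hπ : Involutive π) (f : Fin k → Fin (2 * n + 1)) :
    permute k π (tup f) = tup (π ∘ f) := by
  rw [permute, tup, exteriorPower.map_apply_ιMulti, tup]
  congr 1
  ext i p
  simp only [comp_apply, LinearMap.funLeft_apply, Pi.single_apply]
  congr 1
  rw [← hπ.eq_iff]

theorem form_permute (hπ : Involutive π) (a b : ⋀[ℂ]^k (Fin (2 * n + 1) → ℂ)) :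
    form _ k (permute k π a) b = form _ k a (permute k π b) := by
  refine form_map (fun x y => ?_) a b
  simp only [dotProduct, LinearMap.funLeft_apply]
  rw [← Equiv.sum_comp (hπ.toPerm)]
  refine Finset.sum_congr rfl fun i _ => ?_
  simp [hπ i]

theorem permute_lie (hπ : Involutive π) (hr : ∀ p, π p.rev = (π p).rev)
    (p q : Fin (2 * n + 1)) (u : ⋀[ℂ]^k (Fin (2 * n + 1) → ℂ)) :
    permute k π ⁅elt p q, u⁆ = ⁅elt (π p) (π q), permute k π u⁆ := by
  have hcomp : ∀ (f : Fin k → Fin (2 * n + 1)) i q, π ∘ update f i q = update (π ∘ f) i (π q) :=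
    fun f i q => comp_update _ _ _ _
  have : (permute k π).comp (LieModule.toEnd ℂ (so n) _ (elt p q)) =
      (LieModule.toEnd ℂ (so n) _ (elt (π p) (π q))).comp (permute k π) := by
    refine LinearMap.ext_on span_tup ?_
    rintro _ ⟨f, rfl⟩
    simp only [LinearMap.comp_apply, LieModule.toEnd_apply_apply, permute_tup hπ, elt_lie_tup,
      map_sum, map_sub, ← hr]
    refine Finset.sum_congr rfl fun i _ => ?_
    congr 1
    · rw [apply_ite (permute k π), permute_tup hπ, map_zero, hcomp]
      simp only [comp_apply, hπ.injective.eq_iff]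
    · rw [apply_ite (permute k π), permute_tup hπ, map_zero, hcomp]
      simp only [comp_apply, hπ.injective.eq_iff]
  exact LinearMap.congr_fun this u

end Swap

/-- These matrices send the $e_i$ with $i\le n$ into the span of the $e_{\bar i}$ and kill all other
basis vectors, so already their products vanish. -/
theorem lie_elt_elt_eq_zero (a b c d : Fin n) :
    ⁅elt (pos a) (pos b).rev, elt (pos c) (pos d).rev⁆ = 0 := by
  have key : ∀ a b c d : Fin n,
      (elt (pos a) (pos b).rev).1 * (elt (pos c) (pos d).rev).1 = 0 := by
    intro a b c d
    rw [elt_mul_elt, if_neg (pos_ne_rev _ _), if_neg (pos_ne_rev _ _),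
      if_neg (by rw [Fin.rev_rev]; exact pos_ne_rev _ _), if_neg (pos_ne_rev _ _).symm]
    simp
  apply Subtype.ext
  rw [coe_lie, key, key, sub_zero]
  rfl

theorem lie_word_comm {V : Type*} [AddCommGroup V] [Module ℂ V] [LieRingModule (so n) V]
    {l : List (Fin (2 * n + 1) × Fin (2 * n + 1))} (h : ∀ r ∈ l, ∃ a b, r = (pos a, (pos b).rev))
    (a b : Fin n) (u : V) :
    word ⁅(elt (pos a) (pos b).rev : so n), u⁆ l = ⁅(elt (pos a) (pos b).rev : so n), word u l⁆ := by
  induction l with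
  | nil => rfl
  | cons r l ih =>
    obtain ⟨c, d, rfl⟩ := h _ (List.mem_cons_self ..)
    rw [word_cons, word_cons, ih fun r hr => h r (List.mem_cons_of_mem _ hr),
      leibniz_lie, lie_elt_elt_eq_zero, zero_lie, zero_add]

section Exceptional

variable {hk : k ≤ n} {g : Fin k → Fin (2 * n + 1)} (hg : IsStandard hk g)
  (hm : moves hk g = ∅)

include hg hm

theorem IsStandard.eq_of_moves_eq_empty (i : Fin k) :
    g i = if i ∈ flips hk g then (base hk i).rev else base hk i := by
  rcases hg.mem_or_mem i with h | h
  · rw [if_neg, h]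
    intro hi
    exact base_ne_rev hk i i (h.symm.trans (Finset.mem_filter.1 hi).2)
  · rw [hm, Finset.empty_union] at h
    rw [if_pos h]
    exact (Finset.mem_filter.1 h).2

theorem IsStandard.sum_wt_base_sub :
    ∑ i, wt (base hk i) - ∑ i, wt (g i) =
      ∑ a ∈ (flips hk g).map (Fin.castLEEmb hk), (2 : ℝ) • eps a := by
  rw [← Finset.sum_sub_distrib, Finset.sum_map, ← Finset.sum_subset (Finset.subset_univ _)]
  · refine Finset.sum_congr rfl fun i hi => ?_
    rw [hg.eq_of_moves_eq_empty hm i, if_pos hi, wt_rev, sub_neg_eq_add, ← two_smul ℝ, base, wt_pos]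
    rfl
  · intro i _ hi
    rw [hg.eq_of_moves_eq_empty hm i, if_neg hi, sub_self]

/-- All letters are forced to be commuting root vectors that are skew for the form twisted by the
exchange of $e_i$ and $e_{\bar i}$ at the flips. Moving an odd number of them across this symmetric
form shows that the pairing equals its own negative. -/
theorem IsStandard.form_word_eq_zero (hodd : Odd (flips hk g).card)
    {l : List (Fin (2 * n + 1) × Fin (2 * n + 1))} (hlen : l.length ≤ (flips hk g).card)
    (hl : ∑ i, wt (base hk i) - drop l = ∑ i, wt (g i)) :
    form _ k (tup g) (word (tup (base hk)) l) = 0 := by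
  classical
  have hdrop : drop l = ∑ a ∈ (flips hk g).map (Fin.castLEEmb hk), (2 : ℝ) • eps a := by
    rw [← hg.sum_wt_base_sub hm, ← hl, sub_sub_cancel]
  have htot : total (drop l) = 2 * (flips hk g).card := by
    rw [hdrop, total]
    simp only [Finset.sum_apply, Pi.smul_apply, smul_eq_mul]
    rw [Finset.sum_comm]
    have h1 : ∀ i : Fin n, ∑ a, 2 * eps i a = 2 := fun i => by
      rw [← Finset.mul_sum]
      have := total_eps i
      rw [total] at this
      rw [this, mul_one]
    simp only [h1]
    simp [mul_comm]
  have hform := exists_of_le_total_drop (l := l) (by rw [htot]; exact_mod_cast (by omega))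
  have hlen' : l.length = (flips hk g).card := by
    have := total_drop_le l
    rw [htot] at this
    have h2 : (flips hk g).card ≤ l.length := by
      have h3 : ((flips hk g).card : ℝ) ≤ l.length := by linarith
      exact_mod_cast h3
    omega
  -- the involution of the indices
  let P : Fin (2 * n + 1) → Prop := fun p => ∃ i ∈ flips hk g, p = base hk i ∨ p = (base hk i).rev
  have hP : ∀ p, P p.rev ↔ P p := by
    intro p
    constructor
    · rintro ⟨i, hi, h | h⟩
      · exact ⟨i, hi, Or.inr (by rw [← h, Fin.rev_rev])⟩
      · exact ⟨i, hi, Or.inl (Fin.rev_injective h)⟩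
    · rintro ⟨i, hi, h | h⟩
      · exact ⟨i, hi, Or.inr (by rw [h])⟩
      · exact ⟨i, hi, Or.inl (by rw [h, Fin.rev_rev])⟩
  let π : Fin (2 * n + 1) → Fin (2 * n + 1) := fun p => if P p then p.rev else p
  have hπ : Involutive π := by
    intro p
    by_cases h : P p
    · simp [π, h, hP]
    · simp [π, h]
  have hπr : ∀ p, π p.rev = (π p).rev := by
    intro p
    by_cases h : P p
    · simp [π, h, hP]
    · simp [π, h, hP]
  have hπg : π ∘ base hk = g := by
    ext1 i
    rw [hg.eq_of_moves_eq_empty hm i, comp_apply]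
    by_cases hi : i ∈ flips hk g
    · rw [if_pos hi]
      exact if_pos ⟨i, hi, Or.inl rfl⟩
    · rw [if_neg hi]
      refine if_neg ?_
      rintro ⟨j, hj, h | h⟩
      · exact hi (base_injective hk h ▸ hj)
      · exact base_ne_rev hk _ _ h
  -- The coordinates of the letters are nonnegative and cannot cancel, so indices outside the flips
  -- cannot occur.
  have hletter : ∀ r ∈ l, ∃ a b, r = (pos a, (pos b).rev) ∧ P (pos a) ∧ P (pos b) := by
    have key : ∀ a, 0 < drop l a → P (pos a) := by
      intro a ha
      rw [hdrop, Finset.sum_apply] at ha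
      obtain ⟨b, hb, hba⟩ := Finset.exists_ne_zero_of_sum_ne_zero ha.ne'
      obtain ⟨i, hi, rfl⟩ := Finset.mem_map.1 hb
      refine ⟨i, hi, Or.inl ?_⟩
      simp only [eps, Pi.smul_apply, Pi.single_apply, smul_eq_mul, mul_ite, mul_one, mul_zero,
        ne_eq, ite_eq_right_iff, Classical.not_imp] at hba
      rw [hba.1]
      rfl
    intro r hr
    obtain ⟨a, b, rfl⟩ := hform r hr
    obtain ⟨h1, h2⟩ := drop_apply_pos hform hr
    exact ⟨a, b, rfl, key a h1, key b h2⟩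
  -- the form twisted by the involution
  have hadj : ∀ a b, P (pos a) → P (pos b) → ∀ x y : ⋀[ℂ]^k (Fin (2 * n + 1) → ℂ),
      form _ k (permute k π x) ⁅elt (pos a) (pos b).rev, y⁆ =
      - form _ k (permute k π ⁅elt (pos a) (pos b).rev, x⁆) y := by
    intro a b ha hb x y
    rw [form_comm, form_lie, transp_elt, form_comm, permute_lie hπ hπr]
    have h1 : π (pos a) = (pos a).rev := if_pos ha
    have h2 : π (pos b).rev = pos b := by
      rw [hπr, show π (pos b) = (pos b).rev from if_pos hb, Fin.rev_rev]
    rw [h1, h2]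
    have h4 := elt_rev_rev (pos b).rev (pos a)
    rw [Fin.rev_rev] at h4
    have h5 : (elt (pos b).rev (pos a) : so n) = - elt (pos a).rev (pos b) := by
      rw [h4, neg_neg]
    rw [h5, neg_lie, map_neg, LinearMap.neg_apply]
  -- Crossing the form reverses the order of the letters; commutativity restores the original word.
  have hword : ∀ (l : List (Fin (2 * n + 1) × Fin (2 * n + 1))),
      (∀ r ∈ l, ∃ a b, r = (pos a, (pos b).rev) ∧ P (pos a) ∧ P (pos b)) →
      ∀ x y : ⋀[ℂ]^k (Fin (2 * n + 1) → ℂ), form _ k (permute k π x) (word y l) =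
        (-1) ^ l.length * form _ k (permute k π (word x l)) y := by
    intro l
    induction l with
    | nil => intro _ x y; simp
    | cons r l ih =>
      intro hr x y
      obtain ⟨a, b, rfl, ha, hb⟩ := hr _ (List.mem_cons_self ..)
      have hr' := fun r hr' => hr r (List.mem_cons_of_mem _ hr')
      rw [word_cons, hadj a b ha hb, ih hr', word_cons, lie_word_comm (fun r h => by
        obtain ⟨a, b, h, -⟩ := hr' r h
        exact ⟨a, b, h⟩), List.length_cons, pow_succ]
      ring
  have h1 := hword l hletter (tup (base hk)) (tup (base hk))
  rw [hlen', hodd.neg_one_pow, form_permute hπ (word _ _), form_comm (word _ _), permute_tup hπ,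
    hπg] at h1
  have h2 : (2 : ℂ) * form _ k (tup g) (word (tup (base hk)) l) = 0 := by
    linear_combination h1
  simpa using h2

/-- Pairing with `tup g` kills every word that could contribute to its weight in this step of the
filtration, yet `tup g` pairs to 1 with itself. -/
theorem IsStandard.notMem_pbwFiltration (hodd : Odd (flips hk g).card) {t : ℕ}
    (ht : t ≤ (flips hk g).card) : tup g ∉ pbwFiltration n (tup (base hk)) t := by
  intro hmem
  have h := mem_span_word_of_mem_pbwFiltration (tup_mem_wtSpace (base hk)) hmem (tup_mem_wtSpace g)
  have hle : Submodule.span ℂ {v | ∃ l : List (Fin (2 * n + 1) × Fin (2 * n + 1)),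
      IsLowerWord l ∧ l.length ≤ t ∧ ∑ i, wt (base hk i) - drop l = ∑ i, wt (g i) ∧
        v = word (tup (base hk)) l} ≤ LinearMap.ker (form (Fin (2 * n + 1)) k (tup g)) := by
    rw [Submodule.span_le]
    rintro _ ⟨l, -, h2, h3, rfl⟩
    exact hg.form_word_eq_zero hm hodd (h2.trans ht) h3
  have := LinearMap.mem_ker.1 (hle h)
  rw [form_tup_self hg.inj] at this
  exact one_ne_zero this

end Exceptional

/-! ### The case of the exterior powers -/

theorem mem_span_tup_of_mem_wtSpace {g : Fin k → Fin (2 * n + 1)} (hg : Injective g)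
    (hg' : ∀ i j, g i ≠ (g j).rev) {u : ⋀[ℂ]^k (Fin (2 * n + 1) → ℂ)}
    (hu : u ∈ wtSpace _ (∑ i, wt (g i))) : u ∈ Submodule.span ℂ {tup g} := by
  have hu' : u ∈ Submodule.span ℂ (Set.range (tup (n := n) (k := k))) := by
    rw [span_tup]; trivial
  have h := mem_span_inter_wtSpace (by
    rintro _ ⟨f, rfl⟩
    exact ⟨_, tup_mem_wtSpace f⟩) hu' hu
  refine Submodule.span_le.2 ?_ h
  rintro _ ⟨⟨f, rfl⟩, hf⟩
  by_cases h0 : tup f = 0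
  · rw [h0]; exact Submodule.zero_mem _
  · exact tup_mem_span_of_wt_eq hg hg' (eq_of_mem_wtSpace h0 (tup_mem_wtSpace f) hf)

section Transfer

variable {V S : Type*} [AddCommGroup V] [Module ℂ V] [LieRingModule (so n) V]
  [AddCommGroup S] [Module ℂ S] [LieRingModule (so n) S]

theorem mem_pbwFiltration_equiv {φ : S ≃ₗ[ℂ] V} (hφ : ∀ (x : so n) s, φ ⁅x, s⁆ = ⁅x, φ s⁆)
    {u v : S} {s : ℕ} : φ v ∈ pbwFiltration n (φ u) s ↔ v ∈ pbwFiltration n u s := by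
  have hfold : ∀ l : List (so n), l.foldr (fun x y => ⁅x, y⁆) (φ u) =
      φ (l.foldr (fun x y => ⁅x, y⁆) u) := by
    intro l
    induction l with
    | nil => rfl
    | cons x l ih => rw [List.foldr_cons, List.foldr_cons, ih, hφ]
  have : pbwFiltration n (φ u) s = (pbwFiltration n u s).map (φ : S →ₗ[ℂ] V) := by
    rw [pbwFiltration, pbwFiltration, Submodule.map_span]
    congr 1
    ext w
    constructor
    · rintro ⟨l, h1, h2, rfl⟩
      exact ⟨_, ⟨l, h1, h2, rfl⟩, (hfold l).symm⟩
    · rintro ⟨_, ⟨l, h1, h2, rfl⟩, rfl⟩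
      exact ⟨l, h1, h2, (hfold l).symm⟩
  rw [this, Submodule.mem_map_equiv, LinearEquiv.symm_apply_apply]

theorem mem_wtSpace_equiv {φ : S ≃ₗ[ℂ] V} (hφ : ∀ (x : so n) s, φ ⁅x, s⁆ = ⁅x, φ s⁆)
    [LieModule ℂ (so n) V] [LieModule ℂ (so n) S]
    {μ : Fin n → ℝ} {v : S} : φ v ∈ wtSpace V μ ↔ v ∈ wtSpace S μ := by
  simp only [mem_wtSpace, ← hφ, ← map_smul, φ.injective.eq_iff]

end Transfer

section Main

variable {V : Type*} [AddCommGroup V] [Module ℂ V] [LieRingModule (so n) V]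
  [LieModule ℂ (so n) V]

theorem pbwFiltration_smul (u : V) {c : ℂ} (hc : c ≠ 0) (s : ℕ) :
    pbwFiltration n (c • u) s = pbwFiltration n u s := by
  refine le_antisymm (pbwFiltration_smul_le u c s) ?_
  have := pbwFiltration_smul_le (n := n) (c • u) c⁻¹ s
  rwa [smul_smul, inv_mul_cancel₀ hc, one_smul] at this

/-- A highest weight vector and a vector of extremal weight in a module isomorphic to an exterior
power of the vector representation. -/
theorem exists_standard_of_equiv (hk : k < n) {v₀ v : V}
    (hv₀ : IsHighestWeightVector (fundWeight n k) v₀) {φ : (⋀[ℂ]^k (Fin (2 * n + 1) → ℂ)) ≃ₗ[ℂ] V}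
    (hφ : ∀ (x : so n) u, φ ⁅x, u⁆ = ⁅x, φ u⁆) {g : Fin k → Fin (2 * n + 1)}
    (hg : IsStandard hk.le g) (hv : IsWeightVector (∑ i, wt (g i)) v) :
    (∃ c : ℂ, c ≠ 0 ∧ v = c • φ (tup g)) ∧
      ∀ s, v ∈ pbwFiltration n v₀ s ↔ tup g ∈ pbwFiltration n (tup (base hk.le)) s := by
  obtain ⟨u₀, rfl⟩ := φ.surjective v₀
  obtain ⟨u, rfl⟩ := φ.surjective v
  have h0 : u₀ ∈ wtSpace _ (∑ i, wt (base hk.le i)) := by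
    rw [sum_wt_base hk]
    exact (mem_wtSpace_equiv hφ).1 hv₀.1.2
  have h1 : u ∈ wtSpace _ (∑ i, wt (g i)) := (mem_wtSpace_equiv hφ).1 hv.2
  obtain ⟨c₀, rfl⟩ := Submodule.mem_span_singleton.1
    (mem_span_tup_of_mem_wtSpace (base_injective hk.le) (base_ne_rev hk.le) h0)
  obtain ⟨c, rfl⟩ := Submodule.mem_span_singleton.1 (mem_span_tup_of_mem_wtSpace hg.inj hg.ne_rev h1)
  have hc₀ : c₀ ≠ 0 := by
    rintro rfl
    exact hv₀.1.1 (by simp)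
  have hc : c ≠ 0 := by
    rintro rfl
    exact hv.1 (by simp)
  refine ⟨⟨c, hc, map_smul φ c _⟩, fun s => ?_⟩
  rw [mem_pbwFiltration_equiv hφ, pbwFiltration_smul _ hc₀, Submodule.smul_mem_iff _ hc]

theorem flippedWedge_eq_tup (hk : k ≤ n) (I : Finset (Fin k)) :
    flippedWedge hk I = tup fun i => if i ∈ I then (base hk i).rev else base hk i := by
  rw [flippedWedge, tup]
  congr 1
  ext1 i
  split_ifs <;> rfl

theorem isStandard_flip (hk : k ≤ n) (I : Finset (Fin k)) :
    IsStandard hk fun i => if i ∈ I then (base hk i).rev else base hk i where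
  inj := by
    intro i j h
    dsimp only at h
    split_ifs at h
    · exact base_injective hk (Fin.rev_injective h)
    · exact absurd h.symm (base_ne_rev hk _ _)
    · exact absurd h (base_ne_rev hk _ _)
    · exact base_injective hk h
  ne_rev := by
    intro i j h
    split_ifs at h with h1 h2 h2
    · rw [Fin.rev_rev] at h
      exact base_ne_rev hk _ _ h.symm
    · have := base_injective hk (Fin.rev_injective h)
      exact h2 (this ▸ h1)
    · rw [Fin.rev_rev] at h
      exact h1 (base_injective hk h ▸ h2)
    · exact base_ne_rev hk _ _ h
  cases := by
    intro i
    split_ifs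
    · exact Or.inr (Or.inl rfl)
    · exact Or.inl rfl

theorem flips_flip (hk : k ≤ n) (I : Finset (Fin k)) :
    flips hk (fun i => if i ∈ I then (base hk i).rev else base hk i) = I := by
  ext i
  simp only [flips, Finset.mem_filter, Finset.mem_univ, true_and]
  split_ifs with h
  · simp [h]
  · simp [h, base_ne_rev]

theorem moves_flip (hk : k ≤ n) (I : Finset (Fin k)) :
    moves hk (fun i => if i ∈ I then (base hk i).rev else base hk i) = ∅ := by
  ext i
  simp only [moves, Finset.mem_filter, Finset.mem_univ, true_and, Finset.notMem_empty, iff_false]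
  intro h
  have := h i
  split_ifs at this
  · exact this.2 rfl
  · exact this.1 rfl

/-- Membership in step `N` produces a decomposition of length at most `N`, so the lower bound is
attained; an earlier step would produce one that is too short. -/
theorem hasPBWDegree_of_le {v₀ v : V} {lam μ : Fin n → ℝ} (hv₀ : v₀ ∈ wtSpace V lam)
    (hv : IsWeightVector μ v) {N : ℕ} (hmem : v ∈ pbwFiltration n v₀ N)
    (hN : ∀ M ∈ decompositionLengths (lam - μ), N ≤ M) :
    IsLeast (decompositionLengths (lam - μ)) N ∧ HasPBWDegree n v₀ v N := by
  have key : ∀ t, v ∈ pbwFiltration n v₀ t → ∃ M ≤ t, M ∈ decompositionLengths (lam - μ) :=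
    fun t ht => exists_mem_decompositionLengths hv₀ ht hv.2 hv.1
  refine ⟨⟨?_, hN⟩, hv.1, hmem, fun t ht hmem' => ?_⟩
  · obtain ⟨M, hM, hM'⟩ := key N hmem
    rwa [le_antisymm (hN M hM') hM]
  · obtain ⟨M, hM, hM'⟩ := key t hmem'
    exact absurd (hN M hM') (by omega)

theorem pbwDegree_of_lt (hk : k < n) [LieModule.IsIrreducible ℂ (so n) V] {v₀ v : V}
    (hv₀ : IsHighestWeightVector (fundWeight n k) v₀) (w : SignedPerm n)
    (hv : IsWeightVector (w.act (fundWeight n k)) v) :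
    ∃ N : ℕ, IsLeast (decompositionLengths (fundWeight n k - w.act (fundWeight n k))) N ∧
      (¬ IsExceptional hk.le v → HasPBWDegree n v₀ v N) ∧
      (IsExceptional hk.le v → HasPBWDegree n v₀ v (N + 1)) := by
  by_cases hex : IsExceptional hk.le v
  · obtain ⟨hk3, -, I, s, hI, φ, hφ, rfl⟩ := hex
    rw [isExteriorPowerIso_iff] at hφ
    set g : Fin k → Fin (2 * n + 1) := fun i => if i ∈ I then (base hk.le i).rev else base hk.le i
      with hgdef
    have hg : IsStandard hk.le g := isStandard_flip hk.le I
    have hflips : flips hk.le g = I := flips_flip hk.le I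
    have hmoves : moves hk.le g = ∅ := moves_flip hk.le I
    rw [flippedWedge_eq_tup, ← hgdef] at hv ⊢
    have hgw : ∑ i, wt (g i) = w.act (fundWeight n k) :=
      eq_of_mem_wtSpace hv.1 ((mem_wtSpace_equiv hφ).2 (tup_mem_wtSpace g)) hv.2
    have hodd : Odd (flips hk.le g).card := by rw [hflips, hI]; exact ⟨s + 1, by ring⟩
    obtain ⟨-, hmem⟩ := exists_standard_of_equiv hk hv₀ hφ hg (hgw ▸ hv)
    refine ⟨(flips hk.le g).card, ⟨?_, fun M hM => ?_⟩, fun h => absurd ?_ h, fun _ =>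
      ⟨hv.1, ?_, fun t ht => ?_⟩⟩
    · rw [← hgw, ← sum_wt_base hk, hg.sum_wt_base_sub hmoves]
      have := mem_decompositionLengths_of_two_le (I := (flips hk.le g).map (Fin.castLEEmb hk.le))
        (by rw [Finset.card_map, hflips, hI]; omega)
      rwa [Finset.card_map] at this
    · exact (Nat.le_add_right _ _).trans (hg.le_of_mem_decompositionLengths (hk := hk) hgw hM)
    · exact ⟨hk3, hk, I, s, hI, φ, isExteriorPowerIso_iff.2 hφ, by rw [flippedWedge_eq_tup]⟩
    · rw [hmem]
      exact hg.mem_pbwFiltration_of_odd hodd hmoves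
    · rw [hmem]
      exact hg.notMem_pbwFiltration hmoves hodd (by omega)
  · have := isIrreducible_exteriorPower hk
    obtain ⟨φ, hφ, -⟩ := exists_equiv_of_isIrreducible hv₀ (isHighestWeightVector_tup_base hk)
    obtain ⟨g, hg, hgw⟩ := w.exists_isStandard hk
    obtain ⟨⟨c, hc, hcv⟩, hmem⟩ := exists_standard_of_equiv hk hv₀ hφ hg (hgw ▸ hv)
    suffices h : ∃ N, v ∈ pbwFiltration n v₀ N ∧
        ∀ M ∈ decompositionLengths (fundWeight n k - w.act (fundWeight n k)), N ≤ M by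
      obtain ⟨N, h1, h2⟩ := h
      obtain ⟨h3, h4⟩ := hasPBWDegree_of_le hv₀.1.2 hv h1 h2
      exact ⟨N, h3, fun _ => h4, fun h => absurd h hex⟩
    by_cases h : Even (flips hk.le g).card ∨ (moves hk.le g).Nonempty
    · exact ⟨_, (hmem _).2 (hg.mem_pbwFiltration h),
        fun M hM => hg.le_of_mem_decompositionLengths (hk := hk) hgw hM⟩
    · rw [not_or, Nat.not_even_iff_odd, Finset.not_nonempty_iff_eq_empty] at h
      refine ⟨_, (hmem _).2 (hg.mem_pbwFiltration_of_odd h.1 h.2), fun M hM => ?_⟩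
      -- An odd number of flips other than 1 is at least 3, and without moves that would make `v`
      -- exceptional.
      have hone : (flips hk.le g).card = 1 := by
        by_contra hne
        apply hex
        obtain ⟨m, hm⟩ := h.1
        have hle : (flips hk.le g).card ≤ k := by
          simpa using Finset.card_le_univ (flips hk.le g)
        -- Here $2m+1=2(m-1)+3$, and the scalar `c` is absorbed into the isomorphism.
        refine ⟨by omega, hk, flips hk.le g, m - 1, by omega,
          φ.trans (LinearEquiv.smulOfNeZero ℂ V c hc), ?_, ?_⟩
        · rw [isExteriorPowerIso_iff]
          intro x u
          simp [hφ]
        · rw [hcv, flippedWedge_eq_tup, ← funext (hg.eq_of_moves_eq_empty h.2)]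
          rfl
      rw [hone]
      exact hg.two_le_of_mem_decompositionLengths (hk := hk) hgw
        (Finset.card_pos.1 (by omega)) hM

end Main

end

/-! ### $\mathfrak{sl}_2$-theory for a root, and integrability for the simple roots -/

noncomputable section

variable {n : ℕ}

/-! ### Commutators of root vectors -/

theorem evalWt_elt_self (μ : Fin n → ℝ) (p : Fin (2 * n + 1)) :
    evalWt μ (elt p p) = ((μ ⬝ᵥ wt p : ℝ) : ℂ) := by
  simp only [evalWt, dotProduct, Complex.ofReal_sum, Complex.ofReal_mul]
  refine Finset.sum_congr rfl fun i _ => ?_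
  rw [elt_apply, wt]
  simp only [and_self, Fin.rev_eq_iff]
  split_ifs <;> simp

theorem lie_elt_swap {p q : Fin (2 * n + 1)} (h : q ≠ p.rev) :
    ⁅elt q p, elt p q⁆ = elt p p - elt q q := by
  have h' : p.rev ≠ q := h.symm
  have h1 : p ≠ q.rev := fun h2 => h (by rw [h2, Fin.rev_rev])
  apply Subtype.ext
  rw [coe_lie, elt_mul_elt, elt_mul_elt]
  simp only [if_true, h, h', h1, h1.symm, if_false, sub_zero]
  change _ = (elt p p).1 - (elt q q).1
  simp only [elt]
  abel

theorem lie_elt_eq_zero {p q r s : Fin (2 * n + 1)} (h1 : p ≠ s) (h2 : q ≠ r) (h3 : p ≠ r.rev)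
    (h4 : q ≠ s.rev) : ⁅elt p q, elt r s⁆ = 0 := by
  have h5 : q.rev ≠ s := fun h => h4 (by rw [← h, Fin.rev_rev])
  have h6 : r ≠ p.rev := fun h => h3 (by rw [h, Fin.rev_rev])
  apply Subtype.ext
  rw [coe_lie, elt_mul_elt, elt_mul_elt]
  simp [h1, h2, h3, h5, h6, h1.symm, h2.symm, h4.symm]

theorem lie_elt_apply (x : so n) (p q i j : Fin (2 * n + 1)) :
    (⁅x, elt p q⁆ : so n).1 i j = (if p = j then x.1 i q else 0) -
      (if q.rev = j then x.1 i p.rev else 0) - (if q = i then x.1 p j else 0) +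
      (if p.rev = i then x.1 q.rev j else 0) := by
  rw [coe_lie, Matrix.sub_apply]
  simp only [elt, mul_sub, sub_mul, Matrix.sub_apply, Matrix.mul_apply, Matrix.single_apply,
    ite_and, mul_ite, mul_one, mul_zero, ite_mul, one_mul, zero_mul]
  simp
  ring

/-! ### The rank one subalgebra of a root -/

section Ladder

variable {V : Type*} [AddCommGroup V] [Module ℂ V] [LieRingModule (so n) V]
  [LieModule ℂ (so n) V]

local notation "opr" => LieModule.toEnd ℂ (so n) V

theorem pow_toEnd_mem_wtSpace {μ : Fin n → ℝ} {u : V} (hu : u ∈ wtSpace V μ)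
    (p q : Fin (2 * n + 1)) (j : ℕ) :
    (opr (elt p q) ^ j) u ∈ wtSpace V (μ - (j : ℝ) • (wt p - wt q)) := by
  induction j with
  | zero => simpa using hu
  | succ j ih =>
    rw [pow_succ', Module.End.mul_apply, LieModule.toEnd_apply_apply]
    have := elt_mem_wtSpace ih p q
    rwa [show μ - (j : ℝ) • (wt p - wt q) - (wt p - wt q) =
      μ - ((j + 1 : ℕ) : ℝ) • (wt p - wt q) by push_cast; module] at this

theorem lie_sub_elt_self {μ : Fin n → ℝ} {u : V} (hu : u ∈ wtSpace V μ)
    (p q : Fin (2 * n + 1)) :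
    ⁅elt p p - elt q q, u⁆ = ((μ ⬝ᵥ (wt p - wt q) : ℝ) : ℂ) • u := by
  rw [sub_lie, hu _ (isCartan_elt_self p), hu _ (isCartan_elt_self q), evalWt_elt_self,
    evalWt_elt_self, ← sub_smul, dotProduct_sub, Complex.ofReal_sub]

/-- The usual $\mathfrak{sl}_2$ computation with unnormalized $h=[e,f]$: for $\beta$ the difference
of the weights of $p$ and $q$, it acts on $f^i u$ by $(\mu,\beta)-i(\beta,\beta)$. Summing over
$i=0,\dots,j$ gives the coefficient. -/
theorem lie_swap_pow_toEnd {μ : Fin n → ℝ} {u : V} (hu : u ∈ wtSpace V μ)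
    {p q : Fin (2 * n + 1)} (h : q ≠ p.rev) (he : ⁅elt q p, u⁆ = 0) (j : ℕ) :
    ⁅elt q p, (opr (elt p q) ^ (j + 1)) u⁆ =
      (((j + 1) * (μ ⬝ᵥ (wt p - wt q) - j * ((wt p - wt q) ⬝ᵥ (wt p - wt q)) / 2) : ℝ) : ℂ) •
        (opr (elt p q) ^ j) u := by
  have key : ∀ j : ℕ, ⁅elt q p, (opr (elt p q) ^ (j + 1)) u⁆ =
      ((μ ⬝ᵥ (wt p - wt q) - j * ((wt p - wt q) ⬝ᵥ (wt p - wt q)) : ℝ) : ℂ) •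
        (opr (elt p q) ^ j) u + ⁅elt p q, ⁅elt q p, (opr (elt p q) ^ j) u⁆⁆ := by
    intro j
    rw [pow_succ', Module.End.mul_apply, LieModule.toEnd_apply_apply, leibniz_lie,
      lie_elt_swap h, lie_sub_elt_self (pow_toEnd_mem_wtSpace hu p q j), sub_dotProduct,
      smul_dotProduct, smul_eq_mul]
  induction j with
  | zero =>
    rw [key]
    simp [he]
  | succ j ih =>
    rw [key, ih, lie_smul, ← LieModule.toEnd_apply_apply ℂ (so n) V (elt p q), ← Module.End.mul_apply,
      ← pow_succ', ← add_smul]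
    congr 1
    push_cast
    ring

/-- A raising operator which is the transpose of a nilpotent lowering operator is injective on
the weight spaces on the negative side of the root. -/
theorem eq_zero_of_lie_swap_eq_zero {μ : Fin n → ℝ} {u : V} (hu : u ∈ wtSpace V μ)
    {p q : Fin (2 * n + 1)} (h : q ≠ p.rev) (he : ⁅elt q p, u⁆ = 0)
    (hneg : μ ⬝ᵥ (wt p - wt q) < 0) {N : ℕ} (hN : (opr (elt p q) ^ N) u = 0) : u = 0 := by
  induction N with
  | zero => simpa using hN
  | succ N ih =>
    apply ih
    have h1 := lie_swap_pow_toEnd hu h he N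
    rw [hN, lie_zero, eq_comm, smul_eq_zero] at h1
    refine h1.resolve_left ?_
    rw [Complex.ofReal_eq_zero]
    have h2 : 0 ≤ (wt p - wt q) ⬝ᵥ (wt p - wt q) := 
      Finset.sum_nonneg fun i _ => mul_self_nonneg _
    have h3 : (0 : ℝ) ≤ N * ((wt p - wt q) ⬝ᵥ (wt p - wt q)) := by positivity
    refine mul_ne_zero (by positivity) (by linarith)

theorem isNilpotent_elt {p q : Fin (2 * n + 1)} (hpq : p ≠ q) :
    IsNilpotent (elt p q).1 := by
  -- The square is nonzero only if $p$ or $q$ is the middle index (a short root); the cube always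
  -- vanishes.
  refine ⟨3, ?_⟩
  have h1 : q.rev ≠ p.rev := fun h2 => hpq (Fin.rev_inj.1 h2).symm
  have hrev : p = p.rev → q.rev ≠ q := by
    intro h2 h3
    apply hpq
    have h4 := congrArg Fin.val h2
    have h5 := congrArg Fin.val h3
    rw [Fin.val_rev] at h4 h5
    ext
    omega
  rw [pow_three, elt_mul_elt]
  simp only [hpq, hpq.symm, if_false, add_zero, zero_sub, mul_sub, mul_neg]
  have hA : p = p.rev → (elt p q).1 * Matrix.single q q.rev 1 = 0 := fun h2 => by
    simp [elt, sub_mul, Matrix.single_mul_single_of_ne, hpq, hrev h2]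
  have hB : q.rev = q → (elt p q).1 * Matrix.single p.rev p 1 = 0 := fun h2 => by
    have h3 : p ≠ p.rev := fun h3 => hrev h3 h2
    simp [elt, sub_mul, Matrix.single_mul_single_of_ne, h3, h1]
  split_ifs with h2 h3 h3
  · rw [hA h2, hB h3, neg_zero, sub_zero]
  · rw [hA h2, mul_zero, neg_zero, sub_zero]
  · rw [hB h3, mul_zero, neg_zero, sub_zero]
  · rw [mul_zero, neg_zero, sub_zero]

/-- A root vector that is nilpotent on the highest weight vector is locally nilpotent. -/
theorem exists_pow_toEnd_eq_zero [LieModule.IsIrreducible ℂ (so n) V] {p q : Fin (2 * n + 1)}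
    (hpq : p ≠ q) {v₀ : V} (h0 : v₀ ≠ 0) {m : ℕ}
    (hm : (opr (elt p q) ^ m) v₀ = 0) (v : V) : ∃ N, (opr (elt p q) ^ N) v = 0 := by
  have had : IsNilpotent (LieAlgebra.ad ℂ (so n) (elt p q)) :=
    LieAlgebra.isNilpotent_ad_of_isNilpotent (isNilpotent_elt hpq)
  -- Because the adjoint action of the root vector is nilpotent, its generalized null space is
  -- stable under the whole Lie algebra; by irreducibility it is everything once it contains `v₀`.
  let M : LieSubmodule ℂ (so n) V :=
    { (opr (elt p q)).maxGenEigenspace 0 with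
      lie_mem := by
        intro y v hv
        change v ∈ (opr (elt p q)).maxGenEigenspace 0 at hv
        change ⁅y, v⁆ ∈ (opr (elt p q)).maxGenEigenspace 0
        rw [← zero_add (0 : ℂ)]
        refine LieModule.lie_mem_maxGenEigenspace_toEnd ?_ hv
        obtain ⟨k, hk⟩ := had
        rw [Module.End.mem_maxGenEigenspace]
        exact ⟨k, by rw [zero_smul, sub_zero]; exact LinearMap.congr_fun hk y⟩ }
  have hmem : ∀ v, v ∈ M ↔ ∃ N, (opr (elt p q) ^ N) v = 0 := by
    intro v
    change v ∈ (opr (elt p q)).maxGenEigenspace 0 ↔ _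
    rw [Module.End.mem_maxGenEigenspace]
    simp
  rw [← hmem, (eq_bot_or_eq_top M).resolve_left]
  · trivial
  · intro hM
    have h1 := (hmem v₀).2 ⟨m, hm⟩
    rw [hM] at h1
    exact h0 (by simpa using h1)

end Ladder

/-! ### Simple roots -/

/-- The index following that of `e_i`. -/
def nxt (a : Fin n) : Fin (2 * n + 1) := ⟨a + 1, by omega⟩

theorem pos_lt_nxt (a : Fin n) : pos a < nxt a := by
  rw [Fin.lt_def]; simp [nxt]

theorem nxt_ne_rev_pos (a : Fin n) : nxt a ≠ (pos a).rev := by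
  intro h
  have := congrArg Fin.val h
  simp [nxt, Fin.val_rev] at this
  omega

theorem wt_pos_sub_wt_nxt_mem_posRoots (a : Fin n) : wt (pos a) - wt (nxt a) ∈ posRoots n :=
  wt_sub_wt_mem_posRoots (pos_lt_nxt a) (nxt_ne_rev_pos a)

theorem nxt_of_lt {a : Fin n} (h : (a : ℕ) + 1 < n) : nxt a = pos ⟨a + 1, h⟩ := rfl

theorem nxt_of_eq {a : Fin n} (h : (a : ℕ) + 1 = n) : nxt a = mid n := by
  ext; simp [nxt, h]

/-- Elements of the nilradical of the minimal parabolic subalgebra of a simple root. -/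
def IsUpperOff (a : Fin n) (x : so n) : Prop := IsUpper x ∧ x.1 (pos a) (nxt a) = 0

/-- Subtracting a simple root from a different positive root never leaves the positive roots and
never yields the simple root itself, so the nilradical is stable. -/
theorem IsUpperOff.lie_elt {a : Fin n} {x : so n} (hx : IsUpperOff a x) :
    IsUpperOff a ⁅x, elt (pos a) (nxt a)⁆ := by
  have hs : x.1 (pos a) (pos a).rev = 0 := by
    have := apply_eq_neg_rev x (pos a) (pos a).rev
    rwa [Fin.rev_rev, self_eq_neg] at this
  have hval : (nxt a : ℕ) = a + 1 := rfl
  have h1 : ∀ i, pos a ≤ i → x.1 i (nxt a) = 0 := by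
    intro i hi
    rcases hi.eq_or_lt with rfl | hi
    · exact hx.2
    · exact hx.1 _ _ (by rw [Fin.le_def]; rw [Fin.lt_def, val_pos] at hi; omega)
  have h2 : ∀ j, j ≤ nxt a → x.1 (pos a) j = 0 := by
    intro j hj
    rcases hj.eq_or_lt with rfl | hj
    · exact hx.2
    · exact hx.1 _ _ (by rw [Fin.le_def, val_pos]; rw [Fin.lt_def] at hj; omega)
  refine ⟨fun i j hij => ?_, ?_⟩
  · rw [TypeB.lie_elt_apply]
    have e1 : (if pos a = j then x.1 i (nxt a) else 0) = 0 := by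
      split_ifs with h
      · exact h1 i (h ▸ hij)
      · rfl
    have e2 : (if (nxt a).rev = j then x.1 i (pos a).rev else 0) = 0 := by
      split_ifs with h
      · rw [apply_eq_neg_rev, Fin.rev_rev, h2 i.rev, neg_zero]
        rw [Fin.rev_le_iff, h]
        exact hij
      · rfl
    have e3 : (if nxt a = i then x.1 (pos a) j else 0) = 0 := by
      split_ifs with h
      · exact h2 j (h ▸ hij)
      · rfl
    have e4 : (if (pos a).rev = i then x.1 (nxt a).rev j else 0) = 0 := by
      split_ifs with h
      · rw [apply_eq_neg_rev, Fin.rev_rev, h1 j.rev, neg_zero]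
        rw [Fin.le_rev_iff, h]
        exact hij
      · rfl
    rw [e1, e2, e3, e4]
    simp
  · rw [TypeB.lie_elt_apply, if_neg (pos_lt_nxt a).ne, if_neg (pos_lt_nxt a).ne',
      if_neg (pos_ne_rev a a).symm, hs]
    simp

section Simple

variable {V : Type*} [AddCommGroup V] [Module ℂ V] [LieRingModule (so n) V]
  [LieModule ℂ (so n) V]

local notation "opr" => LieModule.toEnd ℂ (so n) V

theorem IsUpperOff.lie_pow_toEnd {a : Fin n} {x : so n} (hx : IsUpperOff a x) {v₀ : V}
    (hv₀ : ∀ y : so n, IsUpper y → ⁅y, v₀⁆ = 0) (j : ℕ) :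
    ⁅x, (opr (elt (pos a) (nxt a)) ^ j) v₀⁆ = 0 := by
  induction j generalizing x with
  | zero => simpa using hv₀ x hx.1
  | succ j ih =>
    rw [pow_succ', Module.End.mul_apply, LieModule.toEnd_apply_apply, leibniz_lie, ih hx,
      ih hx.lie_elt, lie_zero, add_zero]

/-- The hypothesis says that `lam` takes the value `m` on the simple coroot. Then the raising
operator kills this vector by the $\mathfrak{sl}_2$ formula and the rest of $\mathfrak n$ kills it
by `IsUpperOff.lie_pow_toEnd`. It is thus singular of lower weight, which irreducibility forbids
unless it is zero. -/
theorem pow_toEnd_eq_zero_of_highest [LieModule.IsIrreducible ℂ (so n) V] {lam : Fin n → ℝ}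
    {v₀ : V} (hv₀ : IsHighestWeightVector lam v₀) (a : Fin n) {m : ℕ}
    (hm : lam ⬝ᵥ (wt (pos a) - wt (nxt a)) =
      m * ((wt (pos a) - wt (nxt a)) ⬝ᵥ (wt (pos a) - wt (nxt a))) / 2) :
    (opr (elt (pos a) (nxt a)) ^ (m + 1)) v₀ = 0 := by
  have hmem := pow_toEnd_mem_wtSpace hv₀.1.2 (pos a) (nxt a) (m + 1)
  refine IsBorelEigen.eq_zero_of_height_pos (n := n) hv₀.1.1 hv₀.1.2 ?_ hmem ?_
  · intro x hx
    obtain ⟨y, z, hy, hz, rfl⟩ := exists_cartan_add_upper hx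
    set c := z.1 (pos a) (nxt a)
    have hup := isUpper_elt (pos_lt_nxt a)
    have hz' : IsUpperOff a (z - c • elt (nxt a) (pos a)) := by
      refine ⟨fun i j hij => ?_, ?_⟩
      · change z.1 i j - c * (elt (nxt a) (pos a)).1 i j = 0
        rw [hz i j hij, hup i j hij, mul_zero, sub_zero]
      · change z.1 _ _ - c * (elt (nxt a) (pos a)).1 _ _ = 0
        rw [elt_apply, if_pos ⟨rfl, rfl⟩, if_neg fun h => nxt_ne_rev_pos a h.2.symm]
        simp [c]
    have he : ⁅elt (nxt a) (pos a), (opr (elt (pos a) (nxt a)) ^ (m + 1)) v₀⁆ = 0 := by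
      rw [lie_swap_pow_toEnd hv₀.1.2 (nxt_ne_rev_pos a) (hv₀.2 _ hup), hm, sub_self]
      simp
    have hzv := hz'.lie_pow_toEnd hv₀.2 (m + 1)
    rw [sub_lie, smul_lie, he, smul_zero, sub_zero] at hzv
    exact ⟨_, by rw [add_lie, hzv, add_zero]; exact hmem y hy⟩
  · rw [height_sub]
    have h1 := height_pos_of_mem_posRoots (wt_pos_sub_wt_nxt_mem_posRoots a)
    have h2 : height (((m + 1 : ℕ) : ℝ) • (wt (pos a) - wt (nxt a))) =
        ((m + 1 : ℕ) : ℝ) * height (wt (pos a) - wt (nxt a)) := by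
      simp only [height, Pi.smul_apply, smul_eq_mul, Finset.mul_sum]
      exact Finset.sum_congr rfl fun i _ => by ring
    rw [h2]
    have : 0 < ((m + 1 : ℕ) : ℝ) * height (wt (pos a) - wt (nxt a)) := by positivity
    linarith

end Simple

end

/-! ### The spin case $k=n$ and the conclusion -/

noncomputable section

variable {n : ℕ}

/-! ### The spin representation -/

/-- The weights `(±1/2, …, ±1/2)`, with the minus signs on the places in `T`. -/
def spinWt (T : Finset (Fin n)) : Fin n → ℝ := fun j => if j ∈ T then -1 / 2 else 1 / 2

theorem spinWt_empty : spinWt (∅ : Finset (Fin n)) = fundWeight n n := by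
  ext j; simp [spinWt, fundWeight]

theorem spinWt_insert {T : Finset (Fin n)} {a : Fin n} (ha : a ∉ T) :
    spinWt (insert a T) = spinWt T - eps a := by
  ext j
  rcases eq_or_ne j a with rfl | h
  · simp [spinWt, eps, ha]; norm_num
  · simp [spinWt, eps, h]

theorem spinWt_dotProduct_eps (T : Finset (Fin n)) (a : Fin n) :
    spinWt T ⬝ᵥ eps a = spinWt T a := by
  simp [eps]

/-- Every set other than the empty one has an element not followed by another element. -/
theorem exists_mem_succ_notMem {T : Finset (Fin n)} (hT : T.Nonempty) :
    ∃ a ∈ T, ∀ h : (a : ℕ) + 1 < n, (⟨a + 1, h⟩ : Fin n) ∉ T := by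
  refine ⟨T.max' hT, T.max'_mem hT, fun h hmem => ?_⟩
  have := T.le_max' _ hmem
  rw [Fin.le_def] at this
  simp at this

section Spin

variable {V : Type*} [AddCommGroup V] [Module ℂ V] [LieRingModule (so n) V]
  [LieModule ℂ (so n) V]

local notation "opr" => LieModule.toEnd ℂ (so n) V

theorem exists_pow_toEnd_simple_eq_zero [LieModule.IsIrreducible ℂ (so n) V] {v₀ : V}
    (hv₀ : IsHighestWeightVector (fundWeight n n) v₀) (a : Fin n) (v : V) :
    ∃ N, (opr (elt (pos a) (nxt a)) ^ N) v = 0 := by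
  suffices h : ∃ m : ℕ, fundWeight n n ⬝ᵥ (wt (pos a) - wt (nxt a)) =
      m * ((wt (pos a) - wt (nxt a)) ⬝ᵥ (wt (pos a) - wt (nxt a))) / 2 by
    obtain ⟨m, hm⟩ := h
    exact exists_pow_toEnd_eq_zero (pos_lt_nxt a).ne hv₀.1.1
      (pow_toEnd_eq_zero_of_highest hv₀ a hm) v
  rcases Nat.lt_or_ge (a + 1) n with h | h
  -- $\omega_n$ is orthogonal to every simple root $\varepsilon_a-\varepsilon_{a+1}$ and takes the
  -- value 1 on the coroot of the short one, $\varepsilon_n$.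
  · refine ⟨0, ?_⟩
    rw [nxt_of_lt h, wt_pos, wt_pos, ← spinWt_empty, dotProduct_sub, spinWt_dotProduct_eps,
      spinWt_dotProduct_eps]
    simp [spinWt]
  · refine ⟨1, ?_⟩
    rw [nxt_of_eq (by omega), wt_pos, wt_mid, sub_zero, ← spinWt_empty, spinWt_dotProduct_eps]
    simp [spinWt, eps]

/-- The extremal weight spaces of the spin representation are lines. -/
theorem mem_span_singleton_of_mem_wtSpace_spinWt [LieModule.IsIrreducible ℂ (so n) V] {v₀ : V}
    (hv₀ : IsHighestWeightVector (fundWeight n n) v₀) (T : Finset (Fin n)) {u v : V}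
    (hu : u ∈ wtSpace V (spinWt T)) (hu0 : u ≠ 0) (hv : v ∈ wtSpace V (spinWt T)) :
    v ∈ Submodule.span ℂ {u} := by
  -- A simple raising operator shifts a minus sign one place to the right, or removes it from the
  -- last place. Either way this sum decreases.
  induction hN : ∑ j ∈ T, (n - (j : ℕ)) using Nat.strong_induction_on generalizing T u v with
  | _ N ih =>
  rcases T.eq_empty_or_nonempty with rfl | hT
  · rw [spinWt_empty] at hu hv
    have key : ∀ w ∈ wtSpace V (fundWeight n n), ∃ c : ℂ, c • v₀ = w := by
      intro w hw
      obtain ⟨s, hs⟩ := hv₀.isBorelEigen.exists_mem_pbwFiltration hv₀.1.1 w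
      exact Submodule.mem_span_singleton.1 (mem_span_singleton_of_mem_pbwFiltration hv₀.1.2 hs hw)
    obtain ⟨c, rfl⟩ := key u hu
    obtain ⟨d, rfl⟩ := key v hv
    have hc : c ≠ 0 := fun h => hu0 (by rw [h, zero_smul])
    exact Submodule.mem_span_singleton.2 ⟨d / c, by rw [smul_smul, div_mul_cancel₀ _ hc]⟩
  obtain ⟨a, ha, hnext⟩ := exists_mem_succ_notMem hT
  have hTa : spinWt T = spinWt (T.erase a) - eps a := by
    rw [← spinWt_insert (Finset.notMem_erase a T), Finset.insert_erase ha]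
  have hdota : spinWt T ⬝ᵥ eps a = -1 / 2 := by
    rw [spinWt_dotProduct_eps, spinWt, if_pos ha]
  obtain ⟨T', hT', hneg, hlt⟩ : ∃ T' : Finset (Fin n),
      spinWt T - (wt (nxt a) - wt (pos a)) = spinWt T' ∧
      spinWt T ⬝ᵥ (wt (pos a) - wt (nxt a)) < 0 ∧
      ∑ j ∈ T', (n - (j : ℕ)) < ∑ j ∈ T, (n - (j : ℕ)) := by
    have ha' := a.2
    rcases Nat.lt_or_ge (a + 1) n with h | h
    · have hb : (⟨a + 1, h⟩ : Fin n) ∉ T.erase a := fun hb => hnext h (Finset.mem_of_mem_erase hb)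
      refine ⟨insert ⟨a + 1, h⟩ (T.erase a), ?_, ?_, ?_⟩
      · rw [spinWt_insert hb, hTa, nxt_of_lt h, wt_pos, wt_pos]
        abel
      · rw [nxt_of_lt h, wt_pos, wt_pos, dotProduct_sub, hdota, spinWt_dotProduct_eps, spinWt,
          if_neg (hnext h)]
        norm_num
      · rw [Finset.sum_insert hb, ← Finset.add_sum_erase T _ ha]
        refine Nat.add_lt_add_right ?_ _
        simp only
        omega
    · refine ⟨T.erase a, ?_, ?_, ?_⟩
      · rw [hTa, nxt_of_eq (by omega), wt_pos, wt_mid]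
        abel
      · rw [nxt_of_eq (by omega), wt_pos, wt_mid, sub_zero, hdota]
        norm_num
      · rw [← Finset.add_sum_erase T _ ha]
        omega
  -- The weight is negative on the chosen simple root and the lowering operator is locally
  -- nilpotent, so raising is injective here and the line property descends from `T'` to `T`.
  have hinj : ∀ w ∈ wtSpace V (spinWt T), ⁅elt (nxt a) (pos a), w⁆ = 0 → w = 0 := by
    intro w hw hw0
    obtain ⟨N, hN⟩ := exists_pow_toEnd_simple_eq_zero hv₀ a w
    exact eq_zero_of_lie_swap_eq_zero hw (nxt_ne_rev_pos a) hw0 hneg hN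
  have hmap : ∀ w ∈ wtSpace V (spinWt T), ⁅elt (nxt a) (pos a), w⁆ ∈ wtSpace V (spinWt T') := by
    intro w hw
    rw [← hT']
    exact elt_mem_wtSpace hw _ _
  obtain ⟨c, hc⟩ := Submodule.mem_span_singleton.1 <|
    ih _ (hN ▸ hlt) T' (hmap u hu) (fun h => hu0 (hinj u hu h)) (hmap v hv) rfl
  refine Submodule.mem_span_singleton.2 ⟨c, ?_⟩
  rw [← sub_eq_zero]
  refine hinj _ (Submodule.sub_mem _ (Submodule.smul_mem _ _ hu) hv) ?_
  rw [lie_sub, lie_smul, hc, sub_self]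

/-- When $eu=0$, applying $e$ to $fu$ gives a nonzero multiple of $u$. -/
theorem lie_ne_zero_of_dotProduct_ne_zero {μ : Fin n → ℝ} {u : V} (hu : u ∈ wtSpace V μ)
    (hu0 : u ≠ 0) {p q : Fin (2 * n + 1)} (h : q ≠ p.rev) (he : ⁅elt q p, u⁆ = 0)
    (hμ : μ ⬝ᵥ (wt p - wt q) ≠ 0) : ⁅elt p q, u⁆ ≠ 0 := by
  intro h0
  have := lie_swap_pow_toEnd hu h he 0
  rw [zero_add, pow_one, pow_zero, LieModule.toEnd_apply_apply, h0, lie_zero, eq_comm,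
    Module.End.one_apply, smul_eq_zero_iff_left hu0, Complex.ofReal_eq_zero] at this
  exact hμ (by simpa using this)

/-- The extremal vectors with an even number `2m` of minus signs are obtained from the highest
weight vector by `m` commuting root vectors; the remaining abelian nilradical kills them. -/
theorem exists_spin_vector_even {v₀ : V} (hv₀ : IsHighestWeightVector (fundWeight n n) v₀) (m : ℕ)
    {T : Finset (Fin n)} (hT : T.card = 2 * m) :
    ∃ y : V, y ≠ 0 ∧ y ∈ wtSpace V (spinWt T) ∧ y ∈ pbwFiltration n v₀ m ∧
      (∀ a ∉ T, ∀ b ∉ T, ⁅elt (pos b).rev (pos a), y⁆ = 0) ∧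
      ∀ a ∉ T, ⁅elt (mid n) (pos a), y⁆ = 0 := by
  induction m generalizing T with
  | zero =>
    obtain rfl : T = ∅ := by simpa using hT
    refine ⟨v₀, hv₀.1.1, by rw [spinWt_empty]; exact hv₀.1.2, self_mem_pbwFiltration _ _, ?_, ?_⟩
    · intro a _ b _
      refine hv₀.2 _ (isUpper_elt ?_)
      rw [Fin.lt_def, Fin.val_rev, val_pos, val_pos]
      omega
    · intro a _
      refine hv₀.2 _ (isUpper_elt ?_)
      rw [Fin.lt_def, val_mid, val_pos]
      omega
  | succ m ih =>
    obtain ⟨a, ha⟩ : T.Nonempty := Finset.card_pos.1 (by omega)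
    have hcard := Finset.card_erase_of_mem ha
    obtain ⟨b, hb⟩ : (T.erase a).Nonempty := Finset.card_pos.1 (by omega)
    have hcard' := Finset.card_erase_of_mem hb
    obtain ⟨hba, hbT⟩ := Finset.mem_erase.1 hb
    obtain ⟨y, hy0, hy, hyF, hy1, hy2⟩ := ih (T := (T.erase a).erase b) (by omega)
    have ha' : a ∉ (T.erase a).erase b := fun h =>
      Finset.notMem_erase a T (Finset.mem_of_mem_erase h)
    have hb' : b ∉ (T.erase a).erase b := Finset.notMem_erase _ _
    have hsub : ∀ c ∉ T, c ∉ (T.erase a).erase b := fun c hc h =>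
      hc (Finset.mem_of_mem_erase (Finset.mem_of_mem_erase h))
    have hne : (pos b).rev ≠ (pos a).rev := fun h => hba (pos_injective (Fin.rev_inj.1 h))
    have hwt : wt (pos a) - wt (pos b).rev = eps a + eps b := by
      rw [wt_rev, wt_pos, wt_pos, sub_neg_eq_add]
    refine ⟨⁅elt (pos a) (pos b).rev, y⁆, ?_, ?_, ?_, ?_, ?_⟩
    · refine lie_ne_zero_of_dotProduct_ne_zero hy hy0 hne (hy1 a ha' b hb') ?_
      rw [hwt, dotProduct_add, spinWt_dotProduct_eps, spinWt_dotProduct_eps, spinWt, spinWt,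
        if_neg ha', if_neg hb']
      norm_num
    · have := elt_mem_wtSpace hy (pos a) (pos b).rev
      rwa [hwt, add_comm, ← sub_sub, ← spinWt_insert hb', Finset.insert_erase hb,
        ← spinWt_insert (Finset.notMem_erase a T), Finset.insert_erase ha] at this
    · refine elt_lie_mem_pbwFiltration ?_ hyF
      rw [Fin.lt_def, Fin.val_rev, val_pos, val_pos]
      omega
    · intro c hc d hd
      have hca : c ≠ a := fun h => hc (h ▸ ha)
      have hcb : c ≠ b := fun h => hc (h ▸ hbT)
      have hda : d ≠ a := fun h => hd (h ▸ ha)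
      have hdb : d ≠ b := fun h => hd (h ▸ hbT)
      -- Raising operators with indices off `T` commute with the new root vector, whose indices are
      -- in `T`, so the annihilation property persists.
      rw [leibniz_lie, hy1 c (hsub c hc) d (hsub d hd), lie_zero, add_zero,
        lie_elt_eq_zero, zero_lie]
      · exact fun h => hdb (pos_injective (Fin.rev_inj.1 h))
      · exact fun h => hca (pos_injective h)
      · exact fun h => hda (pos_injective (Fin.rev_inj.1 h))
      · rw [Fin.rev_rev]
        exact fun h => hcb (pos_injective h)
    · intro c hc
      have hca : c ≠ a := fun h => hc (h ▸ ha)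
      have hcb : c ≠ b := fun h => hc (h ▸ hbT)
      rw [leibniz_lie, hy2 c (hsub c hc), lie_zero, add_zero, lie_elt_eq_zero, zero_lie]
      · exact (rev_pos_ne_mid b).symm
      · exact fun h => hca (pos_injective h)
      · exact (rev_pos_ne_mid a).symm
      · rw [Fin.rev_rev]
        exact fun h => hcb (pos_injective h)

/-- Minus signs are created two at a time by the roots $\varepsilon_a+\varepsilon_b$; a leftover one
costs one more root vector, of $-\varepsilon_a$. -/
theorem exists_spin_vector {v₀ : V} (hv₀ : IsHighestWeightVector (fundWeight n n) v₀)
    (T : Finset (Fin n)) :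
    ∃ y : V, y ≠ 0 ∧ y ∈ wtSpace V (spinWt T) ∧ y ∈ pbwFiltration n v₀ ((T.card + 1) / 2) := by
  rcases Nat.even_or_odd' T.card with ⟨m, hm | hm⟩
  · obtain ⟨y, hy0, hy, hyF, -⟩ := exists_spin_vector_even hv₀ m hm
    exact ⟨y, hy0, hy, by rwa [show (T.card + 1) / 2 = m by omega]⟩
  · obtain ⟨a, ha⟩ : T.Nonempty := Finset.card_pos.1 (by omega)
    have hcard := Finset.card_erase_of_mem ha
    have ha' := Finset.notMem_erase a T
    obtain ⟨y, hy0, hy, hyF, -, hy2⟩ := exists_spin_vector_even hv₀ m (T := T.erase a) (by omega)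
    refine ⟨⁅elt (pos a) (mid n), y⁆, ?_, ?_, ?_⟩
    · refine lie_ne_zero_of_dotProduct_ne_zero hy hy0 (rev_pos_ne_mid a).symm (hy2 a ha') ?_
      rw [wt_pos, wt_mid, sub_zero, spinWt_dotProduct_eps, spinWt, if_neg ha']
      norm_num
    · have := elt_mem_wtSpace hy (pos a) (mid n)
      rwa [wt_pos, wt_mid, sub_zero, ← spinWt_insert ha', Finset.insert_erase ha] at this
    · rw [show (T.card + 1) / 2 = m + 1 by omega]
      refine elt_lie_mem_pbwFiltration ?_ hyF
      rw [Fin.lt_def, val_mid, val_pos]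
      omega

theorem SignedPerm.act_fundWeight_self (w : SignedPerm n) :
    ∃ T, w.act (fundWeight n n) = spinWt T := by
  refine ⟨Finset.univ.filter fun j => w.sign (w.perm.symm j) = -1, ?_⟩
  ext j
  obtain ⟨i, rfl⟩ := w.perm.surjective j
  rw [w.act_apply, spinWt]
  rcases Int.units_eq_one_or (w.sign i) with h | h <;> simp [h, fundWeight]
  norm_num

theorem pbwDegree_self [LieModule.IsIrreducible ℂ (so n) V] {v₀ v : V}
    (hv₀ : IsHighestWeightVector (fundWeight n n) v₀) (w : SignedPerm n)
    (hv : IsWeightVector (w.act (fundWeight n n)) v) :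
    ∃ N : ℕ, IsLeast (decompositionLengths (fundWeight n n - w.act (fundWeight n n))) N ∧
      HasPBWDegree n v₀ v N := by
  obtain ⟨T, hT⟩ := w.act_fundWeight_self
  rw [hT] at hv ⊢
  obtain ⟨y, hy0, hy, hyF⟩ := exists_spin_vector hv₀ T
  refine ⟨_, hasPBWDegree_of_le hv₀.1.2 hv ((Submodule.span_singleton_le_iff_mem _ _).2 hyF
    (mem_span_singleton_of_mem_wtSpace_spinWt hv₀ T hy hy0 hv.2)) fun M hM => ?_⟩
  -- The weight difference has $\ell^1$-norm $|T|$ and each root at most 2, so at least $\lceil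
  -- |T|/2\rceil$ roots are needed.
  have h1 := sum_abs_le_of_mem_decompositionLengths hM
  have h2 : ∑ a, |(fundWeight n n - spinWt T) a| = (T.card : ℝ) := by
    rw [← spinWt_empty, Finset.card_eq_sum_ones, Nat.cast_sum, ← Finset.sum_subset T.subset_univ]
    · refine Finset.sum_congr rfl fun j hj => ?_
      norm_num [spinWt, hj]
    · intro j _ hj
      simp [spinWt, hj]
  rw [h2] at h1
  have h3 : T.card ≤ 2 * M := by exact_mod_cast h1
  omega

end Spin

end

end TypeB

theorem proposition5p7 (n k : ℕ) (hk1 : 1 ≤ k) (hkn : k ≤ n)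
    {V : Type*} [AddCommGroup V] [Module ℂ V] [LieRingModule (TypeB.so n) V]
    [LieModule ℂ (TypeB.so n) V] [LieModule.IsIrreducible ℂ (TypeB.so n) V]
    (v₀ : V) (hv₀ : TypeB.IsHighestWeightVector (TypeB.fundWeight n k) v₀)
    (w : TypeB.SignedPerm n)
    (v : V) (hv : TypeB.IsWeightVector (w.act (TypeB.fundWeight n k)) v) :
    ∃ N : ℕ,
      IsLeast (TypeB.decompositionLengths
        (TypeB.fundWeight n k - w.act (TypeB.fundWeight n k))) N ∧
      (¬ TypeB.IsExceptional hkn v → TypeB.HasPBWDegree n v₀ v N) ∧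
      (TypeB.IsExceptional hkn v → TypeB.HasPBWDegree n v₀ v (N + 1)) := by
  rcases hkn.lt_or_eq with hk | rfl
  · exact TypeB.pbwDegree_of_lt hk hv₀ w hv
  · obtain ⟨N, hN, hdeg⟩ := TypeB.pbwDegree_self hv₀ w hv
    exact ⟨N, hN, fun _ => hdeg, fun h => absurd h.2.1 (lt_irrefl _)⟩
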